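/- For positive integers $N,r$ let $S_{N,r}$ be the set of $r$-tuples of odd integers $n_i\ge 3$ with $n_1+\dots+n_r=N$. Let $\mathbf V_{N,r}\subset\mathbb Q[x_1,\dots,x_r]$ be the span of the monomials $x_1^{n_1-1}\cdots x_r^{n_r-1}$ with $(n_1,\dots,n_r)\in S_{N,r}$, let $\pi(P)=(a_n)_{n\in S_{N,r}}$ be the row vector of coefficients of $P=\sum_{n\in S_{N,r}} a_n x_1^{n_1-1}\cdots x_r^{n_r-1}\in\mathbf V_{N,r}$, and, for $r\ge 2$, let $$\mathbf W_{N,r}=\{P\in\mathbf V_{N,r} : P(x_1,\dots,x_r)=P(x_2-x_1,x_2,x_3,\dots,x_r)-P(x_2-x_1,x_1,x_3,\dots,x_r)\}.$$ For integers $m_i,n_i\ge1$ let $e\binom{m_1,\dots,m_r}{n_1,\dots,n_r}$ be the coefficient of $x_1^{n_1-1}\cdots x_r^{n_r-1}$ in $x_1^{m_1-1}\,\underline{\circ}\,(x_1^{m_2-1}\cdots x_{r-1}^{m_r-1})$, where for a monomial $f\in\mathbb Q[x_1]$ and a polynomial $g$ in $r-1$ variables $$(f\,\underline{\circ}\,g)(x_1,\dots,x_r)=f(x_1)g(x_2,\dots,x_r)+\sum_{i=1}^{r-1}\Bigl(f(x_{i+1}-x_i)\,g(x_1,\dots,\widehat{x_{i+1}},\dots,x_r)-(-1)^{\deg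 f}f(x_i-x_{i+1})\,g(x_1,\dots,\widehat{x_i},\dots,x_r)\Bigr).$$ Define matrices with rows $m$ and columns $n$ in $S_{N,r}$ by $E_{N,r}=\bigl(e\binom{m_1,\dots,m_r}{n_1,\dots,n_r}\bigr)$, by $E_{N,r}^{(j)}=\bigl(\delta_{(m_1,\dots,m_{r-j}),(n_1,\dots,n_{r-j})}\,e\binom{m_{r-j+1},\dots,m_r}{n_{r-j+1},\dots,n_r}\bigr)$ for $2\le j\le r$, and by $C_{N,r}=E_{N,r}^{(2)}E_{N,r}^{(3)}\cdots E_{N,r}^{(r-1)}E_{N,r}$. For a matrix $A$, $\ker A$ denotes the space of its right annihilators. Put $$\mathbb O(x)=\frac{x^3}{1-x^2},\qquad \mathbb S(x)=\frac{x^{12}}{(1-x^4)(1-x^6)}.$$ Assume that for all $r\ge2$ and all $N$ Tasaka's map $\mathbf W_{N,r}\to\ker{}^tE_{N,r}$, $P\mapsto\pi(P)(E_{N,r}-\mathrm{id})$, is injective. Then Tasaka's map is an isomorphism for $r=3$ and all $N$ if and only if $$\sum_{N>0}\dim_{\mathbb Q}\ker{}^tE_{N,3}\,x^N=\mathbb O(x)\,\mathbb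 S(x),$$ and if this holds, then $$\sum_{N>0}\dim_{\mathbb Q}\ker C_{N,5}\,x^N\ \ge\ 4\,\mathbb O(x)^3\,\mathbb S(x)-3\,\mathbb O(x)\,\mathbb S(x)^2,$$ meaning that for every $N$ the coefficient of $x^N$ on the right does not exceed that on the left. -/

import Mathlib

noncomputable section

namespace TotallyOdd

/-- The totally odd index set `S_{N,r}`: tuples of odd integers `≥ 3` with sum `N`. -/
def oddIndices (N r : ℕ) : Finset (Fin r → ℕ) :=
  (Finset.Nat.antidiagonalTuple r N).filter fun n => ∀ i, 3 ≤ n i ∧ Odd (n i)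

/-- `S_{N,r}` as a type, used to index rows and columns of matrices. -/
abbrev Idx (N r : ℕ) : Type := ↥(oddIndices N r)

/-- The exponent vector of `x₁^{m₁-1} ⋯ x_r^{m_r-1}`. -/
def expo {r : ℕ} (m : Fin r → ℕ) : Fin r →₀ ℕ :=
  Finsupp.equivFunOnFinite.symm fun i => m i - 1

/-- The space `V_{N,r}` of restricted totally even homogeneous polynomials. -/
def V (N r : ℕ) : Submodule ℚ (MvPolynomial (Fin r) ℚ) :=
  Submodule.span ℚ (Set.range fun m : Idx N r => MvPolynomial.monomial (expo m.1) (1 : ℚ))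

/-- The coefficient vector `(a_n)_{n ∈ S_{N,r}}` of a polynomial; on `V_{N,r}` this is the natural
isomorphism `π` onto the vectors indexed by `S_{N,r}`. -/
def coeffVec (N r : ℕ) : MvPolynomial (Fin r) ℚ →ₗ[ℚ] (Idx N r → ℚ) :=
  LinearMap.pi fun n => MvPolynomial.lcoeff ℚ (expo n.1)

/-- The substitution `P ↦ P(x₂ - x₁, x₂, x₃, …, x_r)`. -/
def substA (r : ℕ) (hr : 2 ≤ r) : MvPolynomial (Fin r) ℚ →ₐ[ℚ] MvPolynomial (Fin r) ℚ :=
  MvPolynomial.aeval fun i =>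
    if (i : ℕ) = 0 then MvPolynomial.X ⟨1, by omega⟩ - MvPolynomial.X ⟨0, by omega⟩
    else MvPolynomial.X i

/-- The substitution `P ↦ P(x₂ - x₁, x₁, x₃, …, x_r)`. -/
def substB (r : ℕ) (hr : 2 ≤ r) : MvPolynomial (Fin r) ℚ →ₐ[ℚ] MvPolynomial (Fin r) ℚ :=
  MvPolynomial.aeval fun i =>
    if (i : ℕ) = 0 then MvPolynomial.X ⟨1, by omega⟩ - MvPolynomial.X ⟨0, by omega⟩
    else if (i : ℕ) = 1 then MvPolynomial.X ⟨0, by omega⟩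
    else MvPolynomial.X i

/-- The space `W_{N,r}` of all `P ∈ V_{N,r}` with
`P(x₁, …, x_r) = P(x₂ - x₁, x₂, x₃, …, x_r) - P(x₂ - x₁, x₁, x₃, …, x_r)`. -/
def W (N r : ℕ) (hr : 2 ≤ r) : Submodule ℚ (MvPolynomial (Fin r) ℚ) :=
  V N r ⊓ LinearMap.eqLocus LinearMap.id ((substA r hr).toLinearMap - (substB r hr).toLinearMap)

/-- The polynomial representation of the Ihara action,
`f(x₁) g(x₂, …, x_r) + ∑_{i=1}^{r-1} (f(x_{i+1} - x_i) g(x₁, …, x̂_{i+1}, …, x_r)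
  - (-1)^{deg f} f(x_i - x_{i+1}) g(x₁, …, x̂_i, …, x_r))`, where `r = s + 1`.
Because of the sign `(-1)^{deg f}` it is only meant for homogeneous `f`; below `f` is a monomial. -/
def ihara {s : ℕ} (f : Polynomial ℚ) (g : MvPolynomial (Fin s) ℚ) :
    MvPolynomial (Fin (s + 1)) ℚ :=
  Polynomial.aeval (MvPolynomial.X 0) f * MvPolynomial.rename Fin.succ g +
    ∑ i : Fin s,
      (Polynomial.aeval (MvPolynomial.X i.succ - MvPolynomial.X i.castSucc) f *
          MvPolynomial.rename (Fin.succAbove i.succ) g -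
        (-1) ^ f.natDegree *
          Polynomial.aeval (MvPolynomial.X i.castSucc - MvPolynomial.X i.succ) f *
          MvPolynomial.rename (Fin.succAbove i.castSucc) g)

/-- The number `e(m₁, …, m_r; n₁, …, n_r)`: the coefficient of `x₁^{n₁-1} ⋯ x_r^{n_r-1}` in the Ihara
action of `x₁^{m₁-1}` on `x₁^{m₂-1} ⋯ x_{r-1}^{m_r-1}`. (Only `r ≥ 1` is relevant.) -/
def e : {r : ℕ} → (Fin r → ℕ) → (Fin r → ℕ) → ℚ
  | 0, _, _ => 0
  | _ + 1, m, n =>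
    MvPolynomial.coeff (expo n)
      (ihara (Polynomial.X ^ (m 0 - 1))
        (MvPolynomial.monomial (expo fun i => m i.succ) (1 : ℚ)))

/-- The matrix `E_{N,r}`. -/
def E (N r : ℕ) : Matrix (Idx N r) (Idx N r) ℚ :=
  Matrix.of fun m n => e m.1 n.1

/-- The last `j` entries `(m_{r-j+1}, …, m_r)` of an `r`-tuple. -/
def lastEntries {r j : ℕ} (h : j ≤ r) (m : Fin r → ℕ) : Fin j → ℕ :=
  fun i => m ⟨r - j + i, by omega⟩

/-- The matrix `E_{N,r}^{(j)}` (only `2 ≤ j ≤ r` is relevant; it is set to `0` for `j > r`). -/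
def Ej (N r j : ℕ) : Matrix (Idx N r) (Idx N r) ℚ :=
  Matrix.of fun m n =>
    if h : j ≤ r then
      if ∀ i : Fin r, (i : ℕ) < r - j → m.1 i = n.1 i then
        e (lastEntries h m.1) (lastEntries h n.1)
      else 0
    else 0

/-- The matrix `C_{N,r} = E_{N,r}^{(2)} E_{N,r}^{(3)} ⋯ E_{N,r}^{(r-1)} E_{N,r}`;
`List.range' 2 (r - 2)` is the list `[2, 3, …, r - 1]`. -/
def C (N r : ℕ) : Matrix (Idx N r) (Idx N r) ℚ :=
  ((List.range' 2 (r - 2)).map fun j => Ej N r j).prod * E N r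

/-- The space of right annihilators of a square matrix. -/
def rightKer {ι : Type} [Fintype ι] (A : Matrix ι ι ℚ) : Submodule ℚ (ι → ℚ) :=
  LinearMap.ker A.mulVecLin

/-- Tasaka's map `P ↦ π(P) F_{N,r}` on `W_{N,r}`, with `F_{N,r} = E_{N,r} - id`, as a map into the
space of all row vectors indexed by `S_{N,r}`. -/
def tasakaMap (N r : ℕ) (hr : 2 ≤ r) : W N r hr →ₗ[ℚ] (Idx N r → ℚ) :=
  (Matrix.vecMulLinear (E N r - 1)).comp ((coeffVec N r).comp (W N r hr).subtype)

/-- For all weights `N`, Tasaka's map in depth `r` is an isomorphism from `W_{N,r}` onto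
`ker ᵗE_{N,r}`. -/
def TasakaIso (r : ℕ) (hr : 2 ≤ r) : Prop :=
  ∀ N : ℕ, Function.Injective (tasakaMap N r hr) ∧
    LinearMap.range (tasakaMap N r hr) = rightKer (E N r).transpose

/-- The formal power series `∑_{N > 0} d(N) x^N`. -/
def genSeries (d : ℕ → ℕ) : PowerSeries ℚ :=
  PowerSeries.mk fun N => if 0 < N then (d N : ℚ) else 0

/-- `𝕆(x) = x³ / (1 - x²)`. -/
def oddSeries : PowerSeries ℚ :=
  PowerSeries.X ^ 3 * (1 - PowerSeries.X ^ 2)⁻¹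

/-- `𝕊(x) = x¹² / ((1 - x⁴)(1 - x⁶))`. -/
def cuspSeries : PowerSeries ℚ :=
  PowerSeries.X ^ 12 * ((1 - PowerSeries.X ^ 4) * (1 - PowerSeries.X ^ 6))⁻¹

end TotallyOdd

end

noncomputable section

namespace TotallyOdd

open MvPolynomial

/-! Row vectors indexed by `S_{N,r}` are viewed as elements of weight `N` and depth `r` in the free
algebra on the odd letters `n ≥ 3`. Row multiplication by `E_{N,r}` then becomes one map `act`,
sending `a w` to `a w + ∂_a w`, where `∂_a` (`der a`) is a derivation. `E_{N,r}^{(j)}` becomes `act`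
applied to the last `j` letters, and `C_{N,5}` becomes `fullAct`, the composite of the actions of
all letters.

Let `P ∈ W_{N,2}`, and for a word `w` sum over the coefficients of `P`. The three-term relation says
that applying `∂_a` to the letter `b` sums to `-P` (`bisum_pairAct`), and it forces `∂_b ∂_a` to sum
to zero (`bisum_der_der`). Writing `1 ⊗ act` for `tailMap act`, this yields `act (P w) + (1 ⊗ act)(P
w) = P w` and `act ((1 ⊗ act)(P w)) = 0` (`act_add_tailMap_act`, `act_tailMap_act`). Since the
relation involves only the first two variables, `W_{N,r}` is the weight `N` part of `W_2 ⊗ (words of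
length r - 2)` (`tens_Period`).

In depth 3, Tasaka's map is `z ↦ act z - z = -(1 ⊗ act) z`, so its image lies in the left kernel of
`E_{N,3}`. Given injectivity, it is an isomorphism exactly when the dimensions agree, and `dim
W_{N,3}` has generating series `𝕆 𝕊` once `dim W_{N,2}` is known to have series `𝕊`. The latter
comes from the action of the symmetric group `S₃` on binary forms of even degree: `W_{N,2}` is the
kernel of the sum over rotations on antisymmetric even forms without extreme monomials. The image of
that sum is the whole sign-isotypic part (`Alt_le_range`), whose dimension is found by dividing by a
discriminant (`finrank_Alt`).

For depth 5, let `K_r` be the generating series of the kernel of `fullAct` in depth `r`. This kernel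
contains letters ⊗ kernel and `W_2` ⊗ words, and by injectivity of Tasaka's map these meet inside
`W_2` ⊗ kernel. Hence `K_{r+2} + 𝕊 K_r ≥ 𝕆 K_{r+1} + 𝕊 𝕆^r` (`kerDim_add_le`). From `K_0 = K_1 = 0`,
the cases `r = 3, 2, 1, 0` with the multipliers `1`, `𝕆`, `𝕆² - 𝕊`, `𝕆 (𝕆² - 2𝕊)` add up to the
bound; the multipliers have nonnegative coefficients because `2 dim W_{N,2} ≤ |S_{N,2}|`. -/

/-! ### Binary forms and the action of `S₃` in even degree -/

/-- Binary forms: the substitution `P ↦ P(x - y, x)`. -/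
def rot : MvPolynomial (Fin 2) ℚ →ₐ[ℚ] MvPolynomial (Fin 2) ℚ := aeval ![X 0 - X 1, X 0]

/-- Binary forms: the substitution `P ↦ P(y, x)`. -/
def flp : MvPolynomial (Fin 2) ℚ →ₐ[ℚ] MvPolynomial (Fin 2) ℚ := aeval ![X 1, X 0]

@[simp] lemma rot_X_zero : rot (X 0) = X 0 - X 1 := by simp [rot]
@[simp] lemma rot_X_one : rot (X 1) = X 0 := by simp [rot]
@[simp] lemma flp_X_zero : flp (X 0) = X 1 := by simp [flp]
@[simp] lemma flp_X_one : flp (X 1) = X 0 := by simp [flp]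

/-- Binary forms of degree `d`. -/
abbrev Forms (d : ℕ) : Submodule ℚ (MvPolynomial (Fin 2) ℚ) := homogeneousSubmodule (Fin 2) ℚ d

lemma monomial_fin_two (e : Fin 2 →₀ ℕ) (c : ℚ) :
    monomial e c = c • (X 0 ^ e 0 * X 1 ^ e 1 : MvPolynomial (Fin 2) ℚ) := by
  rw [monomial_eq, Finsupp.prod_fintype _ _ (by simp), Fin.prod_univ_two, smul_eq_C_mul]

lemma forms_le_span (d : ℕ) :
    Forms d ≤ Submodule.span ℚ {P | ∃ i j, i + j = d ∧ P = X 0 ^ i * X 1 ^ j} := by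
  intro P hP
  rw [P.as_sum]
  refine Submodule.sum_mem _ fun e he => ?_
  rw [monomial_fin_two]
  refine Submodule.smul_mem _ _ (Submodule.subset_span ⟨e 0, e 1, ?_, rfl⟩)
  have h := hP (mem_support_iff.1 he)
  rw [← h, Finsupp.weight_apply, Finsupp.sum_fintype _ _ (by simp)]
  simp

lemma forms_exists_sum {d : ℕ} {P : MvPolynomial (Fin 2) ℚ} (hP : P ∈ Forms d) :
    ∃ a : ℕ → ℚ, P = ∑ i ∈ Finset.range (d + 1), a i • (X 0 ^ (d - i) * X 1 ^ i) := by
  refine Submodule.span_induction (p := fun P _ => ∃ a : ℕ → ℚ,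
    P = ∑ i ∈ Finset.range (d + 1), a i • (X 0 ^ (d - i) * X 1 ^ i)) ?_ ?_ ?_ ?_
    (forms_le_span d hP)
  · rintro _ ⟨i, j, rfl, rfl⟩
    refine ⟨fun k => if k = j then 1 else 0, ?_⟩
    rw [Finset.sum_eq_single j]
    · simp
    · intro b _ hb
      simp [hb]
    · intro h
      exact absurd (Finset.mem_range.2 (by omega)) h
  · exact ⟨0, by simp⟩
  · rintro x y _ _ ⟨a, rfl⟩ ⟨b, rfl⟩
    exact ⟨a + b, by simp [add_smul, Finset.sum_add_distrib]⟩
  · rintro c x _ ⟨a, rfl⟩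
    exact ⟨c • a, by simp [mul_smul, Finset.smul_sum]⟩

lemma forms_eqOn {E : Type*} [AddCommGroup E] [Module ℚ E] {d : ℕ}
    {f g : MvPolynomial (Fin 2) ℚ →ₗ[ℚ] E}
    (h : ∀ i j, i + j = d → f (X 0 ^ i * X 1 ^ j) = g (X 0 ^ i * X 1 ^ j))
    {P : MvPolynomial (Fin 2) ℚ} (hP : P ∈ Forms d) : f P = g P := by
  refine LinearMap.eqOn_span (s := {P | ∃ i j, i + j = d ∧ P = X 0 ^ i * X 1 ^ j}) ?_
    (forms_le_span d hP)
  rintro _ ⟨i, j, hij, rfl⟩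
  exact h i j hij

lemma finiteDimensional_forms (d : ℕ) : FiniteDimensional ℚ (Forms d) := by
  have hfin : Set.Finite {P : MvPolynomial (Fin 2) ℚ |
      ∃ i j, i + j = d ∧ P = X 0 ^ i * X 1 ^ j} := by
    refine ((Finset.HasAntidiagonal.antidiagonal d).image
      fun q => (X 0 ^ q.1 * X 1 ^ q.2 : MvPolynomial (Fin 2) ℚ)).finite_toSet.subset ?_
    rintro _ ⟨i, j, hij, rfl⟩
    simpa using ⟨i, j, hij, rfl⟩
  have := FiniteDimensional.span_of_finite ℚ hfin
  exact Submodule.finiteDimensional_of_le (forms_le_span d)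

lemma monomial_mem_forms {d i j : ℕ} (h : i + j = d) :
    (X 0 ^ i * X 1 ^ j : MvPolynomial (Fin 2) ℚ) ∈ Forms d := by
  have := ((isHomogeneous_X ℚ (0 : Fin 2)).pow i).mul ((isHomogeneous_X ℚ (1 : Fin 2)).pow j)
  simpa [← h] using this

lemma rot_mem_forms {d : ℕ} {P : MvPolynomial (Fin 2) ℚ} (hP : P ∈ Forms d) :
    rot P ∈ Forms d := by
  have := IsHomogeneous.aeval hP (![X 0 - X 1, X 0] : Fin 2 → MvPolynomial (Fin 2) ℚ) (n := 1)
    (by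
      intro i
      fin_cases i
      · exact (isHomogeneous_X _ _).sub (isHomogeneous_X _ _)
      · exact isHomogeneous_X _ _)
  simpa [rot] using this

lemma flp_mem_forms {d : ℕ} {P : MvPolynomial (Fin 2) ℚ} (hP : P ∈ Forms d) :
    flp P ∈ Forms d := by
  have := IsHomogeneous.aeval hP (![X 1, X 0] : Fin 2 → MvPolynomial (Fin 2) ℚ) (n := 1)
    (by
      intro i
      fin_cases i
      · exact isHomogeneous_X _ _
      · exact isHomogeneous_X _ _)
  simpa [flp] using this

lemma flp_flp (P : MvPolynomial (Fin 2) ℚ) : flp (flp P) = P := by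
  have : flp.comp flp = AlgHom.id ℚ _ := by
    ext i; fin_cases i <;> simp
  exact congrArg (fun f => f P) this

/-- The matrix of `rot` has cube `-1`, which acts trivially in even degree. -/
lemma rot_rot_rot {d : ℕ} (hd : Even d) {P : MvPolynomial (Fin 2) ℚ} (hP : P ∈ Forms d) :
    rot (rot (rot P)) = P := by
  refine forms_eqOn (f := rot.toLinearMap ∘ₗ rot.toLinearMap ∘ₗ rot.toLinearMap)
    (g := LinearMap.id) ?_ hP
  intro i j hij
  subst hij
  simp only [LinearMap.comp_apply, AlgHom.toLinearMap_apply, map_mul, map_pow, rot_X_zero,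
    rot_X_one, map_sub, LinearMap.id_apply]
  rw [show (X 0 - X 1 - X 0 - (X 0 - X 1) : MvPolynomial (Fin 2) ℚ) = - X 0 by ring,
    show (X 0 - X 1 - X 0 : MvPolynomial (Fin 2) ℚ) = - X 1 by ring, neg_pow,
    neg_pow (X 1 : MvPolynomial (Fin 2) ℚ)]
  calc _ = ((-1) ^ (i + j)) * (X 0 ^ i * X 1 ^ j : MvPolynomial (Fin 2) ℚ) := by ring
    _ = _ := by rw [hd.neg_one_pow, one_mul]

/-- The remaining relation of `S₃`: the two sides differ by the sign `(-1)^(i + j)`, invisible in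
even degree. -/
lemma flp_rot {d : ℕ} (hd : Even d) {P : MvPolynomial (Fin 2) ℚ} (hP : P ∈ Forms d) :
    flp (rot P) = rot (rot (flp P)) := by
  refine forms_eqOn (f := flp.toLinearMap ∘ₗ rot.toLinearMap)
    (g := rot.toLinearMap ∘ₗ rot.toLinearMap ∘ₗ flp.toLinearMap) ?_ hP
  intro i j hij
  subst hij
  simp only [LinearMap.comp_apply, AlgHom.toLinearMap_apply, map_mul, map_pow, rot_X_zero,
    rot_X_one, map_sub, flp_X_zero, flp_X_one]
  rw [show (X 0 - X 1 - X 0 : MvPolynomial (Fin 2) ℚ) = - X 1 by ring,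
    show (X 1 - X 0 : MvPolynomial (Fin 2) ℚ) = - (X 0 - X 1) by ring, neg_pow,
    neg_pow (X 1 : MvPolynomial (Fin 2) ℚ)]
  calc _ = ((-1) ^ i) * ((X 0 - X 1) ^ i * X 1 ^ j : MvPolynomial (Fin 2) ℚ) := by ring
    _ = ((-1) ^ j) * ((X 0 - X 1) ^ i * X 1 ^ j : MvPolynomial (Fin 2) ℚ) := by
        rw [Nat.even_add] at hd
        rcases Nat.even_or_odd i with h | h
        · rw [h.neg_one_pow, (hd.1 h).neg_one_pow]
        · have : Odd j := by
            rw [← Nat.not_even_iff_odd] at h ⊢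
            tauto
          rw [h.neg_one_pow, this.neg_one_pow]
    _ = _ := by ring

/-! ### Alternating forms and their dimension -/

/-- The sum over the rotations. -/
def avg : MvPolynomial (Fin 2) ℚ →ₗ[ℚ] MvPolynomial (Fin 2) ℚ :=
  LinearMap.id + rot.toLinearMap + rot.toLinearMap ∘ₗ rot.toLinearMap

lemma avg_apply (P : MvPolynomial (Fin 2) ℚ) : avg P = P + rot P + rot (rot P) := rfl

/-- Binary forms of degree `d` that are alternating under the action of the symmetric group
generated by `rot` and `flp`. -/
def Alt (d : ℕ) : Submodule ℚ (MvPolynomial (Fin 2) ℚ) :=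
  Forms d ⊓ LinearMap.eqLocus flp.toLinearMap (-LinearMap.id) ⊓
    LinearMap.eqLocus rot.toLinearMap LinearMap.id

lemma mem_Alt {d : ℕ} {P : MvPolynomial (Fin 2) ℚ} :
    P ∈ Alt d ↔ P ∈ Forms d ∧ flp P = -P ∧ rot P = P := by
  simp [Alt, and_assoc]

lemma finiteDimensional_Alt (d : ℕ) : FiniteDimensional ℚ (Alt d) := by
  have := finiteDimensional_forms d
  exact Submodule.finiteDimensional_of_le (inf_le_left.trans inf_le_left : Alt d ≤ Forms d)

lemma avg_mem_Alt {d : ℕ} (hd : Even d) {P : MvPolynomial (Fin 2) ℚ} (hP : P ∈ Forms d)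
    (h : flp P = -P) : avg P ∈ Alt d := by
  have h1 := rot_mem_forms hP
  have h2 := rot_mem_forms h1
  refine mem_Alt.2 ⟨add_mem (add_mem hP h1) h2, ?_, ?_⟩
  · rw [avg_apply, map_add, map_add, flp_rot hd h1, flp_rot hd hP, h]
    simp only [map_neg, rot_rot_rot hd hP]
    ring
  · rw [avg_apply, map_add, map_add, rot_rot_rot hd hP]
    ring

/-- The functional extracting the coefficient of `x^(d-1) y` of a form of degree `d`. -/
def slope : MvPolynomial (Fin 2) ℚ →ₗ[ℚ] ℚ :=
  Polynomial.lcoeff ℚ 1 ∘ₗ (aeval ![1, Polynomial.X] :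
    MvPolynomial (Fin 2) ℚ →ₐ[ℚ] Polynomial ℚ).toLinearMap

lemma eval_flp (P : MvPolynomial (Fin 2) ℚ) (x y : ℚ) : eval ![x, y] (flp P) = eval ![y, x] P := by
  have : (aeval ![x, y] : MvPolynomial (Fin 2) ℚ →ₐ[ℚ] ℚ).comp flp = aeval ![y, x] := by
    ext i; fin_cases i <;> simp
  simpa using congrArg (fun f => f P) this

lemma eval_rot (P : MvPolynomial (Fin 2) ℚ) (x y : ℚ) :
    eval ![x, y] (rot P) = eval ![x - y, x] P := by
  have : (aeval ![x, y] : MvPolynomial (Fin 2) ℚ →ₐ[ℚ] ℚ).comp rot = aeval ![x - y, x] := by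
    ext i; fin_cases i <;> simp
  simpa using congrArg (fun f => f P) this

lemma eval_eq_of_mem_Alt {d : ℕ} {P : MvPolynomial (Fin 2) ℚ} (hP : P ∈ Alt d) (x y : ℚ) :
    eval ![y, x] P = - eval ![x, y] P ∧ eval ![x - y, x] P = eval ![x, y] P := by
  obtain ⟨-, h1, h2⟩ := mem_Alt.1 hP
  constructor
  · rw [← eval_flp, h1, map_neg]
  · rw [← eval_rot, h2]

/-- Antisymmetry gives `P(1,1) = 0`, and rotation invariance carries `(1,0)` to `(1,1)`. -/
lemma eval_one_zero_of_mem_Alt {d : ℕ} {P : MvPolynomial (Fin 2) ℚ} (hP : P ∈ Alt d) :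
    eval ![1, 0] P = 0 := by
  have h1 := (eval_eq_of_mem_Alt hP 1 1).1
  have h2 := (eval_eq_of_mem_Alt hP 1 0).2
  norm_num at h2
  linarith

lemma X_one_sq_dvd {d : ℕ} {P : MvPolynomial (Fin 2) ℚ} (hP : P ∈ Alt d) (h : slope P = 0) :
    X 1 ^ 2 ∣ P := by
  obtain ⟨a, rfl⟩ := forms_exists_sum (mem_Alt.1 hP).1
  have h0 := eval_one_zero_of_mem_Alt hP
  have ha0 : a 0 = 0 := by
    rw [Finset.sum_range_succ', map_add, map_sum] at h0
    simpa [smul_eq_C_mul] using h0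
  refine Finset.dvd_sum fun i hi => ?_
  rcases i with _ | _ | i
  · simp [ha0]
  · have ha1 : a 1 = 0 := by
      rw [map_sum, Finset.sum_eq_single 1] at h
      · simpa [slope] using h
      · intro b _ hb
        simp [slope, Polynomial.coeff_X_pow, hb.symm]
      · intro h'
        exact absurd hi h'
    simp [ha1]
  · rw [smul_eq_C_mul]
    exact Dvd.dvd.mul_left (Dvd.dvd.mul_left (pow_dvd_pow _ (by omega)) _) _

/-- The discriminant form `(x y (x - y))²`. -/
def disc : MvPolynomial (Fin 2) ℚ := (X 0 * X 1 * (X 0 - X 1)) ^ 2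

lemma rot_disc : rot disc = disc := by
  simp only [disc, map_pow, map_mul, map_sub, rot_X_zero, rot_X_one]; ring

lemma flp_disc : flp disc = disc := by
  simp only [disc, map_pow, map_mul, map_sub, flp_X_zero, flp_X_one]; ring

lemma disc_isHomogeneous : disc.IsHomogeneous 6 := by
  have h := (((isHomogeneous_X ℚ (0 : Fin 2)).mul (isHomogeneous_X ℚ 1)).mul
    ((isHomogeneous_X ℚ (0 : Fin 2)).sub (isHomogeneous_X ℚ 1))).pow 2
  exact h

lemma disc_ne_zero : disc ≠ 0 := by
  intro h
  have := congrArg (eval ![2, 1]) h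
  norm_num [disc] at this

/-- `rot` is an automorphism of the polynomial ring carrying the prime `X 0` to `X 0 - X 1`. -/
lemma prime_X_sub_X : Prime (X 0 - X 1 : MvPolynomial (Fin 2) ℚ) := by
  let f : MvPolynomial (Fin 2) ℚ →ₐ[ℚ] MvPolynomial (Fin 2) ℚ := aeval ![X 1, X 1 - X 0]
  let φ : MvPolynomial (Fin 2) ℚ ≃ₐ[ℚ] MvPolynomial (Fin 2) ℚ := AlgEquiv.ofAlgHom rot f
    (by ext i; fin_cases i <;> simp [f]) (by ext i; fin_cases i <;> simp [f])
  have h := (MulEquiv.prime_iff φ.toMulEquiv).2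
    (X_prime (R := ℚ) (i := (0 : Fin 2)))
  simpa [φ] using h

/-- The rotation permutes the lines `y = 0`, `x = 0`, `x = y`, so a double zero along one of them
spreads to all three; the three primes are pairwise coprime. -/
lemma disc_dvd {d : ℕ} {P : MvPolynomial (Fin 2) ℚ} (hP : P ∈ Alt d) (h : slope P = 0) :
    disc ∣ P := by
  have hr := (mem_Alt.1 hP).2.2
  have h1 := X_one_sq_dvd hP h
  have h2 : X 0 ^ 2 ∣ P := by
    have := map_dvd rot h1
    rwa [hr, map_pow, rot_X_one] at this
  have h3 : (X 0 - X 1) ^ 2 ∣ P := by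
    have := map_dvd rot h2
    rwa [hr, map_pow, rot_X_zero] at this
  obtain ⟨Q, rfl⟩ := h1
  have h4 : X 0 ^ 2 ∣ Q := by
    refine (X_prime (R := ℚ) (i := (0 : Fin 2))).pow_dvd_of_dvd_mul_left 2 ?_ h2
    intro h
    obtain ⟨c, hc⟩ := (X_prime (R := ℚ) (i := (0 : Fin 2))).dvd_of_dvd_pow h
    have := congrArg (eval ![0, 1]) hc
    norm_num at this
  obtain ⟨Q, rfl⟩ := h4
  have h5 : (X 0 - X 1) ^ 2 ∣ Q := by
    rw [← mul_assoc] at h3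
    refine prime_X_sub_X.pow_dvd_of_dvd_mul_left 2 ?_ h3
    intro h
    rw [← mul_pow] at h
    obtain ⟨c, hc⟩ := prime_X_sub_X.dvd_of_dvd_pow h
    have := congrArg (eval ![1, 1]) hc
    norm_num at this
  obtain ⟨Q, rfl⟩ := h5
  exact ⟨Q, by rw [disc]; ring⟩

/-- Comparing components of degree `m + d` gives `P * Q_d = P * Q`; then `P` cancels. -/
lemma isHomogeneous_of_mul {P Q : MvPolynomial (Fin 2) ℚ} {m d : ℕ} (hP : P.IsHomogeneous m)
    (hP0 : P ≠ 0) (h : (P * Q).IsHomogeneous (m + d)) : Q.IsHomogeneous d := by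
  have key : P * homogeneousComponent d Q = P * Q := by
    have h1 : homogeneousComponent (m + d) (P * Q) = P * homogeneousComponent d Q := by
      conv_lhs => rw [← sum_homogeneousComponent Q, Finset.mul_sum, map_sum]
      have h2 : ∀ i, homogeneousComponent (m + d) (P * homogeneousComponent i Q) =
          if m + i = m + d then P * homogeneousComponent i Q else 0 := fun i => by
        rw [homogeneousComponent_of_mem (hP.mul (homogeneousComponent_isHomogeneous i Q))]
        simp only [eq_comm]
      simp only [h2, add_right_inj]
      rw [Finset.sum_ite_eq']
      split_ifs with h3
      · rfl
      · have h4 : Q.totalDegree < d := by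
          rw [Finset.mem_range] at h3
          omega
        rw [MvPolynomial.homogeneousComponent_eq_zero d Q h4, mul_zero]
    rw [← h1, homogeneousComponent_of_mem h, if_pos rfl]
  rw [← mul_left_cancel₀ hP0 key]
  exact homogeneousComponent_isHomogeneous d Q

lemma disc_mul_mem_Alt {d : ℕ} {P : MvPolynomial (Fin 2) ℚ} :
    disc * P ∈ Alt (d + 6) ↔ P ∈ Alt d := by
  rw [mem_Alt, mem_Alt, map_mul, map_mul, rot_disc, flp_disc, ← mul_neg,
    mul_right_inj' disc_ne_zero, mul_right_inj' disc_ne_zero]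
  refine and_congr_left fun _ => ⟨fun h => ?_, fun h => ?_⟩
  · exact isHomogeneous_of_mul disc_isHomogeneous disc_ne_zero (by rw [add_comm 6]; exact h)
  · have := disc_isHomogeneous.mul h
    rwa [add_comm] at this

lemma slope_disc_mul (P : MvPolynomial (Fin 2) ℚ) : slope (disc * P) = 0 := by
  have : (aeval ![1, Polynomial.X] : MvPolynomial (Fin 2) ℚ →ₐ[ℚ] Polynomial ℚ) (disc * P) =
      Polynomial.X ^ 2 * ((1 - Polynomial.X) ^ 2 *
        (aeval ![1, Polynomial.X] : MvPolynomial (Fin 2) ℚ →ₐ[ℚ] Polynomial ℚ) P) := by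
    simp [disc]; ring
  rw [slope, LinearMap.comp_apply, AlgHom.toLinearMap_apply, this, Polynomial.lcoeff_apply,
    Polynomial.coeff_X_pow_mul']
  simp

/-- An alternating form of degree `2 m + 6` whose slope does not vanish. -/
def altForm (m : ℕ) : MvPolynomial (Fin 2) ℚ :=
  X 0 * X 1 * (X 0 - X 1) * ((X 0 + X 1) * (2 * X 0 - X 1) * (X 0 - 2 * X 1)) *
    (X 0 ^ 2 - X 0 * X 1 + X 1 ^ 2) ^ m

lemma slope_altForm (m : ℕ) : slope (altForm m) = 2 := by
  have : (aeval ![1, Polynomial.X] : MvPolynomial (Fin 2) ℚ →ₐ[ℚ] Polynomial ℚ) (altForm m) =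
      Polynomial.X * ((1 - Polynomial.X) * ((1 + Polynomial.X) * (2 - Polynomial.X) *
        (1 - 2 * Polynomial.X)) * (1 - Polynomial.X + Polynomial.X ^ 2) ^ m) := by
    simp [altForm]; ring
  rw [slope, LinearMap.comp_apply, AlgHom.toLinearMap_apply, this, Polynomial.lcoeff_apply,
    Polynomial.coeff_X_mul, Polynomial.coeff_zero_eq_eval_zero]
  simp

lemma altForm_mem_Alt (m : ℕ) : altForm m ∈ Alt (2 * m + 6) := by
  refine mem_Alt.2 ⟨?_, ?_, ?_⟩
  · have x := isHomogeneous_X ℚ (0 : Fin 2)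
    have y := isHomogeneous_X ℚ (1 : Fin 2)
    have c : (2 : MvPolynomial (Fin 2) ℚ).IsHomogeneous 0 := isHomogeneous_C (Fin 2) (2 : ℚ)
    have h := (((x.mul y).mul (x.sub y)).mul (((x.add y).mul
      ((zero_add 1 ▸ c.mul x).sub y)).mul (x.sub (zero_add 1 ▸ c.mul y)))).mul
      ((((x.pow 2).sub (x.mul y)).add (y.pow 2)).pow m)
    rw [mem_homogeneousSubmodule]
    rw [show 2 * m + 6 = 1 + 1 + 1 + (1 + 1 + 1) + 1 * 2 * m by ring]
    exact h
  · simp only [altForm, map_pow, map_mul, map_sub, map_add, flp_X_zero, flp_X_one, map_ofNat]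
    ring
  · simp only [altForm, map_pow, map_mul, map_sub, map_add, rot_X_zero, rot_X_one, map_ofNat]
    rw [show ((X 0 - X 1) ^ 2 - (X 0 - X 1) * X 0 + X 0 ^ 2 : MvPolynomial (Fin 2) ℚ) =
      X 0 ^ 2 - X 0 * X 1 + X 1 ^ 2 by ring]
    ring

/-- The slope maps onto `ℚ`, as `altForm m` shows, and its kernel is `disc` times the alternating
forms of degree six less. -/
lemma finrank_Alt_add_six (m : ℕ) :
    Module.finrank ℚ (Alt (2 * m + 6)) = Module.finrank ℚ (Alt (2 * m)) + 1 := by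
  have := finiteDimensional_Alt (2 * m + 6)
  let f : Alt (2 * m + 6) →ₗ[ℚ] ℚ := slope ∘ₗ (Alt (2 * m + 6)).subtype
  have hf : Function.Surjective f := by
    refine LinearMap.surjective_of_ne_zero fun h => ?_
    have := congrArg (fun g => g ⟨altForm m, altForm_mem_Alt m⟩) h
    simp [f, slope_altForm] at this
  have h1 := f.finrank_range_add_finrank_ker
  rw [LinearMap.range_eq_top.2 hf, finrank_top, Module.finrank_self] at h1
  let g : Alt (2 * m) →ₗ[ℚ] LinearMap.ker f :=
    LinearMap.codRestrict _ (LinearMap.codRestrict _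
      (LinearMap.mulLeft ℚ disc ∘ₗ (Alt (2 * m)).subtype)
      fun P => disc_mul_mem_Alt.2 P.2) fun P => slope_disc_mul P.1
  have hg : Function.Bijective g := by
    constructor
    · intro P Q h
      have h' : disc * P.1 = disc * Q.1 := congrArg (fun z => (z.1.1)) h
      exact Subtype.ext (mul_left_cancel₀ disc_ne_zero h')
    · rintro ⟨⟨P, hP⟩, hs⟩
      obtain ⟨Q, rfl⟩ := disc_dvd hP hs
      exact ⟨⟨Q, disc_mul_mem_Alt.1 hP⟩, rfl⟩
  rw [(LinearEquiv.ofBijective g hg).finrank_eq]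
  omega

/-- In these degrees the symmetries at a few rational points already give enough linear equations to
kill every coefficient. -/
lemma Alt_eq_bot {d : ℕ} (hd : d = 0 ∨ d = 2 ∨ d = 4) : Alt d = ⊥ := by
  rw [eq_bot_iff]
  intro P hP
  obtain ⟨a, ha⟩ := forms_exists_sum (mem_Alt.1 hP).1
  have e0 := eval_one_zero_of_mem_Alt hP
  have e1 := (eval_eq_of_mem_Alt hP 1 1).1
  have e2 := (eval_eq_of_mem_Alt hP 1 (-1)).1
  have e3 := (eval_eq_of_mem_Alt hP 2 1).1
  have e4 := (eval_eq_of_mem_Alt hP 2 1).2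
  have e5 := (eval_eq_of_mem_Alt hP 1 0).1
  rw [Submodule.mem_bot, ha]
  rcases hd with rfl | rfl | rfl <;>
  · simp only [ha, Finset.sum_range_succ, Finset.sum_range_zero] at e0 e1 e2 e3 e4 e5 ⊢
    simp [smul_eq_C_mul] at e0 e1 e2 e3 e4 e5
    norm_num at e0 e1 e2 e3 e4 e5
    refine Eq.trans (b := 0) ?_ rfl
    have h0 : a 0 = 0 := by linarith
    try have h1 : a 1 = 0 := by linarith
    try have h2 : a 2 = 0 := by linarith
    try have h3 : a 3 = 0 := by linarith
    try have h4 : a 4 = 0 := by linarith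
    simp [*]

lemma finrank_Alt (m : ℕ) : Module.finrank ℚ (Alt (2 * m)) = m / 3 := by
  induction m using Nat.strong_induction_on with
  | _ m ih =>
    by_cases hm : m < 3
    · rw [Alt_eq_bot (by omega), finrank_bot]
      omega
    · obtain ⟨k, rfl⟩ := Nat.exists_eq_add_of_le (not_lt.1 hm)
      rw [show 2 * (3 + k) = 2 * k + 6 by ring, finrank_Alt_add_six, ih k (by omega)]
      omega

/-! ### The sum over rotations on antisymmetric even forms -/

/-- The antisymmetric form with given coefficients at `x^(2k+2) y^(d-2k-2) - x^(d-2k-2) y^(2k+2)`. -/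
def antiForm (d : ℕ) : (Fin ((d - 2) / 4) → ℚ) →ₗ[ℚ] MvPolynomial (Fin 2) ℚ :=
  Fintype.linearCombination ℚ fun k : Fin ((d - 2) / 4) =>
    (X 0 ^ (2 * (k : ℕ) + 2) * X 1 ^ (d - (2 * k + 2)) -
      X 0 ^ (d - (2 * k + 2)) * X 1 ^ (2 * (k : ℕ) + 2) : MvPolynomial (Fin 2) ℚ)

/-- For even `d`, the indices `k < (d - 2) / 4` are exactly those with `2k + 2 < d - (2k + 2)`, so
each unordered pair of distinct positive even exponents occurs once. -/
lemma sub_mem_range_antiForm {d i j : ℕ} (hij : i + j = d) (hi : Even i) (hj : Even j)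
    (hi0 : 0 < i) (hj0 : 0 < j) :
    (X 0 ^ i * X 1 ^ j - X 0 ^ j * X 1 ^ i : MvPolynomial (Fin 2) ℚ) ∈
      LinearMap.range (antiForm d) := by
  wlog h : i < j generalizing i j
  · rcases (not_lt.1 h).eq_or_lt with rfl | h'
    · simp
    · rw [← neg_sub]
      exact neg_mem (this (by omega) hj hi hj0 hi0 h')
  obtain ⟨a, rfl⟩ := hi
  obtain ⟨b, rfl⟩ := hj
  refine ⟨Pi.single ⟨a - 1, by omega⟩ 1, ?_⟩
  rw [antiForm, Fintype.linearCombination_apply_single, one_smul]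
  dsimp only
  rw [show 2 * (a - 1) + 2 = a + a by omega, show d - (a + a) = b + b by omega]

/-- The sum telescopes. Hence leaving the extreme monomials out of `antiForm` does not shrink the
image of `avg`. -/
lemma avg_pow_sub_pow {d : ℕ} (hd : Even d) :
    avg (X 0 ^ d - X 1 ^ d : MvPolynomial (Fin 2) ℚ) = 0 := by
  simp only [avg_apply, map_sub, map_pow, rot_X_zero, rot_X_one]
  rw [show (X 0 - X 1 - X 0 : MvPolynomial (Fin 2) ℚ) = - X 1 by ring, hd.neg_pow]
  ring

lemma avg_sub_mem {d i j : ℕ} (hij : i + j = d) (hi : Even i) (hj : Even j) :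
    avg (X 0 ^ i * X 1 ^ j - X 0 ^ j * X 1 ^ i : MvPolynomial (Fin 2) ℚ) ∈
      LinearMap.range (avg ∘ₗ antiForm d) := by
  rcases Nat.eq_zero_or_pos i with rfl | hi0
  · have h : (X 0 ^ 0 * X 1 ^ j - X 0 ^ j * X 1 ^ 0 : MvPolynomial (Fin 2) ℚ) =
      -(X 0 ^ j - X 1 ^ j) := by ring
    rw [h, map_neg, avg_pow_sub_pow hj, neg_zero]
    exact zero_mem _
  rcases Nat.eq_zero_or_pos j with rfl | hj0
  · have h : (X 0 ^ i * X 1 ^ 0 - X 0 ^ 0 * X 1 ^ i : MvPolynomial (Fin 2) ℚ) =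
      X 0 ^ i - X 1 ^ i := by ring
    rw [h, avg_pow_sub_pow hi]
    exact zero_mem _
  obtain ⟨c, hc⟩ := sub_mem_range_antiForm hij hi hj hi0 hj0
  exact ⟨c, by rw [LinearMap.comp_apply, hc]⟩

lemma antiForm_mem {d : ℕ} (c : Fin ((d - 2) / 4) → ℚ) :
    antiForm d c ∈ Forms d ∧ flp (antiForm d c) = - antiForm d c := by
  rw [antiForm, Fintype.linearCombination_apply]
  constructor
  · refine Submodule.sum_mem _ fun k _ => Submodule.smul_mem _ _ (sub_mem ?_ ?_) <;>
    exact monomial_mem_forms (by omega)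
  · rw [map_sum, ← Finset.sum_neg_distrib]
    refine Finset.sum_congr rfl fun k _ => ?_
    rw [map_smul, ← smul_neg]
    simp only [map_sub, map_mul, map_pow, flp_X_zero, flp_X_one]
    congr 1
    ring

/-- A functional on binary forms of degree `d` that is invariant under `y ↦ y - x` and kills the
even monomials vanishes. -/
lemma functional_eq_zero {d : ℕ} (hd : Even d) (l : MvPolynomial (Fin 2) ℚ →ₗ[ℚ] ℚ)
    (h1 : ∀ i j, i + j = d → l (X 0 ^ i * (X 1 - X 0) ^ j) = l (X 0 ^ i * X 1 ^ j))
    (h2 : ∀ i j, i + j = d → Even i → Even j → l (X 0 ^ i * X 1 ^ j) = 0) :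
    ∀ i j, i + j = d → l (X 0 ^ i * X 1 ^ j) = 0 := by
  intro i j
  induction j using Nat.strong_induction_on generalizing i with
  | _ j ih =>
    intro hij
    rcases Nat.eq_zero_or_pos i with rfl | hi
    · exact h2 0 j hij Even.zero (by rwa [← hij, zero_add] at hd)
    obtain ⟨i, rfl⟩ := Nat.exists_eq_succ_of_ne_zero hi.ne'
    -- Invariance is used one degree higher in `y`: the leading terms cancel, the next one is `-(j +
    -- 1) x^(i+1) y^j`, and the rest vanish by induction.
    have h := h1 i (j + 1) (by omega)
    have expand : (X 0 ^ i * (X 1 - X 0) ^ (j + 1) : MvPolynomial (Fin 2) ℚ) =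
        X 0 ^ i * X 1 ^ (j + 1) - ((j : ℚ) + 1) • (X 0 ^ (i + 1) * X 1 ^ j) +
          ∑ m ∈ Finset.range j, ((-1) ^ (j + 1 - m) * ((j + 1).choose m : ℚ)) •
            (X 0 ^ (i + (j + 1 - m)) * X 1 ^ m) := by
      rw [sub_eq_add_neg (X 1), add_pow, Finset.sum_range_succ, Finset.sum_range_succ]
      simp only [smul_eq_C_mul, map_mul, map_pow, map_neg, map_one, map_natCast, map_add,
        Finset.mul_sum, mul_add, Nat.choose_self, Nat.choose_succ_self_right, Nat.cast_one, mul_one,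
        Nat.sub_self, pow_zero, Nat.add_sub_cancel_left, Nat.cast_add, pow_add]
      have : ∀ m ∈ Finset.range j, (X 0 ^ i * (X 1 ^ m * (-X 0) ^ (j + 1 - m) *
          ((j + 1).choose m : MvPolynomial (Fin 2) ℚ))) =
          (-1) ^ (j + 1 - m) * ((j + 1).choose m : MvPolynomial (Fin 2) ℚ) *
            (X 0 ^ i * X 0 ^ (j + 1 - m) * X 1 ^ m) := fun m _ => by
        rw [neg_pow (X 0 : MvPolynomial (Fin 2) ℚ)]; ring
      rw [Finset.sum_congr rfl this]
      ring
    rw [expand, map_add, map_sub, map_smul, map_sum, Finset.sum_eq_zero, add_zero,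
      sub_eq_self, smul_eq_zero] at h
    · exact h.resolve_left (by positivity)
    · intro m hm
      rw [Finset.mem_range] at hm
      rw [map_smul, ih m hm _ (by omega), smul_zero]

/-- Up to a sign depending on `j`, the shift `y ↦ y - x` is an element of `S₃`, so an alternating
functional is compatible with it. -/
lemma shift_eq_smul_rot_flp (i j : ℕ) : (X 0 ^ i * (X 1 - X 0) ^ j : MvPolynomial (Fin 2) ℚ) =
    (-1 : ℚ) ^ j • rot (flp (X 0 ^ i * X 1 ^ j)) := by
  have h : ((X 1 - X 0) ^ j : MvPolynomial (Fin 2) ℚ) = (-1) ^ j * (X 0 - X 1) ^ j := by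
    rw [← mul_pow, neg_one_mul, neg_sub]
  simp only [map_mul, map_pow, flp_X_zero, flp_X_one, rot_X_zero, rot_X_one]
  rw [smul_eq_C_mul, map_pow, map_neg, map_one, h]
  ring

/-- Argument by duality. A functional killing the image but not `z` is turned into an alternating
functional `l` that kills even monomials. The sign in the shift matters only for even `j`, where `l`
vanishes anyway, so `l` is shift-invariant and `functional_eq_zero` gives `l = 0` on forms of degree
`d`. -/
lemma Alt_le_range {d : ℕ} (hd : Even d) :
    Alt d ≤ LinearMap.range (avg ∘ₗ antiForm d) := by
  intro z hz
  by_contra hn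
  obtain ⟨l0, hl0, hl⟩ := Submodule.exists_le_ker_of_notMem hn
  have hl' : ∀ P ∈ LinearMap.range (avg ∘ₗ antiForm d), l0 P = 0 := fun P hP => hl hP
  obtain ⟨l, l_apply⟩ : ∃ l : MvPolynomial (Fin 2) ℚ →ₗ[ℚ] ℚ, ∀ P, l P = l0 (avg (P - flp P)) :=
    ⟨l0 ∘ₗ (avg - avg ∘ₗ flp.toLinearMap), fun P => by simp⟩
  have l_flp : ∀ P, l (flp P) = - l P := fun P => by
    rw [l_apply, l_apply, flp_flp, ← map_neg, ← map_neg, neg_sub]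
  have l_rot : ∀ P ∈ Forms d, l (rot P) = l P := fun P hP => by
    have hf := flp_mem_forms hP
    rw [l_apply, l_apply, flp_rot hd hP]
    congr 1
    simp only [map_sub, avg_apply, rot_rot_rot hd hP, rot_rot_rot hd hf]
    ring
  have l_even : ∀ i j, i + j = d → Even i → Even j → l (X 0 ^ i * X 1 ^ j) = 0 := by
    intro i j hij hi hj
    rw [l_apply]
    refine hl' _ ?_
    have e : flp (X 0 ^ i * X 1 ^ j) = (X 0 ^ j * X 1 ^ i : MvPolynomial (Fin 2) ℚ) := by
      rw [map_mul, map_pow, map_pow, flp_X_zero, flp_X_one, mul_comm]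
    rw [e]
    exact avg_sub_mem hij hi hj
  have l_shift : ∀ i j, i + j = d → l (X 0 ^ i * (X 1 - X 0) ^ j) = l (X 0 ^ i * X 1 ^ j) := by
    intro i j hij
    have e1 := shift_eq_smul_rot_flp i j
    have hm := monomial_mem_forms hij
    rw [e1, map_smul, l_rot _ (flp_mem_forms hm), l_flp]
    rcases Nat.even_or_odd j with hj | hj
    · have hi : Even i := by
        rw [← hij, Nat.even_add] at hd
        exact hd.2 hj
      rw [l_even i j hij hi hj]
      simp
    · simp [hj.neg_one_pow]
  have l_zero : l z = 0 := by
    refine (forms_eqOn (f := l) (g := 0) (fun i j hij => ?_) (mem_Alt.1 hz).1)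
    exact functional_eq_zero hd l l_shift l_even i j hij
  obtain ⟨-, h1, h2⟩ := mem_Alt.1 hz
  -- On an alternating form the signed sum over the group multiplies by its order.
  have : avg (z - flp z) = (6 : ℚ) • z := by
    rw [h1, avg_apply]
    simp only [map_sub, map_neg, h2]
    module
  rw [l_apply, this, map_smul, smul_eq_zero] at l_zero
  exact hl0 (l_zero.resolve_left (by norm_num))

lemma antiForm_injective (d : ℕ) : Function.Injective (antiForm d) := by
  rw [injective_iff_map_eq_zero]
  intro c hc
  funext k
  have hk := k.2
  have h := congrArg (lcoeff ℚ (Finsupp.equivFunOnFinite.symm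
    ![2 * (k : ℕ) + 2, d - (2 * k + 2)])) hc
  rw [antiForm, Fintype.linearCombination_apply, map_sum, map_zero,
    Finset.sum_eq_single k] at h
  · have hne : ¬ (d - (2 * (k : ℕ) + 2) = 2 * k + 2) := by omega
    simpa [X_pow_eq_monomial, monomial_mul, coeff_monomial, DFunLike.ext_iff, Fin.forall_fin_two,
      hne] using h
  · intro b _ hb
    have hb' := b.2
    have hbk : (b : ℕ) ≠ k := fun h => hb (Fin.ext h)
    have hne : ¬ (d - (2 * (b : ℕ) + 2) = 2 * k + 2) := by omega
    simp [X_pow_eq_monomial, monomial_mul, coeff_monomial, DFunLike.ext_iff, Fin.forall_fin_two,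
      hne, hbk]
  · simp

lemma finrank_ker_avg_antiForm {d : ℕ} (hd : Even d) :
    Module.finrank ℚ (LinearMap.ker (avg ∘ₗ antiForm d)) + d / 6 = (d - 2) / 4 := by
  have hr : LinearMap.range (avg ∘ₗ antiForm d) = Alt d := by
    refine le_antisymm ?_ (Alt_le_range hd)
    rintro _ ⟨c, rfl⟩
    exact avg_mem_Alt hd (antiForm_mem c).1 (antiForm_mem c).2
  have h := (avg ∘ₗ antiForm d).finrank_range_add_finrank_ker
  obtain ⟨m, rfl⟩ := hd
  rw [hr, ← two_mul, finrank_Alt, Module.finrank_fin_fun] at h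
  rw [← two_mul]
  omega

/-! ### The dimension of `W_{N,2}` -/

lemma V_two_le_span (d : ℕ) : V (d + 2) 2 ≤ Submodule.span ℚ {P | ∃ i j, i + j = d ∧ Even i ∧
    Even j ∧ 0 < i ∧ 0 < j ∧ P = (X 0 ^ i * X 1 ^ j : MvPolynomial (Fin 2) ℚ)} := by
  refine Submodule.span_mono ?_
  rintro _ ⟨⟨m, hm⟩, rfl⟩
  simp only [oddIndices, Finset.mem_filter, Finset.Nat.mem_antidiagonalTuple,
    Fin.sum_univ_two, Fin.forall_fin_two] at hm
  obtain ⟨h0, ⟨h1, h2⟩, h3, h4⟩ := hm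
  refine ⟨m 0 - 1, m 1 - 1, by omega, ?_, ?_, by omega, by omega, ?_⟩
  · exact Nat.Odd.sub_odd h2 odd_one
  · exact Nat.Odd.sub_odd h4 odd_one
  · change monomial (expo m) (1 : ℚ) = _
    rw [monomial_fin_two]
    simp [expo]

lemma monomial_mem_V_two {d i j : ℕ} (hij : i + j = d) (hi : Even i) (hj : Even j)
    (hi0 : 0 < i) (hj0 : 0 < j) :
    (X 0 ^ i * X 1 ^ j : MvPolynomial (Fin 2) ℚ) ∈ V (d + 2) 2 := by
  have hm : ![i + 1, j + 1] ∈ oddIndices (d + 2) 2 := by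
    simp only [oddIndices, Finset.mem_filter, Finset.Nat.mem_antidiagonalTuple,
      Fin.sum_univ_two, Fin.forall_fin_two]
    refine ⟨?_, ⟨?_, ?_⟩, ?_, ?_⟩
    · simp; omega
    · obtain ⟨a, rfl⟩ := hi
      simp; omega
    · simpa using hi.add_one
    · obtain ⟨a, rfl⟩ := hj
      simp; omega
    · simpa using hj.add_one
  refine Submodule.subset_span ⟨⟨_, hm⟩, ?_⟩
  change monomial (expo ![i + 1, j + 1]) (1 : ℚ) = _
  rw [monomial_fin_two]
  simp [expo]

lemma V_two_eqOn {E : Type*} [AddCommGroup E] [Module ℚ E] {d : ℕ}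
    {f g : MvPolynomial (Fin 2) ℚ →ₗ[ℚ] E}
    (h : ∀ i j, i + j = d → Even i → Even j → 0 < i → 0 < j →
      f (X 0 ^ i * X 1 ^ j) = g (X 0 ^ i * X 1 ^ j))
    {P : MvPolynomial (Fin 2) ℚ} (hP : P ∈ V (d + 2) 2) : f P = g P := by
  refine LinearMap.eqOn_span (s := {P | ∃ i j, i + j = d ∧ Even i ∧
    Even j ∧ 0 < i ∧ 0 < j ∧ P = (X 0 ^ i * X 1 ^ j : MvPolynomial (Fin 2) ℚ)}) ?_
    (V_two_le_span d hP)
  rintro _ ⟨i, j, hij, h1, h2, h3, h4, rfl⟩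
  exact h i j hij h1 h2 h3 h4

lemma substA_X_zero : substA 2 le_rfl (X 0) = X 1 - X 0 := by simp [substA]
lemma substA_X_one : substA 2 le_rfl (X 1) = X 1 := by simp [substA]
lemma substB_X_zero : substB 2 le_rfl (X 0) = X 1 - X 0 := by simp [substB]
lemma substB_X_one : substB 2 le_rfl (X 1) = X 0 := by simp [substB]

/-- Even exponents absorb the sign between `X 1 - X 0` and `X 0 - X 1`, so on `V` the substitutions
of the three-term relation turn into elements of `S₃`. -/
lemma substB_eq_rot {d : ℕ} {P : MvPolynomial (Fin 2) ℚ} (hP : P ∈ V (d + 2) 2) :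
    substB 2 le_rfl P = rot P := by
  refine V_two_eqOn (f := (substB 2 le_rfl).toLinearMap) (g := rot.toLinearMap) ?_ hP
  intro i j _ hi _ _ _
  simp only [AlgHom.toLinearMap_apply, map_mul, map_pow, substB_X_zero, substB_X_one, rot_X_zero,
    rot_X_one]
  rw [← neg_sub, hi.neg_pow]

lemma flp_substA {d : ℕ} {P : MvPolynomial (Fin 2) ℚ} (hP : P ∈ V (d + 2) 2) :
    flp (substA 2 le_rfl P) = substB 2 le_rfl P := by
  refine V_two_eqOn (f := flp.toLinearMap ∘ₗ (substA 2 le_rfl).toLinearMap)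
    (g := (substB 2 le_rfl).toLinearMap) ?_ hP
  intro i j _ hi _ _ _
  simp only [LinearMap.comp_apply, AlgHom.toLinearMap_apply, map_mul, map_pow, substB_X_zero,
    substB_X_one, substA_X_zero, substA_X_one, map_sub, flp_X_zero, flp_X_one]
  rw [← neg_sub, hi.neg_pow]

lemma substA_eq_rot {d : ℕ} {P : MvPolynomial (Fin 2) ℚ} (hP : P ∈ V (d + 2) 2) :
    substA 2 le_rfl P = rot (rot (flp P)) := by
  refine V_two_eqOn (f := (substA 2 le_rfl).toLinearMap)
    (g := rot.toLinearMap ∘ₗ rot.toLinearMap ∘ₗ flp.toLinearMap) ?_ hP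
  intro i j _ hi hj _ _
  simp only [LinearMap.comp_apply, AlgHom.toLinearMap_apply, map_mul, map_pow, substA_X_zero,
    substA_X_one, map_sub, flp_X_zero, flp_X_one, rot_X_zero, rot_X_one]
  rw [← neg_sub, hi.neg_pow, show (X 0 - X 1 - X 0 : MvPolynomial (Fin 2) ℚ) = - X 1 by ring,
    hj.neg_pow]

lemma mem_W {N r : ℕ} {hr : 2 ≤ r} {P : MvPolynomial (Fin r) ℚ} :
    P ∈ W N r hr ↔ P ∈ V N r ∧ P = substA r hr P - substB r hr P := by
  simp [W]

/-- `flp` exchanges the two terms on the right of the three-term relation, so the relation implies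
antisymmetry. -/
lemma flp_eq_neg_of_mem_W {d : ℕ} {P : MvPolynomial (Fin 2) ℚ} (hP : P ∈ W (d + 2) 2 le_rfl) :
    flp P = -P := by
  obtain ⟨hV, h⟩ := mem_W.1 hP
  have h1 := flp_substA hV
  have h2 : flp (substB 2 le_rfl P) = substA 2 le_rfl P := by rw [← h1, flp_flp]
  conv_lhs => rw [h, map_sub, h1, h2]
  conv_rhs => rw [h]
  ring

/-- For antisymmetric `P` the three-term relation reads `P + rot P + rot (rot P) = 0`. -/
lemma W_two_eq_map {d : ℕ} (hd : Even d) : W (d + 2) 2 le_rfl =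
    (LinearMap.ker (avg ∘ₗ antiForm d)).map (antiForm d) := by
  have key : ∀ P ∈ V (d + 2) 2, flp P = -P →
      (P = substA 2 le_rfl P - substB 2 le_rfl P ↔ avg P = 0) := by
    intro P hP hf
    rw [substA_eq_rot hP, substB_eq_rot hP, hf, avg_apply, ← sub_eq_zero]
    simp only [map_neg]
    ring_nf
  apply le_antisymm
  · intro P hP
    have hf := flp_eq_neg_of_mem_W hP
    obtain ⟨hV, h⟩ := mem_W.1 hP
    have hr : P - flp P ∈ LinearMap.range (antiForm d) := by
      have hle : V (d + 2) 2 ≤ (LinearMap.range (antiForm d)).comap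
          (LinearMap.id - flp.toLinearMap) := by
        refine (V_two_le_span d).trans (Submodule.span_le.2 ?_)
        rintro _ ⟨i, j, hij, h1, h2, h3, h4, rfl⟩
        have := sub_mem_range_antiForm hij h1 h2 h3 h4
        simpa [mul_comm] using this
      exact hle hV
    obtain ⟨c, hc⟩ := hr
    have hP2 : antiForm d ((1 / 2 : ℚ) • c) = P := by
      rw [map_smul, hc, hf]
      module
    refine ⟨(1 / 2 : ℚ) • c, ?_, hP2⟩
    rw [SetLike.mem_coe, LinearMap.mem_ker, LinearMap.comp_apply, hP2]
    exact (key P hV hf).1 h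
  · rintro _ ⟨c, hc, rfl⟩
    have hV : antiForm d c ∈ V (d + 2) 2 := by
      rw [antiForm, Fintype.linearCombination_apply]
      refine Submodule.sum_mem _ fun k _ => Submodule.smul_mem _ _ ?_
      have hk := k.2
      obtain ⟨m, rfl⟩ := hd
      refine sub_mem (monomial_mem_V_two ?_ ?_ ?_ ?_ ?_) (monomial_mem_V_two ?_ ?_ ?_ ?_ ?_) <;>
      first
      | omega
      | exact ⟨(k : ℕ) + 1, by omega⟩
      | exact ⟨m - (k + 1), by omega⟩
    exact mem_W.2 ⟨hV, (key _ hV (antiForm_mem c).2).2 hc⟩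

lemma finrank_W_two_add {d : ℕ} (hd : Even d) :
    Module.finrank ℚ (W (d + 2) 2 le_rfl) + d / 6 = (d - 2) / 4 := by
  rw [W_two_eq_map hd, ← (Submodule.equivMapOfInjective _ (antiForm_injective d) _).finrank_eq]
  exact finrank_ker_avg_antiForm hd

lemma V_two_eq_bot {N : ℕ} (hN : ¬ Even N ∨ N < 2) : V N 2 = ⊥ := by
  rw [V, Submodule.span_eq_bot]
  rintro _ ⟨⟨m, hm⟩, -⟩
  simp only [oddIndices, Finset.mem_filter, Finset.Nat.mem_antidiagonalTuple,
    Fin.sum_univ_two, Fin.forall_fin_two] at hm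
  obtain ⟨h0, ⟨h1, h2⟩, h3, h4⟩ := hm
  have := h2.add_odd h4
  rw [h0] at this
  rcases hN with h | h
  · exact absurd this h
  · omega

/-- The dimension of the space of cusp forms of weight `N` for the modular group. -/
def cuspDim (N : ℕ) : ℕ := if Even N then (N - 4) / 4 - (N - 2) / 6 else 0

lemma finrank_W_two (N : ℕ) : Module.finrank ℚ (W N 2 le_rfl) = cuspDim N := by
  rw [cuspDim]
  by_cases h : ¬ Even N ∨ N < 2
  · have : W N 2 le_rfl = ⊥ := by rw [W, V_two_eq_bot h, bot_inf_eq]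
    rw [this, finrank_bot]
    split_ifs with h' <;> [skip; rfl]
    have := h.resolve_left (not_not.2 h')
    omega
  · push Not at h
    obtain ⟨h1, h2⟩ := h
    obtain ⟨d, rfl⟩ := Nat.exists_eq_add_of_le' h2
    have hd : Even d := by simpa [Nat.even_add] using h1
    have := finrank_W_two_add hd
    rw [if_pos h1]
    omega

/-! ### The free algebra, the derivations of the letters, and period polynomials -/

/-- The free associative algebra on the letters `n ∈ ℕ`, as the space with basis all words. -/
abbrev Words : Type := List ℕ →₀ ℚ

/-- Left multiplication by a letter. -/
def consL (a : ℕ) : Words →ₗ[ℚ] Words := Finsupp.lmapDomain ℚ ℚ (List.cons a)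

@[simp] lemma consL_single (a : ℕ) (l : List ℕ) (c : ℚ) :
    consL a (Finsupp.single l c) = Finsupp.single (a :: l) c := by
  simp [consL]

/-- The admissible letters. -/
def IsLetter (n : ℕ) : Prop := 3 ≤ n ∧ Odd n

instance : DecidablePred IsLetter := fun n => inferInstanceAs (Decidable (3 ≤ n ∧ Odd n))

section BinaryForms

variable {E F : Type*} [AddCommGroup E] [Module ℚ E] [AddCommGroup F] [Module ℚ F]

lemma forms_ext {f g : MvPolynomial (Fin 2) ℚ →ₗ[ℚ] E}
    (h : ∀ i j, f (X 0 ^ i * X 1 ^ j) = g (X 0 ^ i * X 1 ^ j)) : f = g := by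
  refine (basisMonomials (Fin 2) ℚ).ext fun e => ?_
  simp only [coe_basisMonomials, monomial_fin_two, one_smul]
  exact h _ _

/-- `bisum f (∑ p(a, b) x^(a-1) y^(b-1)) = ∑ p(a, b) f(a, b)`. -/
def bisum (f : ℕ → ℕ → E) : MvPolynomial (Fin 2) ℚ →ₗ[ℚ] E :=
  (basisMonomials (Fin 2) ℚ).constr ℚ fun e => f (e 0 + 1) (e 1 + 1)

lemma bisum_monomial (f : ℕ → ℕ → E) (i j : ℕ) :
    bisum f (X 0 ^ i * X 1 ^ j) = f (i + 1) (j + 1) := by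
  have h := (basisMonomials (Fin 2) ℚ).constr_basis ℚ (fun e => f (e 0 + 1) (e 1 + 1))
    (Finsupp.equivFunOnFinite.symm ![i, j])
  simp only [coe_basisMonomials, monomial_fin_two, one_smul] at h
  simpa [bisum] using h

lemma map_bisum (g : E →ₗ[ℚ] F) (f : ℕ → ℕ → E) (P : MvPolynomial (Fin 2) ℚ) :
    g (bisum f P) = bisum (fun a b => g (f a b)) P := by
  have : g ∘ₗ bisum f = bisum fun a b => g (f a b) :=
    forms_ext fun i j => by rw [LinearMap.comp_apply, bisum_monomial, bisum_monomial]
  exact congrArg (fun h => h P) this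

lemma bisum_add (f g : ℕ → ℕ → E) (P : MvPolynomial (Fin 2) ℚ) :
    bisum (fun a b => f a b + g a b) P = bisum f P + bisum g P := by
  have : bisum (fun a b => f a b + g a b) = bisum f + bisum g :=
    forms_ext fun i j => by simp only [LinearMap.add_apply, bisum_monomial]
  exact congrArg (fun h => h P) this

lemma bisum_flp (f : ℕ → ℕ → E) (P : MvPolynomial (Fin 2) ℚ) :
    bisum f (flp P) = bisum (fun a b => f b a) P := by
  have : bisum f ∘ₗ flp.toLinearMap = bisum fun a b => f b a :=
    forms_ext fun i j => by
      rw [LinearMap.comp_apply, AlgHom.toLinearMap_apply, map_mul, map_pow, map_pow, flp_X_zero,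
        flp_X_one, mul_comm, bisum_monomial, bisum_monomial]
  exact congrArg (fun h => h P) this

lemma V_eqOn {N : ℕ} {f g : MvPolynomial (Fin 2) ℚ →ₗ[ℚ] E}
    (h : ∀ i j, IsLetter (i + 1) → IsLetter (j + 1) →
      f (X 0 ^ i * X 1 ^ j) = g (X 0 ^ i * X 1 ^ j))
    {P : MvPolynomial (Fin 2) ℚ} (hP : P ∈ V N 2) : f P = g P := by
  refine LinearMap.eqOn_span (s := Set.range _) ?_ hP
  rintro _ ⟨⟨m, hm⟩, rfl⟩
  simp only [oddIndices, Finset.mem_filter, Fin.forall_fin_two] at hm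
  obtain ⟨-, h0, h1⟩ := hm
  dsimp only
  rw [monomial_fin_two, one_smul]
  refine h _ _ ?_ ?_
  · simpa [expo, IsLetter, Nat.sub_add_cancel (show 1 ≤ m 0 by omega)] using h0
  · simpa [expo, IsLetter, Nat.sub_add_cancel (show 1 ≤ m 1 by omega)] using h1

lemma flp_of_mem_W {N : ℕ} {P : MvPolynomial (Fin 2) ℚ} (hP : P ∈ W N 2 le_rfl) :
    flp P = -P := by
  by_cases h : N < 2
  · have hV := (mem_W.1 hP).1
    rw [V_two_eq_bot (Or.inr h), Submodule.mem_bot] at hV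
    simp [hV]
  · obtain ⟨d, rfl⟩ := Nat.exists_eq_add_of_le' (not_lt.1 h)
    exact flp_eq_neg_of_mem_W hP

lemma bisum_swap {N : ℕ} {P : MvPolynomial (Fin 2) ℚ} (hP : P ∈ W N 2 le_rfl)
    (f : ℕ → ℕ → E) : bisum (fun a b => f b a) P = - bisum f P := by
  rw [← bisum_flp, flp_of_mem_W hP, map_neg]

/-- The form `P` is antisymmetric, so a symmetric summand contributes its own negative. -/
lemma bisum_symm {N : ℕ} {P : MvPolynomial (Fin 2) ℚ} (hP : P ∈ W N 2 le_rfl)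
    {f : ℕ → ℕ → E} (h : ∀ a b, f a b = f b a) : bisum f P = 0 := by
  have h1 := bisum_swap hP f
  have h2 : (fun a b => f b a) = f := by
    funext a b
    exact h b a
  rw [h2] at h1
  have h3 : (2 : ℚ) • bisum f P = 0 := by rw [two_smul, ← eq_neg_iff_add_eq_zero, ← h1]
  exact (smul_eq_zero.1 h3).resolve_left two_ne_zero

end BinaryForms

/-- The linear map `x^(a-1) y^(b-1) ↦ (w ↦ a b w)`, restricted to admissible `a` and `b`. -/
def emb₂ : MvPolynomial (Fin 2) ℚ →ₗ[ℚ] Words →ₗ[ℚ] Words :=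
  bisum fun a b => if IsLetter a ∧ IsLetter b then consL a ∘ₗ consL b else 0

/-- The linear map `x^(a-1) y^(b-1) z^(c-1) ↦ (w ↦ a b c w)`, restricted to admissible letters. -/
def emb₃ : MvPolynomial (Fin 3) ℚ →ₗ[ℚ] Words →ₗ[ℚ] Words :=
  (basisMonomials (Fin 3) ℚ).constr ℚ fun e =>
    if IsLetter (e 0 + 1) ∧ IsLetter (e 1 + 1) ∧ IsLetter (e 2 + 1) then
      consL (e 0 + 1) ∘ₗ consL (e 1 + 1) ∘ₗ consL (e 2 + 1) else 0

lemma emb₂_monomial (i j : ℕ) : emb₂ (X 0 ^ i * X 1 ^ j) =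
    if IsLetter (i + 1) ∧ IsLetter (j + 1) then consL (i + 1) ∘ₗ consL (j + 1) else 0 := by
  rw [emb₂, bisum_monomial]

lemma emb₃_monomial (i j k : ℕ) : emb₃ (X 0 ^ i * X 1 ^ j * X 2 ^ k) =
    if IsLetter (i + 1) ∧ IsLetter (j + 1) ∧ IsLetter (k + 1) then
      consL (i + 1) ∘ₗ consL (j + 1) ∘ₗ consL (k + 1) else 0 := by
  have h := (basisMonomials (Fin 3) ℚ).constr_basis ℚ (fun e =>
    if IsLetter (e 0 + 1) ∧ IsLetter (e 1 + 1) ∧ IsLetter (e 2 + 1) then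
      consL (e 0 + 1) ∘ₗ consL (e 1 + 1) ∘ₗ consL (e 2 + 1) else 0)
    (Finsupp.equivFunOnFinite.symm ![i, j, k])
  rw [coe_basisMonomials] at h
  dsimp only at h
  rw [monomial_eq, Finsupp.prod_fintype _ _ (by simp), Fin.prod_univ_three, C_1, one_mul] at h
  simpa [emb₃] using h

/-- The polynomial `(y - x)^(a-1) (x^(c-1) - y^(c-1))`. -/
def pairPoly (a c : ℕ) : MvPolynomial (Fin 2) ℚ :=
  (X 1 - X 0) ^ (a - 1) * (X 0 ^ (c - 1) - X 1 ^ (c - 1))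

/-- The action of the letter `a` on the first letter `c` of a word `c w`. -/
def pairAct (a c : ℕ) : Words →ₗ[ℚ] Words := emb₂ (pairPoly a c)

lemma emb₂_pairPoly (a c : ℕ) : emb₂ (pairPoly a c) = pairAct a c := rfl

/-- The action of the letter `a` on a word by the Leibniz rule. -/
def derWord (a : ℕ) : List ℕ → Words
  | [] => 0
  | c :: w => pairAct a c (Finsupp.single w 1) + consL c (derWord a w)

/-- The derivation of the free algebra attached to the letter `a`. -/
def der (a : ℕ) : Words →ₗ[ℚ] Words := Finsupp.linearCombination ℚ (derWord a)

lemma der_single (a : ℕ) (w : List ℕ) : der a (Finsupp.single w 1) = derWord a w := by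
  simp [der]

lemma words_ext {E : Type*} [AddCommGroup E] [Module ℚ E] {f g : Words →ₗ[ℚ] E}
    (h : ∀ w, f (Finsupp.single w 1) = g (Finsupp.single w 1)) : f = g :=
  Finsupp.lhom_ext' fun w => LinearMap.ext_ring (h w)

lemma der_consL (a c : ℕ) (w : Words) :
    der a (consL c w) = pairAct a c w + consL c (der a w) := by
  have : der a ∘ₗ consL c = pairAct a c + consL c ∘ₗ der a := words_ext fun w => by
    simp only [LinearMap.comp_apply, consL_single, der_single, LinearMap.add_apply, derWord]
  exact congrArg (fun f => f w) this

lemma emb₂_of_odd {d : ℕ} (hd : Odd d) {P : MvPolynomial (Fin 2) ℚ} (hP : P ∈ Forms d) :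
    emb₂ P = 0 := by
  refine forms_eqOn (f := emb₂) (g := 0) (fun i j hij => ?_) hP
  rw [emb₂_monomial, if_neg, LinearMap.zero_apply]
  rintro ⟨⟨-, h1⟩, -, h2⟩
  have := h1.add_odd h2
  rw [← hij] at hd
  have h3 : Even (i + j) := by
    rw [Nat.even_iff] at *
    omega
  exact (Nat.not_even_iff_odd.2 hd) h3

lemma pairPoly_mem_forms (a c : ℕ) : pairPoly a c ∈ Forms (a - 1 + (c - 1)) := by
  have x := isHomogeneous_X ℚ (0 : Fin 2)
  have y := isHomogeneous_X ℚ (1 : Fin 2)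
  have := ((y.sub x).pow (a - 1)).mul ((x.pow (c - 1)).sub (y.pow (c - 1)))
  simpa [pairPoly] using this

/-- This makes truncation to admissible letters compatible with iterated derivations: a discarded
letter could never lead back to admissible ones. For `k = 0` the polynomial is zero; otherwise `k`
is odd, the degree is odd, and no monomial has both exponents even. -/
lemma pairAct_of_not_isLetter {b k : ℕ} (hb : IsLetter b) (hk : ¬ IsLetter (k + 1)) :
    pairAct b (k + 1) = 0 := by
  rcases Nat.eq_zero_or_pos k with rfl | hk0
  · simp [pairAct, pairPoly]
  · refine emb₂_of_odd ?_ (pairPoly_mem_forms b (k + 1))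
    obtain ⟨h1, h2⟩ := hb
    rw [IsLetter, not_and_or, Nat.not_odd_iff_even] at hk
    have hk' : Odd k := by
      rcases hk with hk | hk
      · have : k = 1 := by omega
        simp [this]
      · simpa [Nat.even_add_one] using hk
    exact (Nat.Odd.sub_odd h2 odd_one).add_odd hk'

/-- The polynomial version of `der b` on words of length two. -/
def derPoly (b : ℕ) : MvPolynomial (Fin 2) ℚ →ₗ[ℚ] MvPolynomial (Fin 3) ℚ :=
  LinearMap.mulLeft ℚ ((X 1 - X 0) ^ (b - 1)) ∘ₗ
      ((rename ![0, 2]).toLinearMap - (rename ![1, 2]).toLinearMap) +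
    LinearMap.mulLeft ℚ ((X 2 - X 1) ^ (b - 1)) ∘ₗ
      ((rename ![0, 1]).toLinearMap - (rename ![0, 2]).toLinearMap)

lemma derPoly_apply (b : ℕ) (g : MvPolynomial (Fin 2) ℚ) :
    derPoly b g = (X 1 - X 0) ^ (b - 1) * (rename ![0, 2] g - rename ![1, 2] g) +
      (X 2 - X 1) ^ (b - 1) * (rename ![0, 1] g - rename ![0, 2] g) := rfl

lemma emb₃_mul_right (h : MvPolynomial (Fin 2) ℚ) (k : ℕ) :
    emb₃ (rename ![0, 1] h * X 2 ^ k) =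
      if IsLetter (k + 1) then emb₂ h ∘ₗ consL (k + 1) else 0 := by
  have : emb₃ ∘ₗ LinearMap.mulRight ℚ (X 2 ^ k) ∘ₗ (rename ![0, 1]).toLinearMap =
      if IsLetter (k + 1) then (LinearMap.lcomp ℚ Words (consL (k + 1))) ∘ₗ emb₂ else 0 := by
    refine forms_ext fun i j => ?_
    split_ifs with hk
    · simp [emb₂_monomial, emb₃_monomial, hk]
      split_ifs <;> rfl
    · simp [emb₃_monomial, hk]
  have h2 := congrArg (fun f => f h) this
  simp only [LinearMap.comp_apply, AlgHom.toLinearMap_apply, LinearMap.mulRight_apply] at h2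
  rw [h2]
  split_ifs <;> rfl

lemma emb₃_mul_left (h : MvPolynomial (Fin 2) ℚ) (k : ℕ) :
    emb₃ (X 0 ^ k * rename ![1, 2] h) =
      if IsLetter (k + 1) then consL (k + 1) ∘ₗ emb₂ h else 0 := by
  have : emb₃ ∘ₗ LinearMap.mulLeft ℚ (X 0 ^ k) ∘ₗ (rename ![1, 2]).toLinearMap =
      if IsLetter (k + 1) then (LinearMap.compRight ℚ (consL (k + 1))) ∘ₗ emb₂ else 0 := by
    refine forms_ext fun i j => ?_
    split_ifs with hk
    · simp [emb₂_monomial, emb₃_monomial, hk, ← mul_assoc]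
      split_ifs <;> simp
    · simp [emb₃_monomial, hk, ← mul_assoc]
  have h2 := congrArg (fun f => f h) this
  simp only [LinearMap.comp_apply, AlgHom.toLinearMap_apply, LinearMap.mulLeft_apply] at h2
  rw [h2]
  split_ifs <;> rfl

lemma derPoly_monomial (b i j : ℕ) : derPoly b (X 0 ^ i * X 1 ^ j) =
    rename ![0, 1] (pairPoly b (i + 1)) * X 2 ^ j +
      X 0 ^ i * rename ![1, 2] (pairPoly b (j + 1)) := by
  simp [derPoly_apply, pairPoly]
  ring

/-- Leibniz rule for `der b` on a product of two letters and `w`. When one of the two letters is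
inadmissible the left side is truncated to zero, and `pairAct_of_not_isLetter` gives the same on the
right. -/
lemma der_emb₂ {b : ℕ} (hb : IsLetter b) (g : MvPolynomial (Fin 2) ℚ) (w : Words) :
    der b (emb₂ g w) = emb₃ (derPoly b g) w + emb₂ g (der b w) := by
  have : LinearMap.compRight ℚ (der b) ∘ₗ emb₂ =
      emb₃ ∘ₗ derPoly b + LinearMap.lcomp ℚ Words (der b) ∘ₗ emb₂ := by
    refine forms_ext fun i j => ?_
    simp only [LinearMap.add_apply, LinearMap.comp_apply, derPoly_monomial, map_add,
      emb₃_mul_right, emb₃_mul_left, emb₂_monomial, emb₂_pairPoly]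
    refine LinearMap.ext fun w => ?_
    by_cases hi : IsLetter (i + 1) <;> by_cases hj : IsLetter (j + 1)
    · simp [hi, hj, der_consL, add_assoc]
    · simp [hi, hj, pairAct_of_not_isLetter hb hj]
    · simp [hi, hj, pairAct_of_not_isLetter hb hi]
    · simp [hi, hj]
  exact congrArg (fun f => f g w) this

/-- Summed over `P`, the two terms of `pairPoly` are the two substitutions of the three-term
relation. -/
lemma bisum_pairPoly {N : ℕ} {P : MvPolynomial (Fin 2) ℚ} (hP : P ∈ W N 2 le_rfl) :
    bisum pairPoly P = -P := by
  have : bisum pairPoly = (substB 2 le_rfl).toLinearMap - (substA 2 le_rfl).toLinearMap :=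
    forms_ext fun i j => by
      simp only [bisum_monomial, LinearMap.sub_apply, AlgHom.toLinearMap_apply, map_mul, map_pow,
        substA_X_zero, substA_X_one, substB_X_zero, substB_X_one, pairPoly, Nat.add_sub_cancel]
      ring
  have h := (mem_W.1 hP).2
  rw [this, LinearMap.sub_apply, ← neg_sub]
  exact congrArg Neg.neg h.symm

lemma bisum_pairAct {N : ℕ} {P : MvPolynomial (Fin 2) ℚ} (hP : P ∈ W N 2 le_rfl) :
    bisum pairAct P = -emb₂ P := by
  have h := map_bisum emb₂ pairPoly P
  rw [bisum_pairPoly hP, map_neg] at h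
  exact h.symm

lemma bisum_consL {N : ℕ} {P : MvPolynomial (Fin 2) ℚ} (hP : P ∈ V N 2) :
    bisum (fun a b => consL a ∘ₗ consL b) P = emb₂ P := by
  refine V_eqOn (fun i j hi hj => ?_) hP
  rw [bisum_monomial, emb₂_monomial, if_pos ⟨hi, hj⟩]

/-- The three-term relation of a period polynomial, homogenized in three variables. -/
lemma three_term {N : ℕ} {P : MvPolynomial (Fin 2) ℚ} (hP : P ∈ W N 2 le_rfl)
    (s t : MvPolynomial (Fin 3) ℚ) :
    aeval ![s, t] P = aeval ![t - s, t] P - aeval ![t - s, s] P := by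
  have hA : (aeval ![s, t] : MvPolynomial (Fin 2) ℚ →ₐ[ℚ] MvPolynomial (Fin 3) ℚ).comp
      (substA 2 le_rfl) = aeval ![t - s, t] := by
    ext1 i; fin_cases i <;> simp [substA]
  have hB : (aeval ![s, t] : MvPolynomial (Fin 2) ℚ →ₐ[ℚ] MvPolynomial (Fin 3) ℚ).comp
      (substB 2 le_rfl) = aeval ![t - s, s] := by
    ext1 i; fin_cases i <;> simp [substB]
  conv_lhs => rw [(mem_W.1 hP).2]
  rw [map_sub, ← hA, ← hB]
  rfl

lemma aeval_swap {N : ℕ} {P : MvPolynomial (Fin 2) ℚ} (hP : P ∈ W N 2 le_rfl)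
    (s t : MvPolynomial (Fin 3) ℚ) : aeval ![t, s] P = - aeval ![s, t] P := by
  have h : (aeval ![s, t] : MvPolynomial (Fin 2) ℚ →ₐ[ℚ] MvPolynomial (Fin 3) ℚ).comp flp =
      aeval ![t, s] := by
    ext1 i; fin_cases i <;> simp
  rw [← h, AlgHom.comp_apply, flp_of_mem_W hP, map_neg]

lemma bisum_pow_mul_pow (s t c : MvPolynomial (Fin 3) ℚ) (P : MvPolynomial (Fin 2) ℚ) :
    bisum (fun a b => s ^ (a - 1) * t ^ (b - 1) * c) P = aeval ![s, t] P * c := by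
  have : bisum (fun a b => s ^ (a - 1) * t ^ (b - 1) * c) = LinearMap.mulRight ℚ c ∘ₗ
      (aeval ![s, t] : MvPolynomial (Fin 2) ℚ →ₐ[ℚ] MvPolynomial (Fin 3) ℚ).toLinearMap :=
    forms_ext fun i j => by simp [bisum_monomial]
  rw [this]
  rfl

/-- This is the part of `∂_b ∂_a` in which both derivations hit the letter `c`. It consists of
values of `P` at differences of the variables; by antisymmetry all share the factor `x₀^(c-1) -
x₂^(c-1)`, and its cofactor is the three-term relation at `(x₁ - x₀, x₂ - x₀)`. -/
lemma bisum_derPoly {N : ℕ} {P : MvPolynomial (Fin 2) ℚ} (hP : P ∈ W N 2 le_rfl) (c : ℕ) :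
    bisum (fun a b => derPoly b (pairPoly a c)) P = 0 := by
  have h : (fun a b => derPoly b (pairPoly a c)) = fun a b : ℕ =>
      (X 2 - X 0 : MvPolynomial (Fin 3) ℚ) ^ (a - 1) * (X 1 - X 0) ^ (b - 1) *
        (X 0 ^ (c - 1) - X 2 ^ (c - 1)) +
      ((X 2 - X 1) ^ (a - 1) * (X 1 - X 0) ^ (b - 1) * (-(X 1 ^ (c - 1) - X 2 ^ (c - 1))) +
      ((X 1 - X 0) ^ (a - 1) * (X 2 - X 1) ^ (b - 1) * (X 0 ^ (c - 1) - X 1 ^ (c - 1)) +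
      (X 2 - X 0) ^ (a - 1) * (X 2 - X 1) ^ (b - 1) * (-(X 0 ^ (c - 1) - X 2 ^ (c - 1))))) := by
    funext a b
    simp [derPoly_apply, pairPoly]
    ring
  rw [h]
  simp only [bisum_add, bisum_pow_mul_pow]
  have h1 := three_term hP (X 1 - X 0) (X 2 - X 0)
  rw [show (X 2 - X 0 - (X 1 - X 0) : MvPolynomial (Fin 3) ℚ) = X 2 - X 1 by ring,
    aeval_swap hP (X 2 - X 0) (X 1 - X 0), aeval_swap hP (X 2 - X 0) (X 2 - X 1),
    aeval_swap hP (X 1 - X 0) (X 2 - X 1)] at h1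
  rw [aeval_swap hP (X 1 - X 0) (X 2 - X 1)]
  linear_combination (-(X 0 ^ (c - 1) - X 2 ^ (c - 1) : MvPolynomial (Fin 3) ℚ)) * h1

lemma bisum_congr {E : Type*} [AddCommGroup E] [Module ℚ E] {N : ℕ}
    {f g : ℕ → ℕ → E} (h : ∀ a b, IsLetter a → IsLetter b → f a b = g a b)
    {P : MvPolynomial (Fin 2) ℚ} (hP : P ∈ V N 2) : bisum f P = bisum g P := by
  refine V_eqOn (fun i j hi hj => ?_) hP
  rw [bisum_monomial, bisum_monomial, h _ _ hi hj]

/-- The derivations attached to the letters commute along a period polynomial. -/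
lemma bisum_der_der {N : ℕ} {P : MvPolynomial (Fin 2) ℚ} (hP : P ∈ W N 2 le_rfl) (w : Words) :
    bisum (fun a b => der b (der a w)) P = 0 := by
  have key : ∀ l : List ℕ, bisum (fun a b => der b (der a (Finsupp.single l 1))) P = 0 := by
    intro l
    induction l with
    | nil => rw [bisum_symm hP]; intro a b; simp [der_single, derWord]
    | cons c l ih =>
      set w : Words := Finsupp.single l 1
      -- The derivations hit `c` both times (`bisum_derPoly`), once each (symmetric in `a`, `b`,
      -- hence cancelling), or never (induction).
      have h1 : bisum (fun a b => der b (der a (Finsupp.single (c :: l) 1))) P =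
          bisum (fun a b => emb₃ (derPoly b (pairPoly a c)) w +
            ((pairAct a c (der b w) + pairAct b c (der a w)) +
              consL c (der b (der a w)))) P := by
        refine bisum_congr (fun a b _ hb => ?_) (mem_W.1 hP).1
        have : (Finsupp.single (c :: l) 1 : Words) = consL c w := by simp [w]
        rw [this, der_consL, map_add, ← emb₂_pairPoly, der_emb₂ hb, der_consL]
        abel
      rw [h1, bisum_add, bisum_add, ← map_bisum (consL c), ih, map_zero, add_zero,
        bisum_symm hP (f := fun a b => pairAct a c (der b w) + pairAct b c (der a w))
          (fun a b => add_comm _ _), add_zero]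
      have h2 := map_bisum (LinearMap.applyₗ w ∘ₗ emb₃) (fun a b => derPoly b (pairPoly a c)) P
      rw [bisum_derPoly hP, map_zero] at h2
      exact h2.symm
  have : bisum (fun a b => der b ∘ₗ der a) P = 0 := words_ext fun l => by
    have := map_bisum (LinearMap.applyₗ (Finsupp.single l 1)) (fun a b => der b ∘ₗ der a) P
    exact this.trans (key l)
  have h := map_bisum (LinearMap.applyₗ w) (fun a b => der b ∘ₗ der a) P
  rw [this, map_zero] at h
  exact h.symm

/-! ### The action of the first letter on `P w` for `P ∈ W_{N,2}` -/

/-- The action of the first letter on the rest of the word: `a w ↦ a w + der a w`. -/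
def act : Words →ₗ[ℚ] Words := Finsupp.linearCombination ℚ fun l : List ℕ =>
  match l with
  | [] => 0
  | a :: w => Finsupp.single (a :: w) 1 + derWord a w

lemma act_consL (a : ℕ) (w : Words) : act (consL a w) = consL a w + der a w := by
  have : act ∘ₗ consL a = consL a + der a := words_ext fun w => by
    simp [act, der_single]
  exact congrArg (fun f => f w) this

/-- `f` applied behind the first letter. -/
def tailMap (f : Words →ₗ[ℚ] Words) : Words →ₗ[ℚ] Words :=
  Finsupp.linearCombination ℚ fun l : List ℕ =>
    match l with
    | [] => 0
    | a :: w => consL a (f (Finsupp.single w 1))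

lemma tailMap_consL (f : Words →ₗ[ℚ] Words) (a : ℕ) (w : Words) :
    tailMap f (consL a w) = consL a (f w) := by
  have : tailMap f ∘ₗ consL a = consL a ∘ₗ f := words_ext fun w => by simp [tailMap]
  exact congrArg (fun f => f w) this

lemma emb₂_eq_bisum {N : ℕ} {P : MvPolynomial (Fin 2) ℚ} (hP : P ∈ V N 2) (w : Words) :
    emb₂ P w = bisum (fun a b => consL a (consL b w)) P := by
  rw [← bisum_consL hP]
  exact map_bisum (LinearMap.applyₗ w) (fun a b => consL a ∘ₗ consL b) P

lemma bisum_pairAct_apply {N : ℕ} {P : MvPolynomial (Fin 2) ℚ} (hP : P ∈ W N 2 le_rfl)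
    (w : Words) : bisum (fun a b => pairAct a b w) P = - emb₂ P w := by
  have := map_bisum (LinearMap.applyₗ w) pairAct P
  rw [bisum_pairAct hP] at this
  exact this.symm

/-- In `a b w + ∂_a(b) w + b ∂_a w` the first two terms cancel after summation, since `∂_a(b)` sums
to `-P`. -/
lemma act_emb₂ {N : ℕ} {P : MvPolynomial (Fin 2) ℚ} (hP : P ∈ W N 2 le_rfl) (w : Words) :
    act (emb₂ P w) = bisum (fun a b => consL b (der a w)) P := by
  rw [emb₂_eq_bisum (mem_W.1 hP).1, map_bisum]
  simp only [act_consL, der_consL, bisum_add]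
  rw [bisum_pairAct_apply hP, ← emb₂_eq_bisum (mem_W.1 hP).1]
  abel

/-- The correction term is `a ∂_b w`; antisymmetry of `P` turns it into minus the sum in `act_emb₂`.
-/
lemma tailMap_act_emb₂ {N : ℕ} {P : MvPolynomial (Fin 2) ℚ} (hP : P ∈ W N 2 le_rfl)
    (w : Words) :
    tailMap act (emb₂ P w) = emb₂ P w - bisum (fun a b => consL b (der a w)) P := by
  rw [emb₂_eq_bisum (mem_W.1 hP).1, map_bisum]
  simp only [tailMap_consL, act_consL, map_add, bisum_add]
  rw [bisum_swap hP (f := fun b a => consL a (der b w))]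
  abel

lemma act_add_tailMap_act {N : ℕ} {P : MvPolynomial (Fin 2) ℚ} (hP : P ∈ W N 2 le_rfl)
    (w : Words) : act (emb₂ P w) + tailMap act (emb₂ P w) = emb₂ P w := by
  rw [act_emb₂ hP, tailMap_act_emb₂ hP]
  abel

/-- Applying `act` to `b ∂_a w` adds only `∂_b ∂_a w`, which sums to zero; what remains is `act (P
w)` itself, and it cancels. -/
lemma act_tailMap_act {N : ℕ} {P : MvPolynomial (Fin 2) ℚ} (hP : P ∈ W N 2 le_rfl)
    (w : Words) : act (tailMap act (emb₂ P w)) = 0 := by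
  rw [tailMap_act_emb₂ hP, map_sub, act_emb₂ hP, map_bisum]
  simp only [act_consL, bisum_add]
  rw [bisum_der_der hP]
  abel

/-! ### The numbers `e` as matrix coefficients of `act` -/

lemma consL_apply (a : ℕ) (w : Words) (b : ℕ) (l : List ℕ) :
    consL a w (b :: l) = if a = b then w l else 0 := by
  have : Finsupp.lapply (b :: l) ∘ₗ consL a = if a = b then Finsupp.lapply l else 0 :=
    words_ext fun v => by
      split_ifs with h
      · subst h
        simp [Finsupp.single_apply]
      · simp [h]
  have h := congrArg (fun f => f w) this
  simp only [LinearMap.comp_apply, Finsupp.lapply_apply] at h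
  rw [h]
  split_ifs <;> rfl

lemma emb₂_apply {a b : ℕ} (ha : IsLetter a) (hb : IsLetter b) (P : MvPolynomial (Fin 2) ℚ)
    (w : Words) (l : List ℕ) : emb₂ P w (a :: b :: l) =
      coeff (Finsupp.equivFunOnFinite.symm ![a - 1, b - 1]) P * w l := by
  have : Finsupp.lapply (a :: b :: l) ∘ₗ LinearMap.applyₗ w ∘ₗ emb₂ =
      LinearMap.mulRight ℚ (w l) ∘ₗ
        lcoeff ℚ (Finsupp.equivFunOnFinite.symm ![a - 1, b - 1]) := by
    refine forms_ext fun i j => ?_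
    have e1 : (i = a - 1 ↔ i + 1 = a) := by have := ha.1; omega
    have e2 : (j = b - 1 ↔ j + 1 = b) := by have := hb.1; omega
    have hc : coeff (Finsupp.equivFunOnFinite.symm ![a - 1, b - 1])
        (X 0 ^ i * X 1 ^ j : MvPolynomial (Fin 2) ℚ) = if i + 1 = a ∧ j + 1 = b then 1 else 0 := by
      simp [X_pow_eq_monomial, monomial_mul, coeff_monomial, DFunLike.ext_iff, Fin.forall_fin_two,
        e1, e2]
    simp only [LinearMap.comp_apply, emb₂_monomial, LinearMap.applyₗ_apply_apply,
      Finsupp.lapply_apply, lcoeff_apply, hc, LinearMap.mulRight_apply]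
    by_cases hi : i + 1 = a
    · by_cases hj : j + 1 = b
      · subst hi hj
        simp [ha, hb, consL_apply]
      · simp only [hj, and_false, if_false, zero_mul]
        split_ifs <;> simp [consL_apply, hj]
    · simp only [hi, false_and, if_false, zero_mul]
      split_ifs <;> simp [consL_apply, hi]
  exact congrArg (fun f => f P) this

lemma monomial_expo_succ {s : ℕ} (w : Fin (s + 1) → ℕ) :
    monomial (expo w) (1 : ℚ) =
      X 0 ^ (w 0 - 1) * rename Fin.succ (monomial (expo fun i => w i.succ) 1) := by
  rw [monomial_eq, monomial_eq, Finsupp.prod_fintype _ _ (by simp),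
    Finsupp.prod_fintype _ _ (by simp), Fin.prod_univ_succ]
  simp [expo]

lemma expo_inj {s : ℕ} {m n : Fin s → ℕ} (hm : ∀ i, IsLetter (m i)) (hn : ∀ i, IsLetter (n i)) :
    expo m = expo n ↔ m = n := by
  refine ⟨fun h => funext fun i => ?_, fun h => by rw [h]⟩
  have := DFunLike.congr_fun h i
  simp only [expo, Finsupp.coe_equivFunOnFinite_symm] at this
  have h1 := (hm i).1
  have h2 := (hn i).1
  omega

lemma coeff_X_pow_mul_rename_succ {s : ℕ} (k : ℕ) (Q : MvPolynomial (Fin s) ℚ)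
    (n : Fin (s + 1) → ℕ) : coeff (expo n) (X 0 ^ k * rename Fin.succ Q) =
      if k = n 0 - 1 then coeff (expo fun i => n i.succ) Q else 0 := by
  have : lcoeff ℚ (expo n) ∘ₗ LinearMap.mulLeft ℚ (X 0 ^ k) ∘ₗ (rename Fin.succ).toLinearMap =
      if k = n 0 - 1 then lcoeff ℚ (expo fun i => n i.succ) else 0 := by
    refine (basisMonomials (Fin s) ℚ).ext fun d => ?_
    simp only [coe_basisMonomials, LinearMap.comp_apply, AlgHom.toLinearMap_apply,
      LinearMap.mulLeft_apply, lcoeff_apply, rename_monomial, X_pow_eq_monomial, monomial_mul,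
      coeff_monomial, mul_one]
    have h0 : Finsupp.mapDomain Fin.succ d (0 : Fin (s + 1)) = 0 :=
      Finsupp.mapDomain_of_notMem_range _ _ (by simp)
    have hs : ∀ i, Finsupp.mapDomain Fin.succ d (i.succ : Fin (s + 1)) = d i :=
      fun i => Finsupp.mapDomain_apply (Fin.succ_injective s) _ _
    have key : (Finsupp.single (0 : Fin (s + 1)) k + Finsupp.mapDomain Fin.succ d = expo n) ↔
        k = n 0 - 1 ∧ d = expo fun i => n i.succ := by
      rw [DFunLike.ext_iff, Fin.forall_fin_succ, DFunLike.ext_iff (f := d)]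
      simp [h0, hs, expo]
    simp only [key]
    split_ifs <;> simp_all
  have h := congrArg (fun f => f Q) this
  simp only [LinearMap.comp_apply, AlgHom.toLinearMap_apply, LinearMap.mulLeft_apply,
    lcoeff_apply] at h
  rw [h]
  split_ifs <;> rfl

lemma coeff_rename_mul_rename {s : ℕ} (P : MvPolynomial (Fin 2) ℚ) (Q : MvPolynomial (Fin s) ℚ)
    (n : Fin (s + 2) → ℕ) :
    coeff (expo n) (rename ![0, 1] P * rename Fin.succ (rename Fin.succ Q)) =
      coeff (Finsupp.equivFunOnFinite.symm ![n 0 - 1, n 1 - 1]) P *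
        coeff (expo fun i => n i.succ.succ) Q := by
  have : lcoeff ℚ (expo n) ∘ₗ LinearMap.mulRight ℚ (rename Fin.succ (rename Fin.succ Q)) ∘ₗ
      (rename (![0, 1] : Fin 2 → Fin (s + 2))).toLinearMap =
      LinearMap.mulRight ℚ (coeff (expo fun i => n i.succ.succ) Q) ∘ₗ
        lcoeff ℚ (Finsupp.equivFunOnFinite.symm ![n 0 - 1, n 1 - 1]) := by
    refine forms_ext fun i j => ?_
    have e : (X 0 ^ i * X 1 ^ j * rename Fin.succ (rename Fin.succ Q) :
        MvPolynomial (Fin (s + 2)) ℚ) =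
        X 0 ^ i * rename Fin.succ (X 0 ^ j * rename Fin.succ Q) := by
      simp [mul_assoc]
    have hc : coeff (Finsupp.equivFunOnFinite.symm ![n 0 - 1, n 1 - 1])
        (X 0 ^ i * X 1 ^ j : MvPolynomial (Fin 2) ℚ) =
          if i = n 0 - 1 ∧ j = n 1 - 1 then 1 else 0 := by
      simp [X_pow_eq_monomial, monomial_mul, coeff_monomial, DFunLike.ext_iff, Fin.forall_fin_two]
    simp only [LinearMap.comp_apply, AlgHom.toLinearMap_apply, LinearMap.mulRight_apply,
      lcoeff_apply, hc]
    rw [map_mul, map_pow, map_pow, rename_X, rename_X]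
    change coeff (expo n) (X 0 ^ i * X 1 ^ j * rename Fin.succ (rename Fin.succ Q)) = _
    rw [e, coeff_X_pow_mul_rename_succ, coeff_X_pow_mul_rename_succ]
    simp only [Fin.succ_zero_eq_one]
    split_ifs <;> simp_all
  exact congrArg (fun f => f P) this

/-- The part of the Ihara action of `x^(a-1)` given by the sum over the positions. -/
def iharaSum {s : ℕ} (a : ℕ) (g : MvPolynomial (Fin s) ℚ) (i : Fin s) :
    MvPolynomial (Fin (s + 1)) ℚ :=
  (X i.succ - X i.castSucc) ^ (a - 1) *
    (rename (Fin.succAbove i.succ) g - rename (Fin.succAbove i.castSucc) g)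

/-- The exponent `a - 1` is even, so the sign disappears and both differences have the same power.
-/
lemma ihara_X_pow {s : ℕ} {a : ℕ} (ha : IsLetter a) (g : MvPolynomial (Fin s) ℚ) :
    ihara (Polynomial.X ^ (a - 1)) g =
      X 0 ^ (a - 1) * rename Fin.succ g + ∑ i, iharaSum a g i := by
  have he : Even (a - 1) := Nat.Odd.sub_odd ha.2 odd_one
  rw [ihara]
  simp only [map_pow, Polynomial.aeval_X, Polynomial.natDegree_X_pow, he.neg_one_pow, one_mul]
  congr 1
  refine Finset.sum_congr rfl fun i _ => ?_
  rw [iharaSum, ← neg_sub (X i.succ) (X i.castSucc), he.neg_pow]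
  ring

/-- This and `iharaSum_succ` mirror the recursion of `derWord`: position zero acts on the first
letter, later positions act behind it. -/
lemma iharaSum_zero {s : ℕ} (a : ℕ) (w : Fin (s + 1) → ℕ) :
    iharaSum a (monomial (expo w) 1) 0 = rename ![0, 1] (pairPoly a (w 0)) *
      rename Fin.succ (rename Fin.succ (monomial (expo fun i => w i.succ) 1)) := by
  have h : (Fin.succAbove (1 : Fin (s + 2))) ∘ Fin.succ = Fin.succ ∘ Fin.succ := by
    funext i
    rw [Function.comp_apply, ← Fin.succ_zero_eq_one, Fin.succ_succAbove_succ]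
    simp
  rw [iharaSum, monomial_expo_succ]
  simp only [map_mul, map_pow, rename_X, rename_rename, Fin.succ_zero_eq_one, Fin.castSucc_zero, h,
    Fin.succAbove_zero, pairPoly, map_sub]
  simp
  ring

lemma iharaSum_succ {s : ℕ} (a : ℕ) (w : Fin (s + 1) → ℕ) (i : Fin s) :
    iharaSum a (monomial (expo w) 1) i.succ = X 0 ^ (w 0 - 1) *
      rename Fin.succ (iharaSum a (monomial (expo fun i => w i.succ) 1) i) := by
  have h : ∀ j : Fin (s + 1), (Fin.succAbove j.succ) ∘ Fin.succ = Fin.succ ∘ Fin.succAbove j := by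
    intro j
    funext i
    simp [Fin.succ_succAbove_succ]
  rw [iharaSum, iharaSum, monomial_expo_succ]
  simp only [map_mul, map_pow, rename_X, rename_rename, Fin.castSucc_succ, h, map_sub,
    Fin.succ_succAbove_zero]
  ring

lemma coeff_sum_iharaSum {a : ℕ} : ∀ {s : ℕ} (w : Fin s → ℕ) (n : Fin (s + 1) → ℕ),
    (∀ i, IsLetter (w i)) → (∀ i, IsLetter (n i)) →
    coeff (expo n) (∑ i, iharaSum a (monomial (expo w) 1) i) =
      derWord a (List.ofFn w) (List.ofFn n) := by
  intro s
  induction s with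
  | zero => intro w n _ _; simp [derWord]
  | succ s ih =>
    intro w n hw hn
    rw [Fin.sum_univ_succ, coeff_add, iharaSum_zero, coeff_rename_mul_rename]
    simp only [iharaSum_succ]
    rw [← Finset.mul_sum, ← map_sum, coeff_X_pow_mul_rename_succ,
      ih _ _ (fun i => hw i.succ) (fun i => hn i.succ), coeff_monomial,
      List.ofFn_succ (f := w), derWord, Finsupp.add_apply]
    congr 1
    · rw [List.ofFn_succ (f := n), List.ofFn_succ, pairAct, emb₂_apply (hn 0) (hn _),
        Finsupp.single_apply]
      simp only [expo_inj (fun i => hw i.succ) (fun i => hn i.succ.succ), List.ofFn_inj,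
        Fin.succ_zero_eq_one]
    · rw [List.ofFn_succ (f := n), consL_apply]
      have h1 := (hw 0).1
      have h2 := (hn 0).1
      have : (w 0 - 1 = n 0 - 1) ↔ w 0 = n 0 := by omega
      simp only [this]

lemma act_single_cons (a : ℕ) (l : List ℕ) :
    act (Finsupp.single (a :: l) 1) = Finsupp.single (a :: l) 1 + derWord a l := by
  simp [act]

lemma e_eq_act {r : ℕ} (m n : Fin r → ℕ) (hm : ∀ i, IsLetter (m i)) (hn : ∀ i, IsLetter (n i)) :
    e m n = act (Finsupp.single (List.ofFn m) 1) (List.ofFn n) := by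
  cases r with
  | zero => simp [e, act]
  | succ s =>
    rw [e, ihara_X_pow (hm 0), coeff_add, coeff_sum_iharaSum _ _ (fun i => hm i.succ) hn,
      ← monomial_expo_succ, List.ofFn_succ (f := m), act_single_cons, Finsupp.add_apply,
      coeff_monomial, Finsupp.single_apply, ← List.ofFn_succ (f := m)]
    simp only [List.ofFn_inj, expo_inj hm hn]

/-! ### Grading by weight and depth, and the total action -/

/-- The words of weight `N` and depth `r`. -/
def wordSet (N r : ℕ) : Set (List ℕ) := {l | l.length = r ∧ l.sum = N ∧ ∀ x ∈ l, IsLetter x}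

/-- The homogeneous component of weight `N` and depth `r`. -/
def Comp (N r : ℕ) : Submodule ℚ Words := Finsupp.supported ℚ ℚ (wordSet N r)

lemma mem_Comp {N r : ℕ} {z : Words} : z ∈ Comp N r ↔ ∀ l, z l ≠ 0 → l ∈ wordSet N r := by
  rw [Comp, Finsupp.mem_supported]
  simp [Set.subset_def]

lemma single_mem_Comp {N r : ℕ} {l : List ℕ} (h : l ∈ wordSet N r) (c : ℚ) :
    Finsupp.single l c ∈ Comp N r := Finsupp.single_mem_supported ℚ c h

lemma cons_mem_wordSet {a N r : ℕ} {l : List ℕ} :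
    a :: l ∈ wordSet N (r + 1) ↔ IsLetter a ∧ ∃ M, a + M = N ∧ l ∈ wordSet M r := by
  simp only [wordSet, Set.mem_ofPred_eq, List.length_cons, Nat.add_right_cancel_iff, List.sum_cons,
    List.forall_mem_cons]
  constructor
  · rintro ⟨h1, h2, h3, h4⟩
    exact ⟨h3, _, h2, h1, rfl, h4⟩
  · rintro ⟨h3, M, h2, h1, rfl, h4⟩
    exact ⟨h1, h2, h3, h4⟩

lemma Comp_induction {N r : ℕ} {S : Submodule ℚ Words}
    (h : ∀ l ∈ wordSet N r, Finsupp.single l 1 ∈ S) : Comp N r ≤ S := by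
  rw [Comp, Finsupp.supported_eq_span_single, Submodule.span_le]
  rintro _ ⟨l, hl, rfl⟩
  exact h l hl

lemma Comp_eqOn {E : Type*} [AddCommGroup E] [Module ℚ E] {N r : ℕ} {f g : Words →ₗ[ℚ] E}
    (h : ∀ l ∈ wordSet N r, f (Finsupp.single l 1) = g (Finsupp.single l 1))
    {z : Words} (hz : z ∈ Comp N r) : f z = g z :=
  Comp_induction (S := LinearMap.eqLocus f g) h hz

lemma consL_mem_Comp {a N r : ℕ} (ha : IsLetter a) {w : Words} (hw : w ∈ Comp N r) :
    consL a w ∈ Comp (a + N) (r + 1) := by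
  refine Comp_induction (S := (Comp (a + N) (r + 1)).comap (consL a)) (fun l hl => ?_) hw
  rw [Submodule.mem_comap, consL_single]
  exact single_mem_Comp (cons_mem_wordSet.2 ⟨ha, N, rfl, hl⟩) 1

lemma emb₂_mem_Comp {d N r : ℕ} {P : MvPolynomial (Fin 2) ℚ} (hP : P ∈ Forms d) {w : Words}
    (hw : w ∈ Comp N r) : emb₂ P w ∈ Comp (d + 2 + N) (r + 2) := by
  have h : Forms d ≤ (Comp (d + 2 + N) (r + 2)).comap (LinearMap.applyₗ w ∘ₗ emb₂) := by
    refine (forms_le_span d).trans (Submodule.span_le.2 ?_)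
    rintro _ ⟨i, j, rfl, rfl⟩
    simp only [SetLike.mem_coe, Submodule.mem_comap, LinearMap.comp_apply, emb₂_monomial,
      LinearMap.applyₗ_apply_apply]
    split_ifs with hl
    · have := consL_mem_Comp hl.1 (consL_mem_Comp hl.2 hw)
      rwa [show i + 1 + (j + 1 + N) = i + j + 2 + N by ring] at this
    · simp
  exact h hP

lemma derWord_mem_Comp {a : ℕ} (ha : IsLetter a) : ∀ {r N : ℕ} {l : List ℕ}, l ∈ wordSet N r →
    derWord a l ∈ Comp (a + N) (r + 1) := by
  intro r
  induction r with
  | zero =>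
    rintro N l ⟨h, -⟩
    rw [List.length_eq_zero_iff.1 h, derWord]
    exact zero_mem _
  | succ r ih =>
    intro N l hl
    match l, hl with
    | [], hl => exact absurd hl.1 (by simp)
    | c :: l, hl =>
      obtain ⟨hc, M, rfl, hl'⟩ := cons_mem_wordSet.1 hl
      refine add_mem ?_ ?_
      · have := emb₂_mem_Comp (pairPoly_mem_forms a c) (single_mem_Comp hl' 1)
        have h1 := ha.1
        have h2 := hc.1
        rwa [show a - 1 + (c - 1) + 2 + M = a + (c + M) by omega] at this
      · have := consL_mem_Comp hc (ih hl')
        rwa [show c + (a + M) = a + (c + M) by ring] at this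

/-- A linear map preserves weight and depth. -/
def IsGraded (f : Words →ₗ[ℚ] Words) : Prop := ∀ N r, ∀ z ∈ Comp N r, f z ∈ Comp N r

lemma isGraded_act : IsGraded act := by
  intro N r
  refine Comp_induction (S := (Comp N r).comap act) fun l hl => ?_
  rw [Submodule.mem_comap]
  cases l with
  | nil => simp [act]
  | cons a l =>
    obtain ⟨r, rfl⟩ : ∃ r', r = r' + 1 := ⟨l.length, by simpa using hl.1.symm⟩
    rw [act_single_cons]
    refine add_mem (single_mem_Comp hl 1) ?_
    obtain ⟨ha, M, rfl, h⟩ := cons_mem_wordSet.1 hl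
    exact derWord_mem_Comp ha h

lemma IsGraded.tailMap {f : Words →ₗ[ℚ] Words} (hf : IsGraded f) : IsGraded (tailMap f) := by
  intro N r
  refine Comp_induction (S := (Comp N r).comap (TotallyOdd.tailMap f)) fun l hl => ?_
  rw [Submodule.mem_comap]
  cases l with
  | nil => simp [TotallyOdd.tailMap]
  | cons a l =>
    obtain ⟨r, rfl⟩ : ∃ r', r = r' + 1 := ⟨l.length, by simpa using hl.1.symm⟩
    obtain ⟨ha, M, rfl, h⟩ := cons_mem_wordSet.1 hl
    rw [← consL_single, tailMap_consL]
    exact consL_mem_Comp ha (hf _ _ _ (single_mem_Comp h 1))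

/-- The composite of the Ihara actions of all letters of a word. -/
def fullAct : Words →ₗ[ℚ] Words := Finsupp.linearCombination ℚ fun l : List ℕ =>
  l.foldr (fun a z => act (consL a z)) (Finsupp.single [] 1)

lemma fullAct_nil : fullAct (Finsupp.single [] 1) = Finsupp.single [] 1 := by simp [fullAct]

lemma fullAct_consL (a : ℕ) (w : Words) : fullAct (consL a w) = act (consL a (fullAct w)) := by
  have : fullAct ∘ₗ consL a = act ∘ₗ consL a ∘ₗ fullAct := words_ext fun w => by simp [fullAct]
  exact congrArg (fun f => f w) this

lemma isGraded_fullAct : IsGraded fullAct := by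
  intro N r
  induction r generalizing N with
  | zero =>
    refine Comp_induction (S := (Comp N 0).comap fullAct) fun l hl => ?_
    obtain rfl := List.length_eq_zero_iff.1 hl.1
    rw [Submodule.mem_comap, fullAct_nil]
    exact single_mem_Comp hl 1
  | succ r ih =>
    refine Comp_induction (S := (Comp N (r + 1)).comap fullAct) fun l hl => ?_
    match l, hl with
    | [], hl => exact absurd hl.1 (by simp)
    | a :: l, hl =>
      obtain ⟨ha, M, rfl, h⟩ := cons_mem_wordSet.1 hl
      rw [Submodule.mem_comap, ← consL_single, fullAct_consL]
      exact isGraded_act _ _ _ (consL_mem_Comp ha (ih _ _ (single_mem_Comp h 1)))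

/-! ### The matrices as graded maps -/

lemma mem_oddIndices {N r : ℕ} {m : Fin r → ℕ} :
    m ∈ oddIndices N r ↔ ∑ i, m i = N ∧ ∀ i, IsLetter (m i) := by
  simp [oddIndices, Finset.Nat.mem_antidiagonalTuple, IsLetter]

lemma ofFn_mem_wordSet {N r : ℕ} {m : Fin r → ℕ} :
    List.ofFn m ∈ wordSet N r ↔ m ∈ oddIndices N r := by
  simp [wordSet, mem_oddIndices, List.sum_ofFn]

lemma exists_ofFn {N r : ℕ} {l : List ℕ} (hl : l ∈ wordSet N r) :
    ∃ m : Idx N r, List.ofFn m.1 = l := by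
  obtain ⟨rfl, -⟩ := id hl
  exact ⟨⟨l.get, ofFn_mem_wordSet.1 (by rwa [List.ofFn_get])⟩, List.ofFn_get l⟩

/-- Coefficient vectors as elements of the free algebra. -/
def toWords (N r : ℕ) : (Idx N r → ℚ) ≃ₗ[ℚ] Comp N r :=
  LinearEquiv.ofBijective
    (LinearMap.codRestrict (Comp N r)
      (Fintype.linearCombination ℚ fun m : Idx N r => (Finsupp.single (List.ofFn m.1) 1 : Words))
      fun u => by
        rw [Fintype.linearCombination_apply]
        exact Submodule.sum_mem _ fun m _ => Submodule.smul_mem _ _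
          (single_mem_Comp (ofFn_mem_wordSet.2 m.2) 1)) (by
    have key : ∀ (u : Idx N r → ℚ) (n : Idx N r), (Fintype.linearCombination ℚ
        (fun m : Idx N r => (Finsupp.single (List.ofFn m.1) 1 : Words)) u) (List.ofFn n.1) =
          u n := by
      intro u n
      rw [Fintype.linearCombination_apply, Finsupp.finsetSum_apply, Finset.sum_eq_single n]
      · simp
      · intro m _ hm
        have : List.ofFn m.1 ≠ List.ofFn n.1 := fun h =>
          hm (Subtype.ext (List.ofFn_injective h))
        simp [this]
      · simp
    constructor
    · intro u v h
      funext n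
      have h' := congrArg (fun z : Comp N r => z.1 (List.ofFn n.1)) h
      simpa only [LinearMap.codRestrict_apply, key] using h'
    · rintro ⟨z, hz⟩
      refine ⟨fun m => z (List.ofFn m.1), Subtype.ext (Finsupp.ext fun l => ?_)⟩
      by_cases hl : l ∈ wordSet N r
      · obtain ⟨n, rfl⟩ := exists_ofFn hl
        exact key _ n
      · have h1 := (mem_Comp (z := z)).1 hz l
        rw [LinearMap.codRestrict_apply, Fintype.linearCombination_apply, Finsupp.finsetSum_apply,
          Finset.sum_eq_zero, not_imp_comm.1 h1 hl]
        intro m _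
        have : List.ofFn m.1 ≠ l := by
          rintro rfl
          exact hl (ofFn_mem_wordSet.2 m.2)
        simp [this])

lemma toWords_coe {N r : ℕ} (u : Idx N r → ℚ) : (toWords N r u : Words) =
    ∑ m : Idx N r, u m • Finsupp.single (List.ofFn m.1) 1 :=
  Fintype.linearCombination_apply ..

lemma toWords_symm_apply {N r : ℕ} (z : Comp N r) (n : Idx N r) :
    (toWords N r).symm z n = z.1 (List.ofFn n.1) := by
  obtain ⟨u, rfl⟩ := (toWords N r).surjective z
  rw [LinearEquiv.symm_apply_apply, toWords_coe, Finsupp.finsetSum_apply, Finset.sum_eq_single n]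
  · simp
  · intro m _ hm
    have : List.ofFn m.1 ≠ List.ofFn n.1 := fun h => hm (Subtype.ext (List.ofFn_injective h))
    simp [this]
  · simp

lemma toWords_apply {N r : ℕ} (u : Idx N r → ℚ) (n : Idx N r) :
    (toWords N r u : Words) (List.ofFn n.1) = u n := by
  rw [← toWords_symm_apply, LinearEquiv.symm_apply_apply]

/-- A matrix whose entries are the coefficients of a graded map represents that map. -/
lemma toWords_vecMul {N r : ℕ} {A : Matrix (Idx N r) (Idx N r) ℚ} {f : Words →ₗ[ℚ] Words}
    (hf : IsGraded f)
    (h : ∀ m n : Idx N r, A m n = f (Finsupp.single (List.ofFn m.1) 1) (List.ofFn n.1))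
    (u : Idx N r → ℚ) : (toWords N r (Matrix.vecMul u A) : Words) = f (toWords N r u) := by
  have : toWords N r (Matrix.vecMul u A) = ⟨f (toWords N r u), hf _ _ _ (toWords N r u).2⟩ := by
    rw [← LinearEquiv.eq_symm_apply]
    funext n
    rw [toWords_symm_apply]
    change _ = f (toWords N r u) (List.ofFn n.1)
    rw [toWords_coe, map_sum, Finsupp.finsetSum_apply]
    simp only [map_smul, Finsupp.smul_apply, ← h, Matrix.vecMul, dotProduct, smul_eq_mul]
  rw [this]

lemma toWords_vecMul_E {N r : ℕ} (u : Idx N r → ℚ) :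
    (toWords N r (Matrix.vecMul u (E N r)) : Words) = act (toWords N r u) :=
  toWords_vecMul isGraded_act (fun m n => e_eq_act _ _ (mem_oddIndices.1 m.2).2
    (mem_oddIndices.1 n.2).2) u

lemma isGraded_tailMap_iterate {f : Words →ₗ[ℚ] Words} (hf : IsGraded f) (k : ℕ) :
    IsGraded (tailMap^[k] f) := by
  induction k with
  | zero => exact hf
  | succ k ih =>
    rw [Function.iterate_succ_apply']
    exact ih.tailMap

/-- The agreement of the first `k` letters is the Kronecker delta in the definition of
`E_{N,r}^{(j)}`, with `k = r - j`. -/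
lemma tailMap_iterate_apply (f : Words →ₗ[ℚ] Words) (k : ℕ) : ∀ l l' : List ℕ, k ≤ l.length →
    k ≤ l'.length → (tailMap^[k] f) (Finsupp.single l 1) l' =
      if l.take k = l'.take k then f (Finsupp.single (l.drop k) 1) (l'.drop k) else 0 := by
  induction k with
  | zero => simp
  | succ k ih =>
    intro l l' h h'
    match l, l', h, h' with
    | a :: l, b :: l', h, h' =>
      simp only [List.length_cons, Nat.add_le_add_iff_right] at h h'
      rw [Function.iterate_succ_apply', ← consL_single, tailMap_consL, consL_apply, ih l l' h h']
      by_cases hab : a = b <;> simp [hab]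

lemma ofFn_lastEntries {r j : ℕ} (h : j ≤ r) (m : Fin r → ℕ) :
    List.ofFn (lastEntries h m) = (List.ofFn m).drop (r - j) := by
  refine List.ext_getElem (by simp; omega) fun i h1 h2 => ?_
  simp [lastEntries]

lemma take_ofFn_eq {r k : ℕ} (h : k ≤ r) (m n : Fin r → ℕ) :
    (List.ofFn m).take k = (List.ofFn n).take k ↔ ∀ i : Fin r, (i : ℕ) < k → m i = n i := by
  constructor
  · intro heq i hi
    have h1 : ((List.ofFn m).take k)[(i : ℕ)]'(by simp; omega) =
      ((List.ofFn n).take k)[(i : ℕ)]'(by simp; omega) := by simp only [heq]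
    simpa using h1
  · intro H
    refine List.ext_getElem (by simp) fun i h1 h2 => ?_
    simp only [List.length_take, List.length_ofFn] at h1
    simpa using H ⟨i, by omega⟩ (by simp; omega)

lemma toWords_vecMul_Ej {N r j : ℕ} (hj : j ≤ r) (u : Idx N r → ℚ) :
    (toWords N r (Matrix.vecMul u (Ej N r j)) : Words) =
      (tailMap^[r - j] act) (toWords N r u) := by
  refine toWords_vecMul (isGraded_tailMap_iterate isGraded_act _) (fun m n => ?_) u
  rw [tailMap_iterate_apply _ _ _ _ (by simp) (by simp), ← ofFn_lastEntries hj,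
    ← ofFn_lastEntries hj]
  simp only [take_ofFn_eq (Nat.sub_le r j), Ej, Matrix.of_apply, dif_pos hj]
  split_ifs with h
  · exact e_eq_act _ _ (fun i => (mem_oddIndices.1 m.2).2 _) (fun i => (mem_oddIndices.1 n.2).2 _)
  · rfl

lemma toWords_vecMul_C_five {N : ℕ} (u : Idx N 5 → ℚ) :
    (toWords N 5 (Matrix.vecMul u (C N 5)) : Words) = fullAct (toWords N 5 u) := by
  have hC : C N 5 = Ej N 5 2 * (Ej N 5 3 * Ej N 5 4) * E N 5 := by
    simp [C, List.range'_succ, mul_assoc]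
  rw [hC, ← Matrix.vecMul_vecMul, ← Matrix.vecMul_vecMul, ← Matrix.vecMul_vecMul,
    toWords_vecMul_E, toWords_vecMul_Ej (by norm_num), toWords_vecMul_Ej (by norm_num),
    toWords_vecMul_Ej (by norm_num)]
  -- A row vector meets the leftmost factor `E^{(2)}` first, which is the innermost action in
  -- `fullAct`.
  refine Comp_eqOn (f := act ∘ₗ (tailMap^[1] act) ∘ₗ (tailMap^[2] act) ∘ₗ (tailMap^[3] act))
    (g := fullAct) (fun l hl => ?_) (toWords N 5 u).2
  obtain ⟨a, b, c, d, x, rfl⟩ : ∃ a b c d x, l = [a, b, c, d, x] := by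
    match l, hl.1 with
    | [a, b, c, d, x], _ => exact ⟨a, b, c, d, x, rfl⟩
  -- On one letter `act` is the identity, so no factor for `j = 1` is needed.
  have h1 : act (consL x (Finsupp.single [] 1)) = consL x (Finsupp.single [] 1) := by
    rw [act_consL, der_single, derWord, add_zero]
  simp only [Function.iterate_succ_apply', Function.iterate_zero, id, LinearMap.comp_apply,
    ← consL_single, tailMap_consL, fullAct_consL, fullAct_nil, h1]

/-! ### Tensor products of graded subspaces and their dimensions -/

section MatrixSubspace

variable {I J : Type} [Fintype I] [Fintype J]

/-- The matrices whose rows lie in `B` and whose columns lie in `A`. -/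
def matSub (A : Submodule ℚ (I → ℚ)) (B : Submodule ℚ (J → ℚ)) : Submodule ℚ (I → J → ℚ) where
  carrier := {f | (∀ i, f i ∈ B) ∧ ∀ j, (fun i => f i j) ∈ A}
  add_mem' := fun hf hg => ⟨fun i => B.add_mem (hf.1 i) (hg.1 i),
    fun j => A.add_mem (hf.2 j) (hg.2 j)⟩
  zero_mem' := ⟨fun _ => B.zero_mem, fun _ => A.zero_mem⟩
  smul_mem' := fun c _ hf => ⟨fun i => B.smul_mem c (hf.1 i), fun j => A.smul_mem c (hf.2 j)⟩

/-- Expanding the rows in a basis of `B` identifies such a matrix with a family of coefficient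
columns, and these columns range freely over `A`. -/
lemma finrank_matSub (A : Submodule ℚ (I → ℚ)) (B : Submodule ℚ (J → ℚ)) :
    Module.finrank ℚ (matSub A B) = Module.finrank ℚ A * Module.finrank ℚ B := by
  classical
  let b := Module.finBasis ℚ B
  let φ : (Fin (Module.finrank ℚ B) → A) →ₗ[ℚ] matSub A B :=
    { toFun := fun h => ⟨fun i j => ∑ l, (h l).1 i * (b l).1 j, by
        constructor
        · intro i
          have : (fun j => ∑ l, (h l).1 i * (b l).1 j) = ∑ l, (h l).1 i • (b l).1 := by
            funext j
            simp
          change (fun j => ∑ l, (h l).1 i * (b l).1 j) ∈ B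
          rw [this]
          exact Submodule.sum_mem _ fun l _ => B.smul_mem _ (b l).2
        · intro j
          have : (fun i => ∑ l, (h l).1 i * (b l).1 j) = ∑ l, (b l).1 j • (h l).1 := by
            funext i
            simp [mul_comm]
          rw [this]
          exact Submodule.sum_mem _ fun l _ => A.smul_mem _ (h l).2⟩
      map_add' := fun h h' => by
        ext i j
        simp [add_mul, Finset.sum_add_distrib]
      map_smul' := fun c h => by
        ext i j
        simp [Finset.mul_sum, mul_assoc] }
  have hφ : Function.Bijective φ := by
    constructor
    · intro h h' heq
      have h1 : ∀ i, ∑ l, (h l).1 i • b l = ∑ l, (h' l).1 i • b l := by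
        intro i
        refine Subtype.ext (funext fun j => ?_)
        have := congrFun (congrFun (congrArg Subtype.val heq) i) j
        simpa [φ] using this
      funext l
      refine Subtype.ext (funext fun i => ?_)
      have := congrArg b.equivFun (h1 i)
      rw [← b.equivFun_symm_apply, ← b.equivFun_symm_apply, LinearEquiv.apply_symm_apply,
        LinearEquiv.apply_symm_apply] at this
      exact congrFun this l
    · rintro ⟨f, hf1, hf2⟩
      -- A coordinate on `B` extends to a functional on the whole space, so each coefficient column
      -- is a linear combination of columns of `f`.
      have hA : ∀ l, (fun i => b.repr ⟨f i, hf1 i⟩ l) ∈ A := by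
        intro l
        obtain ⟨g, hg⟩ := LinearMap.exists_extend (b.coord l)
        have : (fun i => b.repr ⟨f i, hf1 i⟩ l) =
            ∑ j, g (Pi.single j 1) • fun i => f i j := by
          funext i
          have h1 : b.repr ⟨f i, hf1 i⟩ l = g (f i) := by
            rw [← b.coord_apply, ← hg]
            rfl
          rw [h1, LinearMap.pi_apply_eq_sum_univ g (f i), Finset.sum_apply]
          refine Finset.sum_congr rfl fun j _ => ?_
          have h2 : (fun k => if j = k then (1 : ℚ) else 0) = Pi.single j 1 := by
            funext k
            simp [Pi.single_apply, eq_comm]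
          rw [h2, Pi.smul_apply, smul_eq_mul, smul_eq_mul, mul_comm]
        rw [this]
        exact Submodule.sum_mem _ fun j _ => A.smul_mem _ (hf2 j)
      refine ⟨fun l => ⟨_, hA l⟩, Subtype.ext (funext fun i => funext fun j => ?_)⟩
      have := congrFun (congrArg Subtype.val (b.sum_repr ⟨f i, hf1 i⟩)) j
      rw [AddSubmonoidClass.coe_finsetSum, Finset.sum_apply] at this
      exact this
  rw [← (LinearEquiv.ofBijective φ hφ).finrank_eq, Module.finrank_pi_fintype]
  simp [mul_comm]

end MatrixSubspace

/-- The part of an element behind the prefix `x`. -/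
def row (x : List ℕ) : Words →ₗ[ℚ] Words :=
  Finsupp.lcomapDomain (x ++ ·) (List.append_right_injective x)

/-- The part of an element before the suffix `y`. -/
def col (y : List ℕ) : Words →ₗ[ℚ] Words :=
  Finsupp.lcomapDomain (· ++ y) (List.append_left_injective y)

@[simp] lemma row_apply (x : List ℕ) (z : Words) (l : List ℕ) : row x z l = z (x ++ l) := rfl

@[simp] lemma col_apply (y : List ℕ) (z : Words) (l : List ℕ) : col y z l = z (l ++ y) := rfl

/-- The part of weight `N` of the tensor product of the subspace `A` in depth `a` and the subspace
`B` in depth `b`. -/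
def tens (a b N : ℕ) (A B : Submodule ℚ Words) : Submodule ℚ Words where
  carrier := {z | z ∈ Comp N (a + b) ∧ (∀ x, x.length = a → row x z ∈ B) ∧
    ∀ y, y.length = b → col y z ∈ A}
  add_mem' := fun hz hw => ⟨add_mem hz.1 hw.1,
    fun x hx => by rw [map_add]; exact add_mem (hz.2.1 x hx) (hw.2.1 x hx),
    fun y hy => by rw [map_add]; exact add_mem (hz.2.2 y hy) (hw.2.2 y hy)⟩
  zero_mem' := ⟨zero_mem _, fun x _ => by rw [map_zero]; exact zero_mem _,
    fun x _ => by rw [map_zero]; exact zero_mem _⟩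
  smul_mem' := fun c z hz => ⟨Submodule.smul_mem _ c hz.1,
    fun x hx => by rw [map_smul]; exact Submodule.smul_mem _ c (hz.2.1 x hx),
    fun y hy => by rw [map_smul]; exact Submodule.smul_mem _ c (hz.2.2 y hy)⟩

lemma mem_tens {a b N : ℕ} {A B : Submodule ℚ Words} {z : Words} :
    z ∈ tens a b N A B ↔ z ∈ Comp N (a + b) ∧ (∀ x, x.length = a → row x z ∈ B) ∧
      ∀ y, y.length = b → col y z ∈ A := Iff.rfl

lemma append_mem_wordSet {a b N : ℕ} {x y : List ℕ} (hx : x.length = a) :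
    x ++ y ∈ wordSet N (a + b) ↔ ∃ i j, i + j = N ∧ x ∈ wordSet i a ∧ y ∈ wordSet j b := by
  simp only [wordSet, Set.mem_ofPred_eq, List.length_append, List.sum_append, List.forall_mem_append]
  constructor
  · rintro ⟨h1, h2, h3, h4⟩
    exact ⟨_, _, h2, ⟨hx, rfl, h3⟩, by omega, rfl, h4⟩
  · rintro ⟨i, j, rfl, ⟨h1, rfl, h3⟩, h4, rfl, h6⟩
    exact ⟨by omega, rfl, h3, h6⟩

lemma wordSet_unique {N N' r r' : ℕ} {x : List ℕ} (h : x ∈ wordSet N r) (h' : x ∈ wordSet N' r') :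
    N = N' := h.2.1.symm.trans h'.2.1

lemma row_mem_Comp {a b i j N : ℕ} (hij : i + j = N) {x : List ℕ} (hx : x ∈ wordSet i a)
    {z : Words} (hz : z ∈ Comp N (a + b)) : row x z ∈ Comp j b := by
  rw [mem_Comp] at hz ⊢
  intro l hl
  obtain ⟨i', j', h, h1, h2⟩ := (append_mem_wordSet hx.1).1 (hz _ hl)
  obtain rfl := wordSet_unique hx h1
  obtain rfl : j = j' := by omega
  exact h2

lemma col_mem_Comp {a b i j N : ℕ} (hij : i + j = N) {y : List ℕ} (hy : y ∈ wordSet j b)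
    {z : Words} (hz : z ∈ Comp N (a + b)) : col y z ∈ Comp i a := by
  rw [mem_Comp] at hz ⊢
  intro l hl
  have hl' := hz _ hl
  have h0 : l.length = a := by
    have := hl'.1
    rw [List.length_append, hy.1] at this
    omega
  obtain ⟨i', j', h, h1, h2⟩ := (append_mem_wordSet h0).1 hl'
  obtain rfl := wordSet_unique hy h2
  obtain rfl : i = i' := by omega
  exact h1

lemma row_eq_zero_or {a b N : ℕ} {x : List ℕ} (hx : x.length = a) {z : Words}
    (hz : z ∈ Comp N (a + b)) : row x z = 0 ∨ ∃ i j, i + j = N ∧ x ∈ wordSet i a := by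
  by_cases h : row x z = 0
  · exact Or.inl h
  · obtain ⟨l, hl⟩ := Finsupp.ne_iff.1 h
    obtain ⟨i, j, hij, h1, -⟩ := (append_mem_wordSet hx).1 (mem_Comp.1 hz _ hl)
    exact Or.inr ⟨i, j, hij, h1⟩

lemma col_eq_zero_or {a b N : ℕ} {y : List ℕ} (hy : y.length = b) {z : Words}
    (hz : z ∈ Comp N (a + b)) : col y z = 0 ∨ ∃ i j, i + j = N ∧ y ∈ wordSet j b := by
  by_cases h : col y z = 0
  · exact Or.inl h
  · obtain ⟨l, hl⟩ := Finsupp.ne_iff.1 h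
    have hl' := mem_Comp.1 hz _ hl
    have h0 : l.length = a := by
      have := hl'.1
      rw [List.length_append, hy] at this
      omega
    obtain ⟨i, j, hij, -, h1⟩ := (append_mem_wordSet h0).1 hl'
    exact Or.inr ⟨i, j, hij, h1⟩

/-- A subspace in weight `i` and depth `a`, in coordinates. -/
def vecSub (i a : ℕ) (A : Submodule ℚ Words) : Submodule ℚ (Idx i a → ℚ) :=
  A.comap ((Comp i a).subtype ∘ₗ (toWords i a).toLinearMap)

lemma mem_vecSub {i a : ℕ} {A : Submodule ℚ Words} {u : Idx i a → ℚ} :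
    u ∈ vecSub i a A ↔ (toWords i a u : Words) ∈ A := Iff.rfl

lemma finrank_vecSub (i a : ℕ) (A : Submodule ℚ Words) :
    Module.finrank ℚ (vecSub i a A) = Module.finrank ℚ (A ⊓ Comp i a : Submodule ℚ Words) := by
  have h : (vecSub i a A).map ((Comp i a).subtype ∘ₗ (toWords i a).toLinearMap) =
      A ⊓ Comp i a := by
    rw [vecSub, Submodule.map_comap_eq, inf_comm, LinearMap.range_comp, LinearEquiv.range,
      Submodule.map_top, Submodule.range_subtype]
  rw [← h]
  refine (Submodule.equivMapOfInjective _ ?_ _).finrank_eq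
  exact (Submodule.subtype_injective _).comp (toWords i a).injective

lemma vec_mem_vecSub {i a : ℕ} {A : Submodule ℚ Words} {z : Words} (hz : z ∈ Comp i a) :
    (fun m : Idx i a => z (List.ofFn m.1)) ∈ vecSub i a A ↔ z ∈ A := by
  have : (toWords i a fun m : Idx i a => z (List.ofFn m.1)) = ⟨z, hz⟩ := by
    rw [← LinearEquiv.eq_symm_apply]
    funext m
    rw [toWords_symm_apply]
  rw [mem_vecSub, this]

open Finset.HasAntidiagonal in
/-- The values of an element of depth `a + b` as a family of matrices. -/
def blocks (a b N : ℕ) : Words →ₗ[ℚ] ((p : antidiagonal N) → Idx p.1.1 a → Idx p.1.2 b → ℚ) where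
  toFun z _ x y := z (List.ofFn x.1 ++ List.ofFn y.1)
  map_add' _ _ := rfl
  map_smul' _ _ := rfl

lemma blocks_injOn {a b N : ℕ} {z : Words} (hz : z ∈ Comp N (a + b)) (h : blocks a b N z = 0) :
    z = 0 := by
  ext l
  by_contra hl
  have hl' := mem_Comp.1 hz l hl
  have hlen : (l.take a).length = a := by rw [List.length_take, hl'.1]; omega
  rw [← List.take_append_drop a l] at hl'
  obtain ⟨i, j, hij, h1, h2⟩ := (append_mem_wordSet hlen).1 hl'
  obtain ⟨x, hx⟩ := exists_ofFn h1
  obtain ⟨y, hy⟩ := exists_ofFn h2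
  have := congrFun (congrFun (congrFun h ⟨(i, j), Finset.HasAntidiagonal.mem_antidiagonal.2 hij⟩) x) y
  rw [← List.take_append_drop a l, ← hx, ← hy] at hl
  exact hl this

lemma blocks_surjective {a b N : ℕ} (g : (p : Finset.HasAntidiagonal.antidiagonal N) →
    Idx p.1.1 a → Idx p.1.2 b → ℚ) : ∃ z ∈ Comp N (a + b), blocks a b N z = g := by
  have hsum : ∀ n : Idx N (a + b),
      (∑ i : Fin a, n.1 (Fin.castAdd b i)) + ∑ i : Fin b, n.1 (Fin.natAdd a i) = N := by
    intro n
    rw [← Fin.sum_univ_add]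
    exact (mem_oddIndices.1 n.2).1
  refine ⟨toWords N (a + b) fun n => g ⟨(_, _), Finset.HasAntidiagonal.mem_antidiagonal.2 (hsum n)⟩
    ⟨fun i => n.1 (Fin.castAdd b i), mem_oddIndices.2 ⟨rfl, fun i => (mem_oddIndices.1 n.2).2 _⟩⟩
    ⟨fun i => n.1 (Fin.natAdd a i), mem_oddIndices.2 ⟨rfl, fun i => (mem_oddIndices.1 n.2).2 _⟩⟩,
    Subtype.property _, ?_⟩
  funext p x y
  obtain ⟨⟨i, j⟩, hp⟩ := p
  obtain ⟨x, hx⟩ := x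
  obtain ⟨y, hy⟩ := y
  have hx' := mem_oddIndices.1 hx
  have hy' := mem_oddIndices.1 hy
  have hm : Fin.append x y ∈ oddIndices N (a + b) := by
    refine mem_oddIndices.2 ⟨?_, fun k => ?_⟩
    · rw [Fin.sum_univ_add]
      simp only [Fin.append_left, Fin.append_right, hx'.1, hy'.1]
      exact Finset.HasAntidiagonal.mem_antidiagonal.1 hp
    · refine Fin.addCases (fun k => ?_) (fun k => ?_) k
      · simpa using hx'.2 k
      · simpa using hy'.2 k
  change (toWords N (a + b) _ : Words) (List.ofFn x ++ List.ofFn y) = _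
  rw [← List.ofFn_fin_append]
  refine (toWords_apply _ ⟨Fin.append x y, hm⟩).trans ?_
  -- The index types depend on the weights of the two halves, which equal `i` and `j` only
  -- propositionally; generalizing allows substitution.
  have key : ∀ (x' : Fin a → ℕ) (y' : Fin b → ℕ) (_ : x' = x) (_ : y' = y)
      (h0 : (∑ i, x' i, ∑ i, y' i) ∈ Finset.HasAntidiagonal.antidiagonal N)
      (h1 : x' ∈ oddIndices (∑ i, x' i) a) (h2 : y' ∈ oddIndices (∑ i, y' i) b),
      g ⟨(∑ i, x' i, ∑ i, y' i), h0⟩ ⟨x', h1⟩ ⟨y', h2⟩ = g ⟨(i, j), hp⟩ ⟨x, hx⟩ ⟨y, hy⟩ := by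
    rintro _ _ rfl rfl h0 h1 h2
    obtain ⟨rfl, -⟩ := hx'
    obtain ⟨rfl, -⟩ := hy'
    rfl
  exact key _ _ (funext fun i => Fin.append_left x y i) (funext fun i => Fin.append_right x y i)
    _ _ _

lemma mem_tens_iff_blocks {a b N : ℕ} {A B : Submodule ℚ Words} {z : Words}
    (hz : z ∈ Comp N (a + b)) : z ∈ tens a b N A B ↔
      ∀ p, blocks a b N z p ∈ matSub (vecSub p.1.1 a A) (vecSub p.1.2 b B) := by
  constructor
  · rintro ⟨-, h1, h2⟩ ⟨⟨i, j⟩, hp⟩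
    have hij := Finset.HasAntidiagonal.mem_antidiagonal.1 hp
    constructor
    · intro x
      have hx := ofFn_mem_wordSet.2 x.2
      exact (vec_mem_vecSub (row_mem_Comp hij hx hz)).2 (h1 _ hx.1)
    · intro y
      have hy := ofFn_mem_wordSet.2 y.2
      exact (vec_mem_vecSub (col_mem_Comp hij hy hz)).2 (h2 _ hy.1)
  · intro h
    refine ⟨hz, fun x hx => ?_, fun y hy => ?_⟩
    · rcases row_eq_zero_or hx hz with h0 | ⟨i, j, hij, hx'⟩
      · rw [h0]
        exact zero_mem _
      · obtain ⟨x, rfl⟩ := exists_ofFn hx'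
        exact (vec_mem_vecSub (row_mem_Comp hij hx' hz)).1
          ((h ⟨(i, j), Finset.HasAntidiagonal.mem_antidiagonal.2 hij⟩).1 x)
    · rcases col_eq_zero_or hy hz with h0 | ⟨i, j, hij, hy'⟩
      · rw [h0]
        exact zero_mem _
      · obtain ⟨y, rfl⟩ := exists_ofFn hy'
        exact (vec_mem_vecSub (col_mem_Comp hij hy' hz)).1
          ((h ⟨(i, j), Finset.HasAntidiagonal.mem_antidiagonal.2 hij⟩).2 y)

/-- Cutting a word after `a` letters decomposes the space into blocks by the weights of the two
parts; each block consists of matrices with rows in `B` and columns in `A`. -/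
lemma finrank_tens (a b N : ℕ) (A B : Submodule ℚ Words) :
    Module.finrank ℚ (tens a b N A B) = ∑ p ∈ Finset.HasAntidiagonal.antidiagonal N,
      Module.finrank ℚ (A ⊓ Comp p.1 a : Submodule ℚ Words) *
        Module.finrank ℚ (B ⊓ Comp p.2 b : Submodule ℚ Words) := by
  let φ : tens a b N A B →ₗ[ℚ] ((p : Finset.HasAntidiagonal.antidiagonal N) →
      matSub (vecSub p.1.1 a A) (vecSub p.1.2 b B)) :=
    { toFun := fun z p => ⟨blocks a b N z.1 p, (mem_tens_iff_blocks z.2.1).1 z.2 p⟩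
      map_add' := fun _ _ => rfl
      map_smul' := fun _ _ => rfl }
  have hφ : Function.Bijective φ := by
    constructor
    · rw [injective_iff_map_eq_zero]
      rintro ⟨z, hz⟩ h
      refine Subtype.ext (blocks_injOn hz.1 (funext fun p => ?_))
      exact congrArg Subtype.val (congrFun h p)
    · intro g
      obtain ⟨z, hz, hg⟩ := blocks_surjective (fun p => (g p).1)
      refine ⟨⟨z, (mem_tens_iff_blocks hz).2 fun p => ?_⟩, funext fun p => Subtype.ext ?_⟩
      · rw [hg]
        exact (g p).2
      · exact congrFun hg p
  rw [(LinearEquiv.ofBijective φ hφ).finrank_eq, Module.finrank_pi_fintype]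
  simp only [finrank_matSub, finrank_vecSub]
  exact Finset.sum_coe_sort (Finset.HasAntidiagonal.antidiagonal N) fun p =>
    Module.finrank ℚ (A ⊓ Comp p.1 a : Submodule ℚ Words) *
        Module.finrank ℚ (B ⊓ Comp p.2 b : Submodule ℚ Words)

/-! ### Polynomials as words: `W_{N,r}` as a tensor product -/

/-- The polynomial `x₁^(n₁-1) ⋯ x_r^(n_r-1)` attached to a word `n₁ ⋯ n_r`. -/
def toPoly (r : ℕ) : Words →ₗ[ℚ] MvPolynomial (Fin r) ℚ :=
  Finsupp.linearCombination ℚ fun l : List ℕ => monomial (expo fun i : Fin r => l.getD i 0) 1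

lemma toPoly_single (r : ℕ) (l : List ℕ) :
    toPoly r (Finsupp.single l 1) = monomial (expo fun i : Fin r => l.getD i 0) 1 := by
  simp [toPoly]

lemma getD_ofFn {r : ℕ} (m : Fin r → ℕ) : (fun i : Fin r => (List.ofFn m).getD i 0) = m := by
  funext i
  simp

lemma coeff_toPoly {N r : ℕ} {z : Words} (hz : z ∈ Comp N r) {n : Fin r → ℕ}
    (hn : ∀ i, IsLetter (n i)) : coeff (expo n) (toPoly r z) = z (List.ofFn n) := by
  refine Comp_eqOn (f := lcoeff ℚ (expo n) ∘ₗ toPoly r) (g := Finsupp.lapply (List.ofFn n))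
    (fun l hl => ?_) hz
  obtain ⟨m, rfl⟩ := exists_ofFn hl
  have hm := (mem_oddIndices.1 m.2).2
  rw [LinearMap.comp_apply, toPoly_single, getD_ofFn, lcoeff_apply, coeff_monomial,
    Finsupp.lapply_apply, Finsupp.single_apply]
  simp only [List.ofFn_inj, expo_inj hm hn]

lemma toPoly_injOn {N r : ℕ} {z : Words} (hz : z ∈ Comp N r) (h : toPoly r z = 0) : z = 0 := by
  ext l
  by_contra hl
  obtain ⟨m, rfl⟩ := exists_ofFn (mem_Comp.1 hz l hl)
  rw [← coeff_toPoly hz (mem_oddIndices.1 m.2).2, h] at hl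
  exact hl rfl

lemma map_toPoly_Comp (N r : ℕ) : (Comp N r).map (toPoly r) = V N r := by
  rw [Comp, Finsupp.supported_eq_span_single, Submodule.map_span, V]
  congr 1
  ext P
  constructor
  · rintro ⟨_, ⟨l, hl, rfl⟩, rfl⟩
    obtain ⟨m, rfl⟩ := exists_ofFn hl
    refine ⟨m, ?_⟩
    rw [toPoly_single, getD_ofFn]
  · rintro ⟨m, rfl⟩
    refine ⟨_, ⟨_, ofFn_mem_wordSet.2 m.2, rfl⟩, ?_⟩
    rw [toPoly_single, getD_ofFn]

/-- The defect of the three-term relation. -/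
def defect (r : ℕ) (hr : 2 ≤ r) : MvPolynomial (Fin r) ℚ →ₗ[ℚ] MvPolynomial (Fin r) ℚ :=
  LinearMap.id - (substA r hr).toLinearMap + (substB r hr).toLinearMap

/-- The elements of the free algebra whose polynomial satisfies the three-term relation. -/
def Period (r : ℕ) (hr : 2 ≤ r) : Submodule ℚ Words := LinearMap.ker (defect r hr ∘ₗ toPoly r)

lemma mem_Period {r : ℕ} {hr : 2 ≤ r} {z : Words} :
    z ∈ Period r hr ↔ defect r hr (toPoly r z) = 0 := Iff.rfl

lemma mem_W_iff_defect {N r : ℕ} {hr : 2 ≤ r} {P : MvPolynomial (Fin r) ℚ} :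
    P ∈ W N r hr ↔ P ∈ V N r ∧ defect r hr P = 0 := by
  rw [mem_W, defect]
  refine and_congr_right fun _ => ?_
  simp only [LinearMap.add_apply, LinearMap.sub_apply, LinearMap.id_apply,
    AlgHom.toLinearMap_apply]
  rw [← sub_eq_zero]
  ring_nf

lemma toPoly_mem_W {N r : ℕ} {hr : 2 ≤ r} {z : Words} (hz : z ∈ Comp N r)
    (h : z ∈ Period r hr) : toPoly r z ∈ W N r hr :=
  mem_W_iff_defect.2 ⟨map_toPoly_Comp N r ▸ Submodule.mem_map_of_mem hz, h⟩

lemma exists_toPoly_eq {N r : ℕ} {hr : 2 ≤ r} {P : MvPolynomial (Fin r) ℚ}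
    (hP : P ∈ W N r hr) : ∃ z ∈ Period r hr ⊓ Comp N r, toPoly r z = P := by
  obtain ⟨hV, h⟩ := mem_W_iff_defect.1 hP
  rw [← map_toPoly_Comp] at hV
  obtain ⟨z, hz, rfl⟩ := hV
  exact ⟨z, ⟨h, hz⟩, rfl⟩

lemma finrank_W_eq (N r : ℕ) (hr : 2 ≤ r) : Module.finrank ℚ (W N r hr) =
    Module.finrank ℚ (Period r hr ⊓ Comp N r : Submodule ℚ Words) := by
  let φ : (Period r hr ⊓ Comp N r : Submodule ℚ Words) →ₗ[ℚ] W N r hr :=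
    { toFun := fun z => ⟨toPoly r z.1, toPoly_mem_W z.2.2 z.2.1⟩
      map_add' := fun z w => Subtype.ext (map_add (toPoly r) z.1 w.1)
      map_smul' := fun c z => Subtype.ext (map_smul (toPoly r) c z.1) }
  have hφ : Function.Bijective φ := by
    constructor
    · rw [injective_iff_map_eq_zero]
      rintro ⟨z, hz⟩ h
      exact Subtype.ext (toPoly_injOn hz.2 (congrArg Subtype.val h))
    · rintro ⟨P, hP⟩
      obtain ⟨z, hz, rfl⟩ := exists_toPoly_eq hP
      exact ⟨⟨z, hz⟩, rfl⟩
  exact (LinearEquiv.ofBijective φ hφ).finrank_eq.symm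

lemma toPoly_single_two (a b : ℕ) :
    toPoly 2 (Finsupp.single [a, b] 1) = X 0 ^ (a - 1) * X 1 ^ (b - 1) := by
  rw [toPoly_single, monomial_fin_two]
  simp [expo]

lemma toPoly_single_cons_cons (k a b : ℕ) (y : List ℕ) :
    toPoly (k + 2) (Finsupp.single (a :: b :: y) 1) =
      rename ![0, 1] (toPoly 2 (Finsupp.single [a, b] 1)) *
        rename Fin.succ (rename Fin.succ (toPoly k (Finsupp.single y 1))) := by
  rw [toPoly_single_two, toPoly_single, toPoly_single, monomial_expo_succ, monomial_expo_succ]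
  simp [mul_assoc]

lemma substA_mul (k : ℕ) (Q : MvPolynomial (Fin 2) ℚ) (R : MvPolynomial (Fin k) ℚ) :
    substA (k + 2) (by omega) (rename ![0, 1] Q * rename Fin.succ (rename Fin.succ R)) =
      rename ![0, 1] (substA 2 le_rfl Q) * rename Fin.succ (rename Fin.succ R) := by
  rw [map_mul]
  congr 1
  · have : (substA (k + 2) (by omega)).comp (rename ![0, 1]) =
        (rename (![0, 1] : Fin 2 → Fin (k + 2))).comp (substA 2 le_rfl) := by
      ext1 i
      fin_cases i <;> simp [substA]
    exact congrArg (fun f => f Q) this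
  · have : (substA (k + 2) (by omega)).comp ((rename Fin.succ).comp (rename Fin.succ)) =
        (rename (Fin.succ : Fin (k + 1) → Fin (k + 2))).comp (rename Fin.succ) := by
      ext1 i
      simp [substA]
    exact congrArg (fun f => f R) this

lemma substB_mul (k : ℕ) (Q : MvPolynomial (Fin 2) ℚ) (R : MvPolynomial (Fin k) ℚ) :
    substB (k + 2) (by omega) (rename ![0, 1] Q * rename Fin.succ (rename Fin.succ R)) =
      rename ![0, 1] (substB 2 le_rfl Q) * rename Fin.succ (rename Fin.succ R) := by
  rw [map_mul]
  congr 1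
  · have : (substB (k + 2) (by omega)).comp (rename ![0, 1]) =
        (rename (![0, 1] : Fin 2 → Fin (k + 2))).comp (substB 2 le_rfl) := by
      ext1 i
      fin_cases i <;> simp [substB]
    exact congrArg (fun f => f Q) this
  · have : (substB (k + 2) (by omega)).comp ((rename Fin.succ).comp (rename Fin.succ)) =
        (rename (Fin.succ : Fin (k + 1) → Fin (k + 2))).comp (rename Fin.succ) := by
      ext1 i
      simp [substB]
    exact congrArg (fun f => f R) this

/-- Both substitutions fix every variable beyond the first two, so the defect is linear over
polynomials in the remaining ones. -/
lemma defect_mul (k : ℕ) (Q : MvPolynomial (Fin 2) ℚ) (R : MvPolynomial (Fin k) ℚ) :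
    defect (k + 2) (by omega) (rename ![0, 1] Q * rename Fin.succ (rename Fin.succ R)) =
      rename ![0, 1] (defect 2 le_rfl Q) * rename Fin.succ (rename Fin.succ R) := by
  simp only [defect, LinearMap.add_apply, LinearMap.sub_apply, LinearMap.id_apply,
    AlgHom.toLinearMap_apply, substA_mul, substB_mul, map_add, map_sub]
  ring

/-- The words of depth `k` that may occur as suffixes of words of weight `N`. -/
def suffixes (N k : ℕ) : Finset (List ℕ) :=
  (Finset.HasAntidiagonal.antidiagonal N).biUnion fun p =>
    (Finset.univ : Finset (Idx p.2 k)).image fun m => List.ofFn m.1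

lemma mem_suffixes {N k : ℕ} {y : List ℕ} :
    y ∈ suffixes N k ↔ ∃ i j, i + j = N ∧ y ∈ wordSet j k := by
  simp only [suffixes, Finset.mem_biUnion, Finset.HasAntidiagonal.mem_antidiagonal,
    Finset.mem_image, Finset.mem_univ, true_and, Prod.exists]
  constructor
  · rintro ⟨i, j, h, m, rfl⟩
    exact ⟨i, j, h, ofFn_mem_wordSet.2 m.2⟩
  · rintro ⟨i, j, h, hy⟩
    exact ⟨i, j, h, exists_ofFn hy⟩

lemma col_single {k : ℕ} {y y₀ : List ℕ} (hy : y.length = k) (hy₀ : y₀.length = k) (x : List ℕ) :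
    col y (Finsupp.single (x ++ y₀) 1) = if y = y₀ then Finsupp.single x 1 else 0 := by
  ext l
  rw [col_apply, Finsupp.single_apply]
  have : x ++ y₀ = l ++ y ↔ y = y₀ ∧ x = l := by
    constructor
    · intro h
      have := List.append_inj' h (by rw [hy, hy₀])
      exact ⟨this.2.symm, this.1⟩
    · rintro ⟨rfl, rfl⟩
      rfl
  simp only [this]
  split_ifs with h1 h2 h2 <;> simp_all

/-- Expansion along suffixes: a map that is bilinear in the first two letters and the rest of a word
is determined by the columns. -/
lemma eq_sum_col {E : Type*} [AddCommGroup E] [Module ℚ E] {N k : ℕ} (f : Words →ₗ[ℚ] E)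
    (g : List ℕ → Words →ₗ[ℚ] E)
    (h : ∀ a b y, IsLetter a → IsLetter b → f (Finsupp.single (a :: b :: y) 1) =
      g y (Finsupp.single [a, b] 1)) {z : Words} (hz : z ∈ Comp N (2 + k)) :
    f z = ∑ y ∈ suffixes N k, g y (col y z) := by
  refine (Comp_eqOn (g := ∑ y ∈ suffixes N k, g y ∘ₗ col y) (fun l hl => ?_) hz).trans
    (by simp [LinearMap.sum_apply])
  have hlen : (l.take 2).length = 2 := by
    rw [List.length_take, hl.1]
    omega
  rw [← List.take_append_drop 2 l] at hl
  obtain ⟨i, j, hij, h1, h2⟩ := (append_mem_wordSet hlen).1 hl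
  obtain ⟨a, b, hab⟩ := List.length_eq_two.1 hlen
  rw [← List.take_append_drop 2 l, hab]
  rw [hab] at h1
  generalize l.drop 2 = y₀ at h2
  rw [LinearMap.sum_apply, Finset.sum_eq_single y₀]
  · rw [LinearMap.comp_apply, col_single h2.1 h2.1, if_pos rfl]
    exact h a b y₀ (h1.2.2 a (by simp)) (h1.2.2 b (by simp))
  · intro y hy hne
    obtain ⟨_, _, _, hy⟩ := mem_suffixes.1 hy
    rw [LinearMap.comp_apply, col_single hy.1 h2.1, if_neg hne, map_zero]
  · intro h
    exact absurd (mem_suffixes.2 ⟨i, j, hij, h2⟩) h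

lemma toPoly_eq_sum {N k : ℕ} {z : Words} (hz : z ∈ Comp N (2 + k)) :
    toPoly (k + 2) z = ∑ y ∈ suffixes N k, rename ![0, 1] (toPoly 2 (col y z)) *
      rename Fin.succ (rename Fin.succ (toPoly k (Finsupp.single y 1))) :=
  eq_sum_col (toPoly (k + 2)) (fun y => LinearMap.mulRight ℚ
    (rename Fin.succ (rename Fin.succ (toPoly k (Finsupp.single y 1)))) ∘ₗ
      (rename ![0, 1]).toLinearMap ∘ₗ toPoly 2)
    (fun a b y _ _ => toPoly_single_cons_cons k a b y) hz

/-- Expanding along suffixes, the defect in depth `k + 2` is a sum of defects of the columns times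
distinct monomials in the remaining variables, so it vanishes iff every column is a period
polynomial. -/
lemma tens_Period (N k : ℕ) : tens 2 k N (Period 2 le_rfl) ⊤ =
    Period (k + 2) (by omega) ⊓ Comp N (2 + k) := by
  ext z
  rw [mem_tens, Submodule.mem_inf]
  have expand : ∀ hz : z ∈ Comp N (2 + k), defect (k + 2) (by omega) (toPoly (k + 2) z) =
      ∑ y ∈ suffixes N k, rename ![0, 1] (defect 2 le_rfl (toPoly 2 (col y z))) *
        rename Fin.succ (rename Fin.succ (toPoly k (Finsupp.single y 1))) := fun hz => by
    rw [toPoly_eq_sum hz, map_sum]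
    simp only [defect_mul]
  constructor
  · rintro ⟨hz, -, hc⟩
    refine ⟨?_, hz⟩
    rw [mem_Period, expand hz]
    refine Finset.sum_eq_zero fun y hy => ?_
    obtain ⟨_, _, _, hy⟩ := mem_suffixes.1 hy
    rw [mem_Period.1 (hc y hy.1), map_zero, zero_mul]
  · rintro ⟨h, hz⟩
    refine ⟨hz, fun _ _ => Submodule.mem_top, fun y' hy' => ?_⟩
    rcases col_eq_zero_or hy' hz with h0 | ⟨i, j, hij, hy'⟩
    · rw [h0]
      exact zero_mem _
    obtain ⟨n, rfl⟩ := exists_ofFn hy'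
    rw [mem_Period] at h ⊢
    ext e
    -- The shifts by one undo the `- 1` in `expo`; the suffix `n` isolates a single column.
    have hc := congrArg (coeff (expo (Fin.cons (e 0 + 1) (Fin.cons (e 1 + 1) n.1)))) h
    rw [expand hz, coeff_sum, Finset.sum_eq_single (List.ofFn n.1), coeff_rename_mul_rename] at hc
    · have h1 : (Finsupp.equivFunOnFinite.symm ![e 0, e 1]) = e := by
        ext i
        fin_cases i <;> simp
      simpa [h1, toPoly_single] using hc
    · intro y hy hne
      obtain ⟨_, _, _, hy⟩ := mem_suffixes.1 hy
      rw [coeff_rename_mul_rename]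
      have : coeff (expo fun i : Fin k => (Fin.cons (e 0 + 1) (Fin.cons (e 1 + 1) n.1) :
          Fin (k + 2) → ℕ) i.succ.succ) (toPoly k (Finsupp.single y 1)) = 0 := by
        simp only [Fin.cons_succ]
        rw [coeff_toPoly (single_mem_Comp hy 1) (mem_oddIndices.1 n.2).2]
        simp [hne]
      rw [this, mul_zero]
    · intro hn
      exact absurd (mem_suffixes.2 ⟨i, j, hij, hy'⟩) hn

/-! ### The relations of `act` on `W_2` ⊗ words -/

lemma emb₂_toPoly {a b : ℕ} (ha : IsLetter a) (hb : IsLetter b) (w : Words) :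
    emb₂ (toPoly 2 (Finsupp.single [a, b] 1)) w = consL a (consL b w) := by
  have h1 := ha.1
  have h2 := hb.1
  rw [toPoly_single_two, emb₂_monomial, Nat.sub_add_cancel (by omega),
    Nat.sub_add_cancel (by omega), if_pos ⟨ha, hb⟩]
  rfl

/-- Expansion of a linear map that acts behind the first two letters. -/
lemma tailMap_tailMap_eq_sum {N k : ℕ} (f : Words →ₗ[ℚ] Words) {z : Words}
    (hz : z ∈ Comp N (2 + k)) : tailMap (tailMap f) z =
      ∑ y ∈ suffixes N k, emb₂ (toPoly 2 (col y z)) (f (Finsupp.single y 1)) :=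
  eq_sum_col (tailMap (tailMap f)) (fun y => LinearMap.applyₗ (f (Finsupp.single y 1)) ∘ₗ emb₂ ∘ₗ
    toPoly 2) (fun a b y ha hb => by
      simp only [LinearMap.comp_apply, LinearMap.applyₗ_apply_apply]
      rw [emb₂_toPoly ha hb, ← consL_single, ← consL_single, tailMap_consL, tailMap_consL]) hz

lemma eq_sum_emb₂ {N k : ℕ} {z : Words} (hz : z ∈ Comp N (2 + k)) :
    z = ∑ y ∈ suffixes N k, emb₂ (toPoly 2 (col y z)) (Finsupp.single y 1) :=
  eq_sum_col LinearMap.id (fun y => LinearMap.applyₗ (Finsupp.single y 1) ∘ₗ emb₂ ∘ₗ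
    toPoly 2) (fun a b y ha hb => by
      simp only [LinearMap.comp_apply, LinearMap.applyₗ_apply_apply]
      rw [emb₂_toPoly ha hb, consL_single, consL_single]
      rfl) hz

lemma exists_toPoly_col_mem_W {N k : ℕ} {z : Words} {B : Submodule ℚ Words}
    (hz : z ∈ tens 2 k N (Period 2 le_rfl) B) {y : List ℕ} (hy : y ∈ suffixes N k) :
    ∃ i, toPoly 2 (col y z) ∈ W i 2 le_rfl := by
  obtain ⟨i, j, hij, hy⟩ := mem_suffixes.1 hy
  exact ⟨i, toPoly_mem_W (col_mem_Comp hij hy hz.1) (hz.2.2 y hy.1)⟩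

/-- By linearity it suffices to treat each column of `z` followed by its suffix, which is the case
`P w`. -/
lemma act_add_tailMap_act_of_mem_tens {N k : ℕ} {z : Words} {B : Submodule ℚ Words}
    (hz : z ∈ tens 2 k N (Period 2 le_rfl) B) : act z + tailMap act z = z := by
  rw [eq_sum_emb₂ hz.1, map_sum, map_sum, ← Finset.sum_add_distrib]
  refine Finset.sum_congr rfl fun y hy => ?_
  obtain ⟨i, hW⟩ := exists_toPoly_col_mem_W hz hy
  exact act_add_tailMap_act hW _

lemma act_tailMap_act_of_mem_tens {N k : ℕ} {z : Words} {B : Submodule ℚ Words}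
    (hz : z ∈ tens 2 k N (Period 2 le_rfl) B) : act (tailMap act z) = 0 := by
  rw [eq_sum_emb₂ hz.1, map_sum, map_sum]
  refine Finset.sum_eq_zero fun y hy => ?_
  obtain ⟨i, hW⟩ := exists_toPoly_col_mem_W hz hy
  exact act_tailMap_act hW _

lemma tailMap_act_tailMap_tailMap_fullAct {N k : ℕ} {z : Words} (hz : z ∈ Comp N (2 + k)) :
    tailMap act (tailMap (tailMap fullAct) z) = tailMap fullAct z := by
  refine Comp_eqOn (f := tailMap act ∘ₗ tailMap (tailMap fullAct)) (g := tailMap fullAct)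
    (fun l hl => ?_) hz
  obtain ⟨a, b, y, rfl⟩ : ∃ a b y, l = a :: b :: y := by
    match l, hl.1 with
    | [], h => rw [List.length_nil] at h; omega
    | [a], h => rw [List.length_singleton] at h; omega
    | a :: b :: y, _ => exact ⟨a, b, y, rfl⟩
  simp only [LinearMap.comp_apply, ← consL_single, tailMap_consL, fullAct_consL]

lemma fullAct_eq {N r : ℕ} {z : Words} (hz : z ∈ Comp N (r + 1)) :
    fullAct z = act (tailMap fullAct z) := by
  refine Comp_eqOn (f := fullAct) (g := act ∘ₗ tailMap fullAct) (fun l hl => ?_) hz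
  obtain ⟨a, y, rfl⟩ := List.exists_cons_of_length_eq_add_one hl.1
  rw [LinearMap.comp_apply, ← consL_single, tailMap_consL, fullAct_consL]

lemma row_singleton_tailMap (f : Words →ₗ[ℚ] Words) (a : ℕ) (z : Words) :
    row [a] (tailMap f z) = f (row [a] z) := by
  have hc : ∀ (b : ℕ) (w : Words), row [a] (consL b w) = if b = a then w else 0 := by
    intro b w
    ext l
    rw [row_apply, List.singleton_append, consL_apply]
    split_ifs <;> rfl
  have : row [a] ∘ₗ tailMap f = f ∘ₗ row [a] := words_ext fun l => by
    cases l with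
    | nil =>
      have h1 : row [a] (Finsupp.single [] 1) = 0 := by
        ext l
        simp
      simp [tailMap, h1]
    | cons b l =>
      rw [LinearMap.comp_apply, LinearMap.comp_apply, ← consL_single, tailMap_consL, hc, hc]
      split_ifs <;> simp
  exact congrArg (fun g => g z) this

lemma row_cons (a : ℕ) (x : List ℕ) (z : Words) : row (a :: x) z = row x (row [a] z) := by
  ext l
  rfl

lemma tailMap_eq_zero {N k : ℕ} {f : Words →ₗ[ℚ] Words} {z : Words} {A : Submodule ℚ Words}
    (hz : z ∈ tens 1 k N A (LinearMap.ker f)) : tailMap f z = 0 := by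
  ext l
  cases l with
  | nil =>
    have : Finsupp.lapply [] ∘ₗ tailMap f = 0 := words_ext fun l => by
      cases l with
      | nil => simp [tailMap]
      | cons a l =>
        rw [LinearMap.comp_apply, ← consL_single, tailMap_consL]
        have : Finsupp.lapply [] ∘ₗ consL a = 0 := words_ext fun l => by simp
        rw [LinearMap.zero_apply]
        exact DFunLike.congr_fun this _
    exact congrArg (fun g => g z) this
  | cons a l =>
    have h := hz.2.1 [a] rfl
    rw [LinearMap.mem_ker, ← row_singleton_tailMap] at h
    exact DFunLike.congr_fun h l

/-! ### Tasaka's map -/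

lemma vecMul_eq_zero_of_mem_rightKer {ι : Type} [Fintype ι] {A : Matrix ι ι ℚ} {u : ι → ℚ} :
    u ∈ rightKer A.transpose ↔ Matrix.vecMul u A = 0 := by
  rw [rightKer, LinearMap.mem_ker, Matrix.mulVecLin_apply, Matrix.mulVec_transpose]

lemma toWords_coeffVec {N r : ℕ} {z : Words} (hz : z ∈ Comp N r) :
    (toWords N r (coeffVec N r (toPoly r z)) : Words) = z := by
  have : toWords N r (coeffVec N r (toPoly r z)) = ⟨z, hz⟩ := by
    rw [← LinearEquiv.eq_symm_apply]
    funext n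
    rw [toWords_symm_apply]
    exact coeff_toPoly hz (mem_oddIndices.1 n.2).2
  rw [this]

lemma toWords_tasakaMap {N r : ℕ} {hr : 2 ≤ r} {z : Words} (hz : z ∈ Comp N r)
    (h : z ∈ Period r hr) :
    (toWords N r (tasakaMap N r hr ⟨toPoly r z, toPoly_mem_W hz h⟩) : Words) = act z - z := by
  have : tasakaMap N r hr ⟨toPoly r z, toPoly_mem_W hz h⟩ =
      Matrix.vecMul (coeffVec N r (toPoly r z)) (E N r) - coeffVec N r (toPoly r z) := by
    change Matrix.vecMul (coeffVec N r (toPoly r z)) (E N r - 1) = _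
    rw [Matrix.vecMul_sub, Matrix.vecMul_one]
  rw [this, map_sub, Submodule.coe_sub, toWords_vecMul_E, toWords_coeffVec hz]

/-- Tasaka's map is `z ↦ act z - z`, so a fixed point of `act` among the period elements lies in its
kernel. -/
lemma eq_zero_of_act_eq_self {N r : ℕ} {hr : 2 ≤ r}
    (hinj : Function.Injective (tasakaMap N r hr)) {z : Words} (hz : z ∈ Comp N r)
    (h : z ∈ Period r hr) (hact : act z = z) : z = 0 := by
  have h1 := toWords_tasakaMap hz h
  rw [hact, sub_self, Submodule.coe_eq_zero, LinearEquiv.map_eq_zero_iff,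
    map_eq_zero_iff _ hinj] at h1
  exact toPoly_injOn hz (congrArg Subtype.val h1)

/-- Tasaka's map takes values in the left kernel of `E_{N,3}`. -/
lemma range_tasakaMap_le (N : ℕ) (hr : 2 ≤ 3) :
    LinearMap.range (tasakaMap N 3 hr) ≤ rightKer (E N 3).transpose := by
  rintro _ ⟨⟨P, hP⟩, rfl⟩
  obtain ⟨z, ⟨hz1, hz2⟩, rfl⟩ := exists_toPoly_eq hP
  rw [vecMul_eq_zero_of_mem_rightKer, ← (toWords N 3).map_eq_zero_iff, ← Submodule.coe_eq_zero,
    toWords_vecMul_E, toWords_tasakaMap hz2 hz1]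
  have hz : z ∈ tens 2 1 N (Period 2 le_rfl) ⊤ := by
    rw [tens_Period]
    exact ⟨hz1, hz2⟩
  have h1 := act_add_tailMap_act_of_mem_tens hz
  have h2 := act_tailMap_act_of_mem_tens hz
  -- Here `act z - z` is `-(tailMap act z)`, which `act` kills.
  rw [← neg_sub, ← eq_sub_iff_add_eq'.2 h1, map_neg, h2, neg_zero]

lemma Period_inf_Comp (N : ℕ) : Module.finrank ℚ (Period 2 le_rfl ⊓ Comp N 2 : Submodule ℚ Words) =
    cuspDim N := by
  rw [← finrank_W_eq, finrank_W_two]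

lemma finrank_Comp (N r : ℕ) : Module.finrank ℚ (Comp N r) = (oddIndices N r).card := by
  rw [← (toWords N r).finrank_eq, Module.finrank_fintype_fun_eq_card, Fintype.card_coe]

lemma finrank_top_inf_Comp (N r : ℕ) :
    Module.finrank ℚ (⊤ ⊓ Comp N r : Submodule ℚ Words) = (oddIndices N r).card := by
  rw [top_inf_eq, finrank_Comp]

lemma finiteDimensional_Comp (N r : ℕ) : FiniteDimensional ℚ (Comp N r) :=
  Module.Finite.equiv (toWords N r)

lemma finrank_W_three (N : ℕ) (hr : 2 ≤ 3) : Module.finrank ℚ (W N 3 hr) =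
    ∑ p ∈ Finset.HasAntidiagonal.antidiagonal N, cuspDim p.1 * (oddIndices p.2 1).card := by
  rw [finrank_W_eq]
  have := finrank_tens 2 1 N (Period 2 le_rfl) ⊤
  rw [tens_Period] at this
  rw [this]
  simp only [Period_inf_Comp, finrank_top_inf_Comp]

/-! ### The recursion for the kernel of the total action -/

/-- The dimension of the kernel of the total Ihara action in weight `N` and depth `r`. -/
def kerDim (N r : ℕ) : ℕ := Module.finrank ℚ (LinearMap.ker fullAct ⊓ Comp N r : Submodule ℚ Words)

lemma finrank_ker_inf_Comp (N r : ℕ) :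
    Module.finrank ℚ (LinearMap.ker fullAct ⊓ Comp N r : Submodule ℚ Words) = kerDim N r := rfl

lemma tens_one_le (N k : ℕ) : tens 1 k N ⊤ (LinearMap.ker fullAct) ≤
    LinearMap.ker fullAct ⊓ Comp N (1 + k) := by
  intro z hz
  refine ⟨?_, hz.1⟩
  have h := hz.1
  rw [add_comm] at h
  rw [SetLike.mem_coe, LinearMap.mem_ker, fullAct_eq h, tailMap_eq_zero hz, map_zero]

/-- Acting behind the first two letters replaces each column by a linear combination of columns, so
the columns remain period polynomials. -/
lemma tailMap_tailMap_fullAct_mem_tens {N k : ℕ} {z : Words}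
    (hz : z ∈ tens 2 k N (Period 2 le_rfl) ⊤) :
    tailMap (tailMap fullAct) z ∈ tens 2 k N (Period 2 le_rfl) ⊤ := by
  refine ⟨isGraded_fullAct.tailMap.tailMap _ _ _ hz.1, fun _ _ => Submodule.mem_top,
    fun y' hy' => ?_⟩
  rw [tailMap_tailMap_eq_sum _ hz.1, map_sum]
  refine Submodule.sum_mem _ fun y hy => ?_
  obtain ⟨i, j, hij, hyw⟩ := mem_suffixes.1 hy
  have hcol := col_mem_Comp hij hyw hz.1
  have h0 : fullAct (Finsupp.single y 1) ∈ Comp j k :=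
    isGraded_fullAct _ _ _ (single_mem_Comp hyw 1)
  have key : col y' (emb₂ (toPoly 2 (col y z)) (fullAct (Finsupp.single y 1))) =
      fullAct (Finsupp.single y 1) y' • col y z := by
    refine Comp_eqOn (f := col y' ∘ₗ LinearMap.applyₗ (fullAct (Finsupp.single y 1)) ∘ₗ emb₂ ∘ₗ
      toPoly 2) (g := fullAct (Finsupp.single y 1) y' • LinearMap.id) (fun l hl => ?_) hcol
    obtain ⟨a, b, rfl⟩ := List.length_eq_two.1 hl.1
    simp only [LinearMap.comp_apply, LinearMap.applyₗ_apply_apply]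
    rw [emb₂_toPoly (hl.2.2 a (by simp)) (hl.2.2 b (by simp)), LinearMap.smul_apply,
      LinearMap.id_apply]
    refine Comp_eqOn (f := col y' ∘ₗ consL a ∘ₗ consL b) (g := LinearMap.toSpanSingleton ℚ Words
      (Finsupp.single [a, b] 1) ∘ₗ Finsupp.lapply y') (fun y₀ hy₀ => ?_) h0
    rw [LinearMap.comp_apply, LinearMap.comp_apply, consL_single, consL_single]
    have := col_single hy' hy₀.1 [a, b]
    rw [List.cons_append, List.cons_append, List.nil_append] at this
    rw [this, LinearMap.comp_apply, Finsupp.lapply_apply, LinearMap.toSpanSingleton_apply,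
      Finsupp.single_apply]
    simp only [eq_comm]
    split_ifs <;> simp
  rw [key]
  exact Submodule.smul_mem _ _ (hz.2.2 y hyw.1)

/-- `fullAct` factors as `act ∘ tailMap act` after the total action behind the first two letters;
the latter preserves `W_2` ⊗ words, where `act ∘ tailMap act` vanishes. -/
lemma tens_two_le (N k : ℕ) : tens 2 k N (Period 2 le_rfl) ⊤ ≤
    LinearMap.ker fullAct ⊓ Comp N (2 + k) := by
  intro z hz
  refine ⟨?_, hz.1⟩
  have h := hz.1
  rw [show 2 + k = k + 1 + 1 by ring] at h
  rw [SetLike.mem_coe, LinearMap.mem_ker, fullAct_eq h, ← tailMap_act_tailMap_tailMap_fullAct hz.1]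
  exact act_tailMap_act_of_mem_tens (tailMap_tailMap_fullAct_mem_tens hz)

/-- Let `z` be the result of acting fully on `v` behind its first two letters. Membership in the
first space gives `tailMap act z = 0`, so `act z = z`; injectivity of Tasaka's map then forces `z =
0`, so the rows of `v` are in the kernel. -/
lemma tens_inf_le {N k : ℕ} (hinj : Function.Injective (tasakaMap N (k + 2) (by omega))) :
    tens 1 (k + 1) N ⊤ (LinearMap.ker fullAct) ⊓ tens 2 k N (Period 2 le_rfl) ⊤ ≤
      tens 2 k N (Period 2 le_rfl) (LinearMap.ker fullAct) := by
  rintro v ⟨h1, h2⟩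
  have hz := tailMap_tailMap_fullAct_mem_tens h2
  have h3 : tailMap act (tailMap (tailMap fullAct) v) = 0 := by
    rw [tailMap_act_tailMap_tailMap_fullAct h2.1, tailMap_eq_zero h1]
  have h4 := act_add_tailMap_act_of_mem_tens hz
  rw [h3, add_zero] at h4
  rw [tens_Period] at hz
  have h5 := hz.2
  rw [add_comm] at h5
  have h6 : tailMap (tailMap fullAct) v = 0 := eq_zero_of_act_eq_self hinj h5 hz.1 h4
  refine ⟨h2.1, fun x hx => ?_, h2.2.2⟩
  obtain ⟨a, b, rfl⟩ := List.length_eq_two.1 hx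
  rw [LinearMap.mem_ker, row_cons, ← row_singleton_tailMap, ← row_singleton_tailMap, h6, map_zero,
    map_zero]

/-- The recursive lower bound for the kernel of the total Ihara action. -/
lemma kerDim_add_le {N k : ℕ} (hinj : Function.Injective (tasakaMap N (k + 2) (by omega))) :
    (∑ p ∈ Finset.HasAntidiagonal.antidiagonal N, (oddIndices p.1 1).card * kerDim p.2 (k + 1)) +
      ∑ p ∈ Finset.HasAntidiagonal.antidiagonal N, cuspDim p.1 * (oddIndices p.2 k).card ≤
    kerDim N (k + 2) +
      ∑ p ∈ Finset.HasAntidiagonal.antidiagonal N, cuspDim p.1 * kerDim p.2 k := by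
  have e1 := finrank_tens 1 (k + 1) N ⊤ (LinearMap.ker fullAct)
  have e2 := finrank_tens 2 k N (Period 2 le_rfl) ⊤
  have e3 := finrank_tens 2 k N (Period 2 le_rfl) (LinearMap.ker fullAct)
  simp only [Period_inf_Comp, finrank_top_inf_Comp, finrank_ker_inf_Comp] at e1 e2 e3
  rw [← e1, ← e2, ← e3]
  have l1 := tens_one_le N (k + 1)
  have l2 := tens_two_le N k
  rw [show 1 + (k + 1) = k + 2 by ring] at l1
  rw [show 2 + k = k + 2 by ring] at l2
  have f0 := finiteDimensional_Comp N (k + 2)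
  have f0' : FiniteDimensional ℚ (LinearMap.ker fullAct ⊓ Comp N (k + 2) : Submodule ℚ Words) :=
    Submodule.finiteDimensional_of_le inf_le_right
  have f1 := Submodule.finiteDimensional_of_le l1
  have f2 := Submodule.finiteDimensional_of_le l2
  have f3 : FiniteDimensional ℚ (tens 2 k N (Period 2 le_rfl) (LinearMap.ker fullAct)) :=
    Submodule.finiteDimensional_of_le (le_trans
      (fun z hz => mem_tens.2 ⟨hz.1, fun _ _ => Submodule.mem_top, hz.2.2⟩) l2)
  -- The sum of the two subspaces lies in the kernel, and their intersection is bounded by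
  -- `tens_inf_le`.
  rw [← Submodule.finrank_sup_add_finrank_inf_eq]
  exact add_le_add (Submodule.finrank_mono (sup_le l1 l2))
    (Submodule.finrank_mono (tens_inf_le hinj))

lemma kerDim_zero (N : ℕ) : kerDim N 0 = 0 := by
  have : LinearMap.ker fullAct ⊓ Comp N 0 = ⊥ := by
    rw [eq_bot_iff]
    rintro z ⟨h1, h2⟩
    rw [SetLike.mem_coe, LinearMap.mem_ker] at h1
    rw [Submodule.mem_bot, ← h1]
    refine Comp_eqOn (f := LinearMap.id) (g := fullAct) (fun l hl => ?_) h2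
    rw [List.length_eq_zero_iff.1 hl.1, fullAct_nil]
    rfl
  rw [kerDim, this, finrank_bot]

lemma kerDim_one (N : ℕ) : kerDim N 1 = 0 := by
  have : LinearMap.ker fullAct ⊓ Comp N 1 = ⊥ := by
    rw [eq_bot_iff]
    rintro z ⟨h1, h2⟩
    rw [SetLike.mem_coe, LinearMap.mem_ker] at h1
    rw [Submodule.mem_bot, ← h1]
    refine Comp_eqOn (f := LinearMap.id) (g := fullAct) (fun l hl => ?_) h2
    obtain ⟨a, rfl⟩ := List.length_eq_one_iff.1 hl.1
    rw [← consL_single, fullAct_consL, fullAct_nil, act_consL, der_single, derWord, add_zero]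
    rfl
  rw [kerDim, this, finrank_bot]

/-- Left and right kernels of a square matrix have equal dimension, and the left kernel is that of
`fullAct`. -/
lemma finrank_rightKer_C_five (N : ℕ) : Module.finrank ℚ (rightKer (C N 5)) = kerDim N 5 := by
  have h1 : Module.finrank ℚ (rightKer (C N 5)) =
      Module.finrank ℚ (rightKer (C N 5).transpose) := by
    have a := (C N 5).mulVecLin.finrank_range_add_finrank_ker
    have b := (C N 5).transpose.mulVecLin.finrank_range_add_finrank_ker
    have c := (C N 5).rank_transpose
    rw [Matrix.rank, Matrix.rank] at c
    rw [rightKer, rightKer]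
    omega
  have h2 : rightKer (C N 5).transpose = vecSub N 5 (LinearMap.ker fullAct) := by
    ext u
    rw [vecMul_eq_zero_of_mem_rightKer, mem_vecSub, LinearMap.mem_ker, ← toWords_vecMul_C_five,
      Submodule.coe_eq_zero, LinearEquiv.map_eq_zero_iff]
  rw [h1, h2, finrank_vecSub, kerDim]

end TotallyOdd

end

/-! ### Generating series and the inequality in depth five -/

noncomputable section
namespace TotallyOdd

lemma card_oddIndices_one (N : ℕ) : (oddIndices N 1).card = if IsLetter N then 1 else 0 := by
  split_ifs with h
  · rw [Finset.card_eq_one]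
    refine ⟨fun _ => N, ?_⟩
    ext m
    rw [mem_oddIndices, Finset.mem_singleton]
    constructor
    · rintro ⟨h1, -⟩
      funext i
      rw [Subsingleton.elim i 0, ← h1]
      simp
    · rintro rfl
      exact ⟨by simp, fun _ => h⟩
  · rw [Finset.card_eq_zero, Finset.eq_empty_iff_forall_notMem]
    intro m hm
    obtain ⟨h1, h2⟩ := mem_oddIndices.1 hm
    rw [Fin.sum_univ_one] at h1
    exact h (h1 ▸ h2 0)

lemma card_oddIndices_zero (N : ℕ) : (oddIndices N 0).card = if N = 0 then 1 else 0 := by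
  split_ifs with h
  · subst h
    rw [Finset.card_eq_one]
    refine ⟨Fin.elim0, ?_⟩
    ext m
    simp [mem_oddIndices, Subsingleton.elim m Fin.elim0]
  · rw [Finset.card_eq_zero, Finset.eq_empty_iff_forall_notMem]
    intro m hm
    exact h (by simpa using (mem_oddIndices.1 hm).1.symm)

lemma card_oddIndices_add (a b N : ℕ) : (oddIndices N (a + b)).card =
    ∑ p ∈ Finset.HasAntidiagonal.antidiagonal N,
      (oddIndices p.1 a).card * (oddIndices p.2 b).card := by
  have h : tens a b N ⊤ ⊤ = ⊤ ⊓ Comp N (a + b) := by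
    ext z
    simp [mem_tens]
  have := finrank_tens a b N ⊤ ⊤
  rw [h] at this
  simpa only [finrank_top_inf_Comp] using this

/-- The power series with natural coefficients, over the rationals. -/
def natSeries (f : ℕ → ℕ) : PowerSeries ℚ := PowerSeries.mk fun n => (f n : ℚ)

lemma coeff_natSeries (f : ℕ → ℕ) (n : ℕ) : PowerSeries.coeff n (natSeries f) = f n :=
  PowerSeries.coeff_mk ..

lemma coeff_natSeries_mul (f g : ℕ → ℕ) (n : ℕ) :
    PowerSeries.coeff n (natSeries f * natSeries g) =
      ((∑ p ∈ Finset.HasAntidiagonal.antidiagonal n, f p.1 * g p.2 : ℕ) : ℚ) := by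
  rw [PowerSeries.coeff_mul]
  push_cast
  simp only [coeff_natSeries]

lemma oddSeries_eq : oddSeries = natSeries fun N => (oddIndices N 1).card := by
  rw [oddSeries, eq_comm, PowerSeries.eq_mul_inv_iff_mul_eq (by simp)]
  ext n
  rw [mul_sub, mul_one, map_sub, PowerSeries.coeff_mul_X_pow', coeff_natSeries,
    PowerSeries.coeff_X_pow]
  simp only [coeff_natSeries, card_oddIndices_one, IsLetter, Nat.odd_iff]
  split_ifs <;> first | omega | simp

/-- Clearing denominators leaves a four-term recurrence for `cuspDim` with a single source at `n =
12`. -/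
lemma cuspSeries_eq : cuspSeries = natSeries cuspDim := by
  rw [cuspSeries, eq_comm, PowerSeries.eq_mul_inv_iff_mul_eq (by simp)]
  have h : natSeries cuspDim * ((1 - PowerSeries.X ^ 4) * (1 - PowerSeries.X ^ 6)) =
      natSeries cuspDim - natSeries cuspDim * PowerSeries.X ^ 4 -
        natSeries cuspDim * PowerSeries.X ^ 6 + natSeries cuspDim * PowerSeries.X ^ 10 := by
    ring
  rw [h]
  ext n
  simp only [map_sub, map_add, PowerSeries.coeff_mul_X_pow', coeff_natSeries,
    PowerSeries.coeff_X_pow]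
  have key : cuspDim n + (if 10 ≤ n then cuspDim (n - 10) else 0) =
      (if 4 ≤ n then cuspDim (n - 4) else 0) + (if 6 ≤ n then cuspDim (n - 6) else 0) +
        (if n = 12 then 1 else 0) := by
    simp only [cuspDim, Nat.even_iff]
    split_ifs <;> omega
  have key' : (cuspDim n : ℚ) + (if 10 ≤ n then (cuspDim (n - 10) : ℚ) else 0) =
      (if 4 ≤ n then (cuspDim (n - 4) : ℚ) else 0) +
        (if 6 ≤ n then (cuspDim (n - 6) : ℚ) else 0) + (if n = 12 then 1 else 0) := by
    exact_mod_cast key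
  linarith

lemma natSeries_card (r : ℕ) : natSeries (fun N => (oddIndices N r).card) = oddSeries ^ r := by
  induction r with
  | zero =>
    ext n
    rw [coeff_natSeries, card_oddIndices_zero, pow_zero, PowerSeries.coeff_one]
    split_ifs <;> simp
  | succ r ih =>
    rw [pow_succ, ← ih, oddSeries_eq]
    ext n
    rw [coeff_natSeries, coeff_natSeries_mul, card_oddIndices_add]

/-- A power series has nonnegative coefficients. -/
def IsNonneg (f : PowerSeries ℚ) : Prop := ∀ n, 0 ≤ PowerSeries.coeff n f

lemma IsNonneg.add {f g : PowerSeries ℚ} (hf : IsNonneg f) (hg : IsNonneg g) :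
    IsNonneg (f + g) := fun n => by
  rw [map_add]
  exact add_nonneg (hf n) (hg n)

lemma IsNonneg.mul {f g : PowerSeries ℚ} (hf : IsNonneg f) (hg : IsNonneg g) :
    IsNonneg (f * g) := fun n => by
  rw [PowerSeries.coeff_mul]
  exact Finset.sum_nonneg fun p _ => mul_nonneg (hf _) (hg _)

lemma isNonneg_natSeries (f : ℕ → ℕ) : IsNonneg (natSeries f) := fun n => by
  rw [coeff_natSeries]
  positivity

lemma card_oddIndices_two (N : ℕ) :
    (oddIndices N 2).card = if Even N then (N - 4) / 2 else 0 := by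
  let g : ℕ → ℕ := fun N => if Even N then (N - 4) / 2 else 0
  have hne : (1 - PowerSeries.X ^ 2 : PowerSeries ℚ) ≠ 0 := fun h => by
    have := congrArg (PowerSeries.constantCoeff (R := ℚ)) h
    simp at this
  have h1 : oddSeries * (1 - PowerSeries.X ^ 2) = PowerSeries.X ^ 3 := by
    rw [← PowerSeries.eq_mul_inv_iff_mul_eq (by simp), oddSeries]
  have h2 : natSeries g * (1 - PowerSeries.X ^ 2) = oddSeries * PowerSeries.X ^ 3 := by
    rw [oddSeries_eq]
    ext n
    rw [mul_sub, mul_one, map_sub, PowerSeries.coeff_mul_X_pow', PowerSeries.coeff_mul_X_pow']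
    simp only [coeff_natSeries, card_oddIndices_one, IsLetter, Nat.odd_iff]
    have key : g n = (if 2 ≤ n then g (n - 2) else 0) +
        (if 3 ≤ n then (if 3 ≤ n - 3 ∧ (n - 3) % 2 = 1 then 1 else 0) else 0) := by
      simp only [g, Nat.even_iff]
      split_ifs <;> omega
    have key' : (g n : ℚ) = (if 2 ≤ n then (g (n - 2) : ℚ) else 0) +
        (if 3 ≤ n then ((if 3 ≤ n - 3 ∧ (n - 3) % 2 = 1 then 1 else 0 : ℕ) : ℚ) else 0) := by
      exact_mod_cast key
    rw [key']
    ring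
  have h3 : oddSeries ^ 2 = natSeries g := by
    refine mul_right_cancel₀ hne ?_
    rw [h2, ← h1]
    ring
  have h4 := congrArg (PowerSeries.coeff N) (natSeries_card 2)
  rw [h3, coeff_natSeries, coeff_natSeries] at h4
  exact_mod_cast h4

/-- Supplies the nonnegativity of `𝕆² - 2𝕊` needed for the multipliers in the depth five bound. -/
lemma two_mul_cuspDim_le (N : ℕ) : 2 * cuspDim N ≤ (oddIndices N 2).card := by
  rw [card_oddIndices_two, cuspDim]
  split_ifs <;> omega

lemma isNonneg_sub {f g : ℕ → ℕ} (h : ∀ n, g n ≤ f n) : IsNonneg (natSeries f - natSeries g) :=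
  fun n => by
    rw [map_sub, coeff_natSeries, coeff_natSeries, sub_nonneg]
    exact_mod_cast h n

/-- The generating series of the dimensions `kerDim N r`. -/
def kerSeries (r : ℕ) : PowerSeries ℚ := natSeries fun N => kerDim N r

lemma isNonneg_kerSeries_sub {k : ℕ}
    (hinj : ∀ N, Function.Injective (tasakaMap N (k + 2) (by omega))) :
    IsNonneg (kerSeries (k + 2) + cuspSeries * kerSeries k - oddSeries * kerSeries (k + 1) -
      cuspSeries * oddSeries ^ k) := fun N => by
  have h : (((∑ p ∈ Finset.HasAntidiagonal.antidiagonal N,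
      (oddIndices p.1 1).card * kerDim p.2 (k + 1)) +
      ∑ p ∈ Finset.HasAntidiagonal.antidiagonal N, cuspDim p.1 * (oddIndices p.2 k).card : ℕ) : ℚ)
      ≤ ((kerDim N (k + 2) +
      ∑ p ∈ Finset.HasAntidiagonal.antidiagonal N, cuspDim p.1 * kerDim p.2 k : ℕ) : ℚ) :=
    Nat.cast_le.2 (kerDim_add_le (hinj N))
  rw [Nat.cast_add, Nat.cast_add] at h
  rw [← natSeries_card, oddSeries_eq, cuspSeries_eq, kerSeries, kerSeries, kerSeries]
  simp only [map_sub, map_add, coeff_natSeries_mul, coeff_natSeries]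
  linarith

lemma isNonneg_kerSeries_five_sub
    (hinj : ∀ (r : ℕ) (hr : 2 ≤ r) (N : ℕ), Function.Injective (tasakaMap N r hr)) :
    IsNonneg (kerSeries 5 - (4 * oddSeries ^ 3 * cuspSeries - 3 * oddSeries * cuspSeries ^ 2)) := by
  have k0 : kerSeries 0 = 0 := by
    ext n
    simp [kerSeries, coeff_natSeries, kerDim_zero]
  have k1 : kerSeries 1 = 0 := by
    ext n
    simp [kerSeries, coeff_natSeries, kerDim_one]
  have h2 := isNonneg_kerSeries_sub (k := 0) (hinj 2 _)
  have h3 := isNonneg_kerSeries_sub (k := 1) (hinj 3 _)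
  have h4 := isNonneg_kerSeries_sub (k := 2) (hinj 4 _)
  have h5 := isNonneg_kerSeries_sub (k := 3) (hinj 5 _)
  simp only [Nat.reduceAdd, k0, k1] at h2 h3 h4 h5
  have ho : IsNonneg oddSeries := oddSeries_eq ▸ isNonneg_natSeries _
  have hs : IsNonneg cuspSeries := cuspSeries_eq ▸ isNonneg_natSeries _
  have hos : IsNonneg (oddSeries ^ 2 - (cuspSeries + cuspSeries)) := by
    have e : cuspSeries + cuspSeries = natSeries fun N => 2 * cuspDim N := by
      rw [cuspSeries_eq]
      ext n
      simp only [map_add, coeff_natSeries]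
      push_cast
      ring
    rw [e, ← natSeries_card]
    exact isNonneg_sub two_mul_cuspDim_le
  have hos' : IsNonneg (oddSeries ^ 2 - cuspSeries) := by
    have := hos.add hs
    rwa [show oddSeries ^ 2 - (cuspSeries + cuspSeries) + cuspSeries = oddSeries ^ 2 - cuspSeries
      by ring] at this
  -- The multipliers `1`, `𝕆`, `𝕆² - 𝕊`, `𝕆 (𝕆² - 2𝕊)` are chosen to eliminate the series of depths
  -- 4, 3 and 2 in turn.
  have := ((h5.add (ho.mul h4)).add (hos'.mul h3)).add ((ho.mul hos).mul h2)
  convert this using 1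
  ring

end TotallyOdd
end

/-! ### The main theorem -/

theorem mainTheorem3
    (hinj : ∀ (r : ℕ) (hr : 2 ≤ r) (N : ℕ),
      Function.Injective (TotallyOdd.tasakaMap N r hr)) :
    (TotallyOdd.TasakaIso 3 (by norm_num) ↔
      TotallyOdd.genSeries (fun N =>
          Module.finrank ℚ (TotallyOdd.rightKer (TotallyOdd.E N 3).transpose)) =
        TotallyOdd.oddSeries * TotallyOdd.cuspSeries) ∧
    (TotallyOdd.genSeries (fun N =>
          Module.finrank ℚ (TotallyOdd.rightKer (TotallyOdd.E N 3).transpose)) =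
        TotallyOdd.oddSeries * TotallyOdd.cuspSeries →
      ∀ N : ℕ,
        PowerSeries.coeff N
            (4 * TotallyOdd.oddSeries ^ 3 * TotallyOdd.cuspSeries -
              3 * TotallyOdd.oddSeries * TotallyOdd.cuspSeries ^ 2) ≤
          PowerSeries.coeff N
            (TotallyOdd.genSeries fun N =>
              Module.finrank ℚ (TotallyOdd.rightKer (TotallyOdd.C N 5)))) := by
  open TotallyOdd in
  -- `genSeries` drops the term `N = 0`; this loses nothing, since there are no indices of weight
  -- zero.
  have hempty : ∀ r, 0 < r → IsEmpty (Idx 0 r) := fun r hr => by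
    refine ⟨fun m => ?_⟩
    obtain ⟨h1, h2⟩ := mem_oddIndices.1 m.2
    have := (Finset.sum_eq_zero_iff.1 h1) ⟨0, hr⟩ (Finset.mem_univ _)
    have := (h2 ⟨0, hr⟩).1
    omega
  refine ⟨?_, fun _ N => ?_⟩
  · have hW : ∀ N, PowerSeries.coeff N (oddSeries * cuspSeries) =
        (Module.finrank ℚ (LinearMap.range (tasakaMap N 3 (by norm_num))) : ℚ) := fun N => by
      rw [LinearMap.finrank_range_of_inj (hinj 3 _ N), finrank_W_three, mul_comm, oddSeries_eq,
        cuspSeries_eq, coeff_natSeries_mul]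
    constructor
    · intro h
      ext N
      rw [hW, (h N).2, genSeries, PowerSeries.coeff_mk]
      split_ifs with hN
      · rfl
      · obtain rfl : N = 0 := by omega
        have := hempty 3 (by norm_num)
        rw [Module.finrank_zero_of_subsingleton, Nat.cast_zero]
    · intro h N
      refine ⟨hinj 3 _ N, ?_⟩
      rcases Nat.eq_zero_or_pos N with rfl | hN
      · have := hempty 3 (by norm_num)
        exact Subsingleton.elim _ _
      · have h1 := congrArg (PowerSeries.coeff N) h
        rw [hW, genSeries, PowerSeries.coeff_mk, if_pos hN] at h1
        -- The image is contained in the left kernel, so equality of dimensions gives surjectivity.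
        exact Submodule.eq_of_le_of_finrank_eq (range_tasakaMap_le N _) (by exact_mod_cast h1.symm)
  · have h := isNonneg_kerSeries_five_sub hinj N
    rw [map_sub, sub_nonneg] at h
    refine h.trans (le_of_eq ?_)
    rw [kerSeries, coeff_natSeries, ← finrank_rightKer_C_five, genSeries, PowerSeries.coeff_mk]
    split_ifs with hN
    · rfl
    · obtain rfl : N = 0 := by omega
      have := hempty 5 (by norm_num)
      rw [Module.finrank_zero_of_subsingleton, Nat.cast_zero]
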